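/- Throughout, "connected" means path-connected and "component" means path component; homology is singular with $\mathbb Z/2$ coefficients. **Morse type.** A continuous $f:X\to\mathbb R$ is of Morse type if there are finitely many critical values $a_1<\dots<a_n$ in $\mathrm{im}(f)$ such that, with $a_0=-\infty$, $a_{n+1}=+\infty$: for every $i=0,\dots,n$ there are a compact locally connected space $Y_i$ and a homeomorphism $\mu_i:Y_i\times(a_i,a_{i+1})\to f^{-1}(a_i,a_{i+1})$ with $f\circ\mu_i=\pi_2$, which extends to a continuous map $\bar\mu_i:Y_i\times([a_i,a_{i+1}]\cap\mathbb R)\to f^{-1}([a_i,a_{i+1}])$; and every level set of $f$ has finitely generated homology groups. **Telescopes.** A telescope with critical values $a_1<\dots<a_n$, cylinders $Y_i$, slices $X_i$ and continuous attaching maps $\psi_{i-1}:Y_{i-1}\to X_i$, $\phi_i:Y_i\to X_i$ is the adjunction space $$T=(Y_0\times(-\infty,a_1])\cup_{\psi_0}(X_1\times\{a_1\})\cup_{\phi_1}(Y_1\times[a_1,a_2])\cup_{\psi_1}\dots\cup_{\phi_n}(Y_n\times[a_n,+\infty)),$$ with second projection $\pi_2:T\to\mathbb R$; put $T^{[a,b]}=\pi_2^{-1}[a,b]$.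 The telescope $T_X$ of $f$ has the critical values and cylinders of $f$, the slices $X_i=f^{-1}(a_i)$, and attaching maps the restrictions of the $\bar\mu_i$. - $\mathrm{Merge}_{a,b}$ ($a\le b$) replaces the critical values in $[a,b]$ (possibly none) by the single critical value $\frac{a+b}2$ with slice $T^{[a,b]}$; the cylinder $Y$ of $T$ just below, resp. just above, is attached by $y\mapsto[(y,a)]$, resp. $y\mapsto[(y,b)]$. - $\mathrm{Split}_{\epsilon,c}$ replaces the critical value $c$ with slice $S$ by the critical values $c-\epsilon$ and $c+\epsilon$, both with slice $S$, with the cylinder $S\times[c-\epsilon,c+\epsilon]$ attached by identities between them; $c-\epsilon$ is called a down-fork and $c+\epsilon$ an up-fork. - $\mathrm{Shift}_{\epsilon,c}$ moves the critical value $c$ to $c+\epsilon$ and keeps all slices, cylinders and attaching maps. **Gomics.** A gomic $\mathcal I$ of $Z\subseteq\mathbb R$ is a cover of $Z$ by relatively open sets of the form $J\cap Z$ with $J$ an interval, which is minimal (no proper subfamily covers $Z$) and generic: no component of a proper part $\tilde I=I\setminus\bigcup_{J\in\mathcal I,J\ne I}J$ is a singleton. Write $a_{\tilde I}=\inf\tilde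 I$, $b_{\tilde I}=\sup\tilde I$, and let $\mathrm{End}(\mathcal I)$ be the set of all these numbers (if $Z$ is an interval, this is the set of the endpoints of the elements of $\mathcal I$). **Perturbation.** For every non-empty intersection $I\cap J$ of two distinct elements of $\mathcal I$ fix $a_{I\cap J}\le b_{I\cap J}$ in $I\cap J$ such that all critical values of $f$ in $I\cap J$ lie in $[a_{I\cap J},b_{I\cap J}]$. Let $$T'_X=\mathrm{Merge}'_{\mathcal I}\circ\mathrm{Shift}_{\mathcal I}\circ\mathrm{Split}_{\mathcal I}\circ\mathrm{Merge}_{\mathcal I}(T_X),$$ where: $\mathrm{Merge}_{\mathcal I}$ is the composition of all $\mathrm{Merge}_{a_{\tilde I},b_{\tilde I}}$ and all $\mathrm{Merge}_{a_{I\cap J},b_{I\cap J}}$; $\mathrm{Split}_{\mathcal I}$ is the composition of the $\mathrm{Split}_{\epsilon(c),c}$ over all critical values $c$ after $\mathrm{Merge}_{\mathcal I}$, with any $\epsilon(c)>0$ such that $\epsilon(c)<\min\{c-a,b-c\}$ for consecutive $a<c<b$ in $\mathrm{End}(\mathcal I)$; $\mathrm{Shift}_{\mathcal I}$ shifts, for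 each such $c$ with $b_{\tilde I}<c<a_{\tilde J}$ for some $I,J\in\mathcal I$ with $I\cap J\neq\emptyset$, the up-fork $c+\epsilon(c)$ to any point of $(a_{\tilde J},b_{\tilde J})$ below the next critical value, and the down-fork $c-\epsilon(c)$ to any point of $(a_{\tilde I},b_{\tilde I})$ above the previous critical value; $\mathrm{Merge}'_{\mathcal I}$ is the composition of all $\mathrm{Merge}_{a_{\tilde I},b_{\tilde I}}$. (Within each step the operations commute; they are performed from the lowest to the highest.) Let $f':T'_X\to\mathbb R$ be the second projection. **Graphs.** The MultiNerve Mapper $\overline{\mathrm M}_f(X,\mathcal I)$ is the multinerve of the cover of $X$ by the sets $V_{(I,C)}=C$, indexed by the pairs $(I,C)$ with $I\in\mathcal I$ and $C$ a component of $f^{-1}(I)$: its simplices are the pairs $(F,D)$ of a finite non-empty set $F$ of indices and a component $D$ of $\bigcap_{v\in F}V_v$, together with the least element $(\emptyset,X)$; $(F,D)$ is a face of $(F',D')$ if $F\subseteq F'$ and $D'\subseteq D$; the dimension is $|F|-1$. If it has dimension at most $1$, it is a multigraph: its nodes and edges are the simplices of dimensions $0$ and $1$, and the ends of an edge are its $0$-dimensional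 faces. The combinatorial Reeb graph $\mathcal C(\mathrm R_{f'}(T'_X))$ is the multigraph whose nodes are the components of the level sets of $f'$ over the critical values of $T'_X$, and whose edges are the components of $f'^{-1}(s,t)$ for consecutive critical values $s<t$ of $T'_X$; the ends of such an edge are the nodes over $s$ that are joined to it by a path in $f'^{-1}[s,t)$ and the nodes over $t$ that are joined to it by a path in $f'^{-1}(s,t]$. **Theorem.** Let $X$ be a Hausdorff space, let $f:X\to\mathbb R$ be of Morse type with bounded image (for instance, $X$ compact), and let $\mathcal I$ be a gomic of $\mathrm{im}(f)$. For every $T'_X$ as above (all admissible choices of the $\mu_i$, of the $[a_{I\cap J},b_{I\cap J}]$, and of the amplitudes of the Splits and Shifts), $\overline{\mathrm M}_f(X,\mathcal I)$ has dimension at most $1$ and is isomorphic, as a multigraph, to $\mathcal C(\mathrm R_{f'}(T'_X))$. -/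

import Mathlib

open Set Topology

universe u

noncomputable section

/-! ### Path components

"Connected" means "path-connected" throughout, and a "component" is a path component. -/

/-- `C` is a component of the subset `S`. -/
def IsPathComponentOf {X : Type u} [TopologicalSpace X] (S C : Set X) : Prop :=
  ∃ x ∈ S, C = pathComponentIn S x

/-- `a < b` are consecutive elements of the set `S` of real numbers. -/
def Consecutive (S : Set ℝ) (a b : ℝ) : Prop :=
  a ∈ S ∧ b ∈ S ∧ a < b ∧ ∀ c ∈ S, ¬ (a < c ∧ c < b)

/-! ### Multigraphs -/

/-- A multigraph: nodes, edges, and for every edge the set of its end nodes. -/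
structure Multigraph where
  Node : Type u
  Edge : Type u
  ends : Edge → Set Node

/-- An isomorphism of multigraphs: a bijection of the nodes and a bijection of the edges which are
compatible with the end nodes. -/
structure Multigraph.Iso (G H : Multigraph) where
  node : G.Node ≃ H.Node
  edge : G.Edge ≃ H.Edge
  map_ends : ∀ e, H.ends (edge e) = node '' G.ends e

/-! ### Morse-type functions -/

/-- The open interval `(a_i, a_{i+1})` for `i = 0, …, n`, where the real numbers `a_1 < … < a_n` are
stored as `a 0, …, a (n-1)` and where `a_0 = -∞`, `a_{n+1} = +∞`. -/
def openGap {n : ℕ} (a : Fin n → ℝ) (i : Fin (n + 1)) : Set ℝ :=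
  {t | (∀ j : Fin n, j.castSucc < i → a j < t) ∧ (∀ j : Fin n, i ≤ j.castSucc → t < a j)}

/-- The closed interval `[a_i, a_{i+1}] ∩ ℝ` for `i = 0, …, n`, with the same conventions. -/
def closedGap {n : ℕ} (a : Fin n → ℝ) (i : Fin (n + 1)) : Set ℝ :=
  {t | (∀ j : Fin n, j.castSucc < i → a j ≤ t) ∧ (∀ j : Fin n, i ≤ j.castSucc → t ≤ a j)}

/-- All the singular homology groups of `S` with coefficients in `ℤ/2` are finitely generated. -/
def HasFGHomology (S : TopCat.{u}) : Prop :=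
  ∀ k : ℕ, Module.Finite (ZMod 2)
    (((AlgebraicTopology.singularHomologyFunctor (ModuleCat.{u} (ZMod 2)) k).obj
      (ModuleCat.of (ZMod 2) (ULift.{u} (ZMod 2)))).obj S)

/-- `f` is of Morse type, with critical values `a_1 < … < a_n` (stored as `crit`), with cylinders
`Y_0, …, Y_n`, with homeomorphisms `μ_i : Y_i × (a_i, a_{i+1}) → f⁻¹(a_i, a_{i+1})` over the open
intervals, and with their continuous extensions to the closed intervals. -/
structure MorseType {X : Type u} [TopologicalSpace X] (f : X → ℝ) where
  continuous : Continuous f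
  n : ℕ
  crit : Fin n → ℝ
  strictMono : StrictMono crit
  crit_mem : ∀ i, crit i ∈ range f
  Y : Fin (n + 1) → TopCat.{u}
  compact : ∀ i, CompactSpace (Y i)
  locConnected : ∀ i, LocallyPathConnectedSpace (Y i)
  μ : ∀ i, (Y i × openGap crit i) ≃ₜ (f ⁻¹' openGap crit i)
  f_μ : ∀ i p, f (μ i p) = p.2
  μbar : ∀ i, C(Y i × closedGap crit i, f ⁻¹' closedGap crit i)
  μbar_eq : ∀ i (y : Y i) (t : ℝ) (h : t ∈ openGap crit i) (h' : t ∈ closedGap crit i),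
    (μbar i (y, ⟨t, h'⟩) : X) = μ i (y, ⟨t, h⟩)
  homology : ∀ t : ℝ, HasFGHomology (TopCat.of (f ⁻¹' {t}))

/-! ### Telescopes -/

/-- The data of a telescope
`(Y_0 × (-∞, a_1]) ∪_{ψ_0} (X_1 × {a_1}) ∪_{φ_1} (Y_1 × [a_1, a_2]) ∪_{ψ_1} … ∪_{φ_n} (Y_n × [a_n, ∞))`
with lowest cylinder `Y = Y_0` and highest cylinder `Z = Y_n`: `nil Y` is the telescope `Y × ℝ`
without critical values, and `cons X a ψ φ T` adds, below the telescope `T`, a critical slice `X` at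
height `a`, to which a new lowest cylinder is attached by `ψ` and the lowest cylinder of `T` is
attached by `φ`. In all the telescopes below, the critical values are listed in increasing order. -/
inductive Telescope : TopCat.{u} → TopCat.{u} → Type (u + 1)
  | nil (Y : TopCat.{u}) : Telescope Y Y
  | cons {Y Y' Z : TopCat.{u}} (X : TopCat.{u}) (a : ℝ) (ψ : C(Y, X)) (φ : C(Y', X))
      (T : Telescope Y' Z) : Telescope Y Z

namespace Telescope

/-- The list of the critical values, from the lowest to the highest. -/
def crit : {Y Z : TopCat.{u}} → Telescope Y Z → List ℝ
  | _, _, nil _ => []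
  | _, _, cons _ a _ _ T => a :: T.crit

/-- The disjoint union of the cylinders and critical slices of a telescope, where only heights in
`S` are kept in the lowest cylinder. -/
def Pieces : {Y Z : TopCat.{u}} → Telescope Y Z → Set ℝ → TopCat.{u}
  | Y, _, nil _, S => TopCat.of (Y × S)
  | Y, _, cons X a _ _ T, S => TopCat.of ((Y × ↥(S ∩ Iic a)) ⊕ (X ⊕ Pieces T (Ici a)))

/-- The point `(y, t)` of the lowest cylinder `Y`. -/
def lowPoint : {Y Z : TopCat.{u}} → (T : Telescope Y Z) → (S : Set ℝ) → (t : ℝ) → (t ∈ S) →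
    (∀ c ∈ T.crit, t ≤ c) → Y → T.Pieces S
  | _, _, nil _, _, t, hS, _ => fun y => (y, ⟨t, hS⟩)
  | _, _, cons _ _ _ _ _, _, t, hS, h => fun y =>
      Sum.inl (y, ⟨t, hS, h _ (List.mem_cons_self ..)⟩)

/-- The point `(z, t)` of the highest cylinder `Z`. -/
def highPoint : {Y Z : TopCat.{u}} → (T : Telescope Y Z) → (S : Set ℝ) → (t : ℝ) → (t ∈ S) →
    (∀ c ∈ T.crit, c ≤ t) → Z → T.Pieces S
  | _, _, nil _, _, t, hS, _ => fun z => (z, ⟨t, hS⟩)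
  | _, _, cons _ a _ _ T, _, t, _, h => fun z =>
      Sum.inr (Sum.inr (T.highPoint (Ici a) t (h a (List.mem_cons_self ..))
        (fun c hc => h c (List.mem_cons_of_mem _ hc)) z))

/-- `p` is the point `(y, t)` of the lowest cylinder. -/
def IsLowPoint : {Y Z : TopCat.{u}} → (T : Telescope Y Z) → (S : Set ℝ) → Y → ℝ → T.Pieces S → Prop
  | _, _, nil _, S, y, t, p => ∃ h : t ∈ S, p = (y, ⟨t, h⟩)
  | _, _, cons _ a _ _ _, S, y, t, p => ∃ h : t ∈ S ∩ Iic a, p = Sum.inl (y, ⟨t, h⟩)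

/-- The identifications made in the adjunction space: `(y, a) ~ ψ y` for `y` in the cylinder below
the slice at height `a`, and `(y, a) ~ φ y` for `y` in the cylinder above it. -/
def Glue : {Y Z : TopCat.{u}} → (T : Telescope Y Z) → (S : Set ℝ) →
    T.Pieces S → T.Pieces S → Prop
  | _, _, nil _, _, _, _ => False
  | Y, _, cons (Y' := Y') _ a ψ φ T, S, p, q =>
      (∃ (y : Y) (h : a ∈ S ∩ Iic a), p = Sum.inl (y, ⟨a, h⟩) ∧ q = Sum.inr (Sum.inl (ψ y))) ∨
      (∃ (y : Y') (p' : T.Pieces (Ici a)), T.IsLowPoint (Ici a) y a p' ∧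
        p = Sum.inr (Sum.inr p') ∧ q = Sum.inr (Sum.inl (φ y))) ∨
      (∃ p' q' : T.Pieces (Ici a), T.Glue (Ici a) p' q' ∧
        p = Sum.inr (Sum.inr p') ∧ q = Sum.inr (Sum.inr q'))

/-- The second projection, on the pieces. -/
def piecesHeight : {Y Z : TopCat.{u}} → (T : Telescope Y Z) → (S : Set ℝ) → T.Pieces S → ℝ
  | _, _, nil _, _ => fun p => p.2
  | _, _, cons _ a _ _ T, _ => Sum.elim (fun p => p.2) (Sum.elim (fun _ => a)
      (T.piecesHeight (Ici a)))

/-- The adjunction space defined by a telescope. -/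
def Space {Y Z : TopCat.{u}} (T : Telescope Y Z) : Type u := Quot (T.Glue univ)

instance {Y Z : TopCat.{u}} (T : Telescope Y Z) : TopologicalSpace T.Space :=
  inferInstanceAs (TopologicalSpace (Quot (T.Glue univ)))

theorem piecesHeight_isLowPoint {Y Z : TopCat.{u}} (T : Telescope Y Z) (S : Set ℝ) (y : Y) (t : ℝ)
    (p : T.Pieces S) (h : T.IsLowPoint S y t p) : T.piecesHeight S p = t := by
  cases T with
  | nil => obtain ⟨_, rfl⟩ := h; rfl
  | cons => obtain ⟨_, rfl⟩ := h; rfl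

theorem piecesHeight_glue {Y Z : TopCat.{u}} (T : Telescope Y Z) (S : Set ℝ) (p q : T.Pieces S)
    (h : T.Glue S p q) : T.piecesHeight S p = T.piecesHeight S q := by
  induction T generalizing S with
  | nil => exact h.elim
  | cons X a ψ φ T ih =>
    rcases h with ⟨y, h, rfl, rfl⟩ | ⟨y, p', h, rfl, rfl⟩ | ⟨p', q', h, rfl, rfl⟩
    · rfl
    · exact T.piecesHeight_isLowPoint _ _ _ _ h
    · exact ih _ _ _ h

/-- The second projection `π₂` of a telescope. -/
def height {Y Z : TopCat.{u}} (T : Telescope Y Z) : T.Space → ℝ :=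
  Quot.lift (T.piecesHeight univ) (T.piecesHeight_glue univ)

/-- The part `π₂⁻¹[a, b]` of a telescope. -/
def Slab {Y Z : TopCat.{u}} (T : Telescope Y Z) (a b : ℝ) : TopCat.{u} :=
  TopCat.of ↥(T.height ⁻¹' Icc a b)

theorem piecesHeight_lowPoint {Y Z : TopCat.{u}} (T : Telescope Y Z) (S : Set ℝ) (t : ℝ)
    (hS : t ∈ S) (h : ∀ c ∈ T.crit, t ≤ c) (y : Y) :
    T.piecesHeight S (T.lowPoint S t hS h y) = t := by
  cases T <;> rfl

theorem piecesHeight_highPoint {Y Z : TopCat.{u}} (T : Telescope Y Z) (S : Set ℝ) (t : ℝ)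
    (hS : t ∈ S) (h : ∀ c ∈ T.crit, c ≤ t) (z : Z) :
    T.piecesHeight S (T.highPoint S t hS h z) = t := by
  induction T generalizing S with
  | nil => rfl
  | cons X a ψ φ T ih => exact ih _ _ _ _

theorem continuous_lowPoint {Y Z : TopCat.{u}} (T : Telescope Y Z) (S : Set ℝ) (t : ℝ)
    (hS : t ∈ S) (h : ∀ c ∈ T.crit, t ≤ c) : Continuous (T.lowPoint S t hS h) := by
  cases T with
  | nil => exact continuous_id.prodMk continuous_const
  | cons => exact continuous_inl.comp (continuous_id.prodMk continuous_const)

theorem continuous_highPoint {Y Z : TopCat.{u}} (T : Telescope Y Z) (S : Set ℝ) (t : ℝ)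
    (hS : t ∈ S) (h : ∀ c ∈ T.crit, c ≤ t) : Continuous (T.highPoint S t hS h) := by
  induction T generalizing S with
  | nil => exact continuous_id.prodMk continuous_const
  | cons X a ψ φ T ih =>
    exact continuous_inr.comp (continuous_inr.comp (ih (Ici a) _ _))

/-- The map `y ↦ [(y, a)]` from the lowest cylinder to the part over `[a, b]`. -/
def slabLow {Y Z : TopCat.{u}} (T : Telescope Y Z) (a b : ℝ) (hab : a ≤ b)
    (h : ∀ c ∈ T.crit, a ≤ c) : C(Y, T.Slab a b) where
  toFun y := ⟨Quot.mk _ (T.lowPoint univ a trivial h y), by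
    have := T.piecesHeight_lowPoint univ a trivial h y
    change T.piecesHeight univ _ ∈ Icc a b
    rw [this]; exact ⟨le_rfl, hab⟩⟩
  continuous_toFun := (continuous_quot_mk.comp (T.continuous_lowPoint _ _ _ _)).subtype_mk _

/-- The map `z ↦ [(z, b)]` from the highest cylinder to the part over `[a, b]`. -/
def slabHigh {Y Z : TopCat.{u}} (T : Telescope Y Z) (a b : ℝ) (hab : a ≤ b)
    (h : ∀ c ∈ T.crit, c ≤ b) : C(Z, T.Slab a b) where
  toFun z := ⟨Quot.mk _ (T.highPoint univ b trivial h z), by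
    have := T.piecesHeight_highPoint univ b trivial h z
    change T.piecesHeight univ _ ∈ Icc a b
    rw [this]; exact ⟨hab, le_rfl⟩⟩
  continuous_toFun := (continuous_quot_mk.comp (T.continuous_highPoint _ _ _ _)).subtype_mk _

/-! ### Merge, Split and Shift -/

/-- Stack the second telescope on top of the first one. -/
def append : {Y W Z : TopCat.{u}} → Telescope Y W → Telescope W Z → Telescope Y Z
  | _, _, _, nil _, T' => T'
  | _, _, _, cons X a ψ φ T, T' => cons X a ψ φ (T.append T')

open Classical in
/-- Cut a telescope, in a cylinder, into a lower part and an upper part: the lower part has the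
lowest critical values, as long as they satisfy `P`. -/
def cut (P : ℝ → Prop) : {Y Z : TopCat.{u}} → Telescope Y Z →
    Σ W : TopCat.{u}, Telescope Y W × Telescope W Z
  | Y, _, nil _ => ⟨Y, nil Y, nil Y⟩
  | Y, _, cons X a ψ φ T =>
      if P a then ⟨(T.cut P).1, cons X a ψ φ (T.cut P).2.1, (T.cut P).2.2⟩
      else ⟨Y, nil Y, cons X a ψ φ T⟩

open Classical in
/-- `Merge_{a,b}`: let `mid` be the part of the telescope with the critical values in `[a, b]`
(possibly none), between a lower part `low` and an upper part `high`. Then `mid` is replaced by a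
single critical value `(a + b) / 2` whose slice is the part `T^{[a,b]}` of the telescope over
`[a, b]`. The attaching maps are `y ↦ [(y, a)]` and `y ↦ [(y, b)]`: these are the original attaching
maps if `a`, resp. `b`, is a critical value, and the inclusions of cylinder sections otherwise. The
condition in the definition always holds if `a ≤ b` and the critical values increase. -/
def merge {Y Z : TopCat.{u}} (a b : ℝ) (T : Telescope Y Z) : Telescope Y Z :=
  let low := (T.cut (· < a)).2.1
  let rest := (T.cut (· < a)).2.2
  let mid := (rest.cut (· ≤ b)).2.1
  let high := (rest.cut (· ≤ b)).2.2
  if h : a ≤ b ∧ ∀ c ∈ mid.crit, a ≤ c ∧ c ≤ b then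
    low.append (cons (mid.Slab a b) ((a + b) / 2)
      (mid.slabLow a b h.1 fun c hc => (h.2 c hc).1)
      (mid.slabHigh a b h.1 fun c hc => (h.2 c hc).2) high)
  else T

/-- `Split_{ε,c}`: the critical value `c`, with slice `X`, is replaced by the two critical values
`c - ε` and `c + ε`, both with slice `X`, with the cylinder `X × [c - ε, c + ε]` between them. -/
def split (ε c : ℝ) : {Y Z : TopCat.{u}} → Telescope Y Z → Telescope Y Z
  | _, _, nil Y => nil Y
  | _, _, cons X a ψ φ T =>
      open Classical in
      if a = c then
        cons X (a - ε) ψ (ContinuousMap.id X) (cons X (a + ε) (ContinuousMap.id X) φ T)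
      else cons X a ψ φ (T.split ε c)

/-- `Shift_{ε,c}`: the critical value `c` is moved to `c + ε`. -/
def shift (ε c : ℝ) : {Y Z : TopCat.{u}} → Telescope Y Z → Telescope Y Z
  | _, _, nil Y => nil Y
  | _, _, cons X a ψ φ T =>
      open Classical in
      if a = c then cons X (a + ε) ψ φ T else cons X a ψ φ (T.shift ε c)

/-- The telescope with cylinders `Y`, slices `X`, critical values `a` and attaching maps `ψ`, `φ`. -/
def ofFin : (n : ℕ) → (Y : Fin (n + 1) → TopCat.{u}) → (X : Fin n → TopCat.{u}) → (Fin n → ℝ) →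
    (∀ i, C(Y i.castSucc, X i)) → (∀ i, C(Y i.succ, X i)) → Telescope (Y 0) (Y (Fin.last n))
  | 0, Y, _, _, _, _ => nil (Y 0)
  | n + 1, Y, X, a, ψ, φ => cons (X 0) (a 0) (ψ 0) (φ 0)
      (ofFin n (fun i => Y i.succ) (fun i => X i.succ) (fun i => a i.succ)
        (fun i => ψ i.succ) (fun i => φ i.succ))

end Telescope

/-! ### The telescope of a Morse-type function -/

theorem openGap_nonempty {n : ℕ} {a : Fin n → ℝ} (ha : StrictMono a) (i : Fin (n + 1)) :
    (openGap a i).Nonempty := by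
  classical
  obtain ⟨m, h₁, h₂⟩ := Order.exists_between_finsets
    (lo := (Finset.univ.filter fun j : Fin n => j.castSucc < i).image a)
    (hi := (Finset.univ.filter fun j : Fin n => i ≤ j.castSucc).image a) (by
      intro x hx y hy
      simp only [Finset.mem_image, Finset.mem_filter, Finset.mem_univ, true_and] at hx hy
      obtain ⟨j, hj, rfl⟩ := hx
      obtain ⟨k, hk, rfl⟩ := hy
      exact ha (Fin.castSucc_lt_castSucc_iff.1 (hj.trans_le hk)))
  refine ⟨m, fun j hj => h₁ _ ?_, fun j hj => h₂ _ ?_⟩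
  · simp only [Finset.mem_image, Finset.mem_filter, Finset.mem_univ, true_and]
    exact ⟨j, hj, rfl⟩
  · simp only [Finset.mem_image, Finset.mem_filter, Finset.mem_univ, true_and]
    exact ⟨j, hj, rfl⟩

/-- A point of the closed interval is the limit of a sequence of points of the open one. -/
theorem exists_seq_openGap {n : ℕ} {a : Fin n → ℝ} (ha : StrictMono a) (i : Fin (n + 1)) {t : ℝ}
    (ht : t ∈ closedGap a i) :
    ∃ s : ℕ → ℝ, (∀ k, s k ∈ openGap a i) ∧ Filter.Tendsto s Filter.atTop (𝓝 t) := by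
  obtain ⟨m, hm⟩ := openGap_nonempty ha i
  refine ⟨fun k => t + (m - t) * (1 / ((k : ℝ) + 1)), fun k => ?_, ?_⟩
  · have h0 : 0 < 1 / ((k : ℝ) + 1) := by positivity
    have h1 : 1 / ((k : ℝ) + 1) ≤ 1 := by
      rw [div_le_one (by positivity)]; linarith [(Nat.cast_nonneg k : (0 : ℝ) ≤ k)]
    constructor
    · intro j hj
      have h2 := ht.1 j hj
      have h3 := hm.1 j hj
      nlinarith
    · intro j hj
      have h2 := ht.2 j hj
      have h3 := hm.2 j hj
      nlinarith
  · have := (tendsto_one_div_add_atTop_nhds_zero_nat (𝕜 := ℝ)).const_mul (m - t)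
    simpa using this.const_add t

namespace MorseType

variable {X : Type u} [TopologicalSpace X] {f : X → ℝ}

theorem openGap_subset {n : ℕ} (a : Fin n → ℝ) (i : Fin (n + 1)) :
    openGap a i ⊆ closedGap a i :=
  fun _ h => ⟨fun j hj => (h.1 j hj).le, fun j hj => (h.2 j hj).le⟩

theorem f_μbar (M : MorseType f) (i : Fin (M.n + 1)) (y : M.Y i) (t : ℝ)
    (ht : t ∈ closedGap M.crit i) : f (M.μbar i (y, ⟨t, ht⟩)) = t := by
  obtain ⟨s, hs, hst⟩ := exists_seq_openGap M.strictMono i ht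
  have hs' : ∀ k, s k ∈ closedGap M.crit i := fun k => openGap_subset _ _ (hs k)
  have h1 : Filter.Tendsto (fun k => f (M.μbar i (y, ⟨s k, hs' k⟩))) Filter.atTop
      (𝓝 (f (M.μbar i (y, ⟨t, ht⟩)))) := by
    have hc : Continuous fun r : closedGap M.crit i => f (M.μbar i (y, r)) :=
      M.continuous.comp (continuous_subtype_val.comp
        ((M.μbar i).continuous.comp (continuous_const.prodMk continuous_id)))
    exact (hc.tendsto ⟨t, ht⟩).comp (tendsto_subtype_rng.2 hst)
  have h2 : (fun k => f (M.μbar i (y, ⟨s k, hs' k⟩))) = s := by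
    funext k
    rw [M.μbar_eq i y (s k) (hs k) (hs' k), M.f_μ]
  rw [h2] at h1
  exact tendsto_nhds_unique h1 hst

theorem crit_mem_closedGap_castSucc (M : MorseType f) (i : Fin M.n) :
    M.crit i ∈ closedGap M.crit i.castSucc :=
  ⟨fun _ hj => (M.strictMono (Fin.castSucc_lt_castSucc_iff.1 hj)).le,
    fun _ hj => M.strictMono.monotone (Fin.castSucc_le_castSucc_iff.1 hj)⟩

theorem crit_mem_closedGap_succ (M : MorseType f) (i : Fin M.n) :
    M.crit i ∈ closedGap M.crit i.succ :=
  ⟨fun _ hj => M.strictMono.monotone (Fin.castSucc_lt_succ_iff.1 hj),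
    fun _ hj => (M.strictMono (Fin.succ_le_castSucc_iff.1 hj)).le⟩

/-- The critical slice `X_i = f⁻¹(a_i)`. -/
def slice (M : MorseType f) (i : Fin M.n) : TopCat.{u} := TopCat.of ↥(f ⁻¹' {M.crit i})

/-- The attaching map of the cylinder below a critical slice, the restriction of `μbar`. -/
def ψ (M : MorseType f) (i : Fin M.n) : C(M.Y i.castSucc, M.slice i) where
  toFun y := ⟨M.μbar i.castSucc (y, ⟨M.crit i, M.crit_mem_closedGap_castSucc i⟩),
    M.f_μbar _ _ _ _⟩
  continuous_toFun := (continuous_subtype_val.comp ((M.μbar _).continuous.comp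
    (continuous_id.prodMk continuous_const))).subtype_mk _

/-- The attaching map of the cylinder above a critical slice, the restriction of `μbar`. -/
def φ (M : MorseType f) (i : Fin M.n) : C(M.Y i.succ, M.slice i) where
  toFun y := ⟨M.μbar i.succ (y, ⟨M.crit i, M.crit_mem_closedGap_succ i⟩),
    M.f_μbar _ _ _ _⟩
  continuous_toFun := (continuous_subtype_val.comp ((M.μbar _).continuous.comp
    (continuous_id.prodMk continuous_const))).subtype_mk _

/-- The telescope `T_X` of a Morse-type function. -/
def telescope (M : MorseType f) : Telescope (M.Y 0) (M.Y (Fin.last M.n)) :=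
  Telescope.ofFin M.n M.Y M.slice M.crit M.ψ M.φ

end MorseType

/-! ### Covers -/

/-- The part of `U` that meets no other element of the cover. -/
def properPart (𝓤 : Set (Set ℝ)) (U : Set ℝ) : Set ℝ := U \ ⋃₀ (𝓤 \ {U})

/-- A gomic of `Z ⊆ ℝ`: a generic, open, minimal cover of `Z` by intervals of `Z`. -/
structure IsGomic (Z : Set ℝ) (𝓤 : Set (Set ℝ)) : Prop where
  cover : ⋃₀ 𝓤 = Z
  interval : ∀ U ∈ 𝓤, ∃ I : Set ℝ, I.OrdConnected ∧ U = I ∩ Z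
  isOpen : ∀ U ∈ 𝓤, ∃ O : Set ℝ, IsOpen O ∧ U = O ∩ Z
  minimal : ∀ 𝓥 ⊆ 𝓤, ⋃₀ 𝓥 = Z → 𝓥 = 𝓤
  generic : ∀ U ∈ 𝓤, ∀ C, IsPathComponentOf (properPart 𝓤 U) C → ∀ x, C ≠ {x}

/-- The lower endpoint of the proper part of `U`. -/
def lowEnd (𝓤 : Set (Set ℝ)) (U : Set ℝ) : ℝ := sInf (properPart 𝓤 U)

/-- The upper endpoint of the proper part of `U`. -/
def highEnd (𝓤 : Set (Set ℝ)) (U : Set ℝ) : ℝ := sSup (properPart 𝓤 U)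

/-- The endpoints of a gomic. Every element `U` is the disjoint union of its intersection with the
element below, its proper part, and its intersection with the element above. Hence, if the covered
set is an interval, the endpoints of the elements are exactly the endpoints of the proper parts. -/
def endpoints (𝓤 : Set (Set ℝ)) : Set ℝ :=
  {x | ∃ U ∈ 𝓤, x = lowEnd 𝓤 U ∨ x = highEnd 𝓤 U}

/-- `I` and `J` are consecutive intersecting elements of the cover, `I` below `J`, and `c` lies
strictly between their proper parts. If the covered set is an interval, the last condition says
`c ∈ I ∩ J`. -/
def BetweenProper (𝓤 : Set (Set ℝ)) (I J : Set ℝ) (c : ℝ) : Prop :=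
  I ∈ 𝓤 ∧ J ∈ 𝓤 ∧ (I ∩ J).Nonempty ∧ highEnd 𝓤 I < c ∧ c < lowEnd 𝓤 J

/-! ### The perturbed telescope -/

namespace Telescope

/-- The composition of the `Merge_{a,b}`, for the `(a, b)` in a list. -/
def mergeList {Y Z : TopCat.{u}} (L : List (ℝ × ℝ)) (T : Telescope Y Z) : Telescope Y Z :=
  L.foldl (fun S ab => S.merge ab.1 ab.2) T

/-- The composition of the `Split_{ε(c), c}`, for all critical values `c`. -/
def splitAll {Y Z : TopCat.{u}} (ε : ℝ → ℝ) (T : Telescope Y Z) : Telescope Y Z :=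
  T.crit.foldl (fun S c => S.split (ε c) c) T

/-- For every `c` in a list, shift the up-fork `c + ε(c)` by `up c` and the down-fork `c - ε(c)` by
`down c`. -/
def shiftForks {Y Z : TopCat.{u}} (ε up down : ℝ → ℝ) (L : List ℝ) (T : Telescope Y Z) :
    Telescope Y Z :=
  L.foldl (fun S c => (S.shift (up c) (c + ε c)).shift (down c) (c - ε c)) T

end Telescope

/-- `L` lists the set `S` of pairwise disjoint intervals `[a, b]`, from the lowest to the highest. -/
def ListsIncreasingly (L : List (ℝ × ℝ)) (S : Set (ℝ × ℝ)) : Prop :=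
  L.Pairwise (fun x y => x.2 < y.1) ∧ ∀ x, x ∈ L ↔ x ∈ S

/-- The choices that are made in the construction of the perturbed telescope
`T'_X = Merge' ∘ Shift ∘ Split ∘ Merge (T_X)`. Operations at different places commute; they are
performed from the lowest to the highest. -/
structure Perturbation {X : Type u} [TopologicalSpace X] {f : X → ℝ} (M : MorseType f)
    (𝓤 : Set (Set ℝ)) where
  /-- The subinterval `[α K, β K]` of a non-empty intersection `K = I ∩ J`, which contains all
  critical values within `K`. -/
  α : Set ℝ → ℝ
  β : Set ℝ → ℝ
  inter : ∀ I ∈ 𝓤, ∀ J ∈ 𝓤, I ≠ J → (I ∩ J).Nonempty →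
    α (I ∩ J) ≤ β (I ∩ J) ∧ α (I ∩ J) ∈ I ∩ J ∧ β (I ∩ J) ∈ I ∩ J ∧
      ∀ i, M.crit i ∈ I ∩ J → M.crit i ∈ Icc (α (I ∩ J)) (β (I ∩ J))
  /-- The intervals merged in the first step: all proper parts, and all the subintervals chosen in
  the intersections. -/
  list : List (ℝ × ℝ)
  list_spec : ListsIncreasingly list
    ({x | ∃ U ∈ 𝓤, x = (lowEnd 𝓤 U, highEnd 𝓤 U)} ∪
      {x | ∃ I ∈ 𝓤, ∃ J ∈ 𝓤, I ≠ J ∧ (I ∩ J).Nonempty ∧ x = (α (I ∩ J), β (I ∩ J))})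
  /-- The intervals merged in the last step: all proper parts. -/
  list' : List (ℝ × ℝ)
  list'_spec : ListsIncreasingly list' {x | ∃ U ∈ 𝓤, x = (lowEnd 𝓤 U, highEnd 𝓤 U)}
  /-- The amplitudes of the Splits: the two new critical values lie strictly between the same
  consecutive endpoints as the old one. -/
  ε : ℝ → ℝ
  ε_spec : ∀ c ∈ (M.telescope.mergeList list).crit, 0 < ε c ∧
    ∃ a b, Consecutive (endpoints 𝓤) a b ∧ a < c ∧ c < b ∧ ε c < min (c - a) (b - c)
  /-- The amplitudes of the Shifts of the up-forks in the intersections: they move to the proper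
  part above, below the next critical value. -/
  up : ℝ → ℝ
  up_spec : ∀ c ∈ (M.telescope.mergeList list).crit, ∀ I J, BetweenProper 𝓤 I J c →
    lowEnd 𝓤 J < c + ε c + up c ∧ c + ε c + up c < highEnd 𝓤 J ∧
      ∀ c' ∈ ((M.telescope.mergeList list).splitAll ε).crit, c + ε c < c' → c + ε c + up c < c'
  /-- The amplitudes of the Shifts of the down-forks in the intersections: they move to the proper
  part below, above the previous critical value. -/
  down : ℝ → ℝ
  down_spec : ∀ c ∈ (M.telescope.mergeList list).crit, ∀ I J, BetweenProper 𝓤 I J c →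
    lowEnd 𝓤 I < c - ε c + down c ∧ c - ε c + down c < highEnd 𝓤 I ∧
      ∀ c' ∈ ((M.telescope.mergeList list).splitAll ε).crit,
        c' < c - ε c → c' < c - ε c + down c

namespace Perturbation

variable {X : Type u} [TopologicalSpace X] {f : X → ℝ} {M : MorseType f} {𝓤 : Set (Set ℝ)}

/-- The telescope after the first Merges. -/
def merged (P : Perturbation M 𝓤) : Telescope (M.Y 0) (M.Y (Fin.last M.n)) :=
  M.telescope.mergeList P.list

open Classical in
/-- The perturbed telescope `T'_X`. -/
def telescope (P : Perturbation M 𝓤) : Telescope (M.Y 0) (M.Y (Fin.last M.n)) :=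
  ((P.merged.splitAll P.ε).shiftForks P.ε P.up P.down
    (P.merged.crit.filter fun c => ∃ I J, BetweenProper 𝓤 I J c)).mergeList P.list'

end Perturbation

/-! ### Reeb graphs -/

/-- `x ∼ y` if `x` and `y` have the same value and lie in the same component of the level set. -/
def reebSetoid {X : Type u} [TopologicalSpace X] (f : X → ℝ) : Setoid X where
  r x y := f x = f y ∧ JoinedIn (f ⁻¹' {f x}) x y
  iseqv :=
    { refl := fun _ => ⟨rfl, JoinedIn.refl rfl⟩
      symm := fun h => ⟨h.1.symm, h.1 ▸ h.2.symm⟩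
      trans := fun h h' => ⟨h.1.trans h'.1, h.2.trans (h.1 ▸ h'.2)⟩ }

/-- The Reeb graph, as a quotient space. -/
def Reeb {X : Type u} [TopologicalSpace X] (f : X → ℝ) : Type u := Quotient (reebSetoid f)

/-- The function induced by `f` on the Reeb graph. -/
def reebMap {X : Type u} [TopologicalSpace X] (f : X → ℝ) : Reeb f → ℝ :=
  Quotient.lift f fun _ _ h => h.1

/-- The arcs of the Reeb graph between consecutive critical values `lo < hi`: the components of the
part of the space over `(lo, hi)`. -/
structure ReebArc {X : Type u} [TopologicalSpace X] (f : X → ℝ) (crit : Set ℝ) : Type u where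
  lo : ℝ
  hi : ℝ
  consecutive : Consecutive crit lo hi
  carrier : Set X
  isComponent : IsPathComponentOf (f ⁻¹' Ioo lo hi) carrier

/-- The combinatorial Reeb graph of a function with given critical values. The nodes are the points
of the Reeb graph over the critical values, that is, the components of the critical level sets. The
edges are the arcs between consecutive critical values. A node is an end of an arc over `(lo, hi)` if
it lies over `lo` and is joined to the arc in the part of the space over `[lo, hi)`, or if it lies
over `hi` and is joined to the arc in the part of the space over `(lo, hi]`. -/
def combReeb {X : Type u} [TopologicalSpace X] (f : X → ℝ) (crit : Set ℝ) : Multigraph.{u} where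
  Node := {r : Reeb f // reebMap f r ∈ crit}
  Edge := ReebArc f crit
  ends e := {r | ∃ x : X, Quotient.mk (reebSetoid f) x = r.1 ∧ ∃ y ∈ e.carrier,
    (f x = e.lo ∧ JoinedIn (f ⁻¹' Ico e.lo e.hi) x y) ∨
    (f x = e.hi ∧ JoinedIn (f ⁻¹' Ioc e.lo e.hi) x y)}

/-! ### The MultiNerve Mapper -/

/-- The multinerve of a family of subsets: its simplices are the pairs of a finite set `F` of indices
and of a component `C` of the intersection of the sets with indices in `F`, and, in addition, the
least element `(∅, ⋃ U)`. -/
structure Multinerve {X : Type u} [TopologicalSpace X] {ι : Type u} (U : ι → Set X) : Type u where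
  F : Finset ι
  C : Set X
  isComponent : (F = ∅ ∧ C = ⋃ i, U i) ∨ (F.Nonempty ∧ IsPathComponentOf (⋂ i ∈ F, U i) C)

instance {X : Type u} [TopologicalSpace X] {ι : Type u} (U : ι → Set X) : LE (Multinerve U) where
  le p q := p.F ⊆ q.F ∧ q.C ⊆ p.C

/-- The simplices of dimensions `0` and `1` of a multinerve, as a multigraph: the ends of an edge are
its faces of dimension `0`. -/
def Multinerve.graph {X : Type u} [TopologicalSpace X] {ι : Type u} (U : ι → Set X) :
    Multigraph.{u} where
  Node := {p : Multinerve U // p.F.card = 1}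
  Edge := {p : Multinerve U // p.F.card = 2}
  ends e := {v | v.1 ≤ e.1}

/-- The indices `(U, C)` of the connected pullback cover: `U` is an element of the cover, and `C` is a
component of `f⁻¹(U)`. -/
def PullbackIndex {X : Type u} [TopologicalSpace X] (f : X → ℝ) (𝓤 : Set (Set ℝ)) : Type u :=
  {p : Set ℝ × Set X // p.1 ∈ 𝓤 ∧ IsPathComponentOf (f ⁻¹' p.1) p.2}

/-- The connected pullback cover. -/
def pullbackCover {X : Type u} [TopologicalSpace X] (f : X → ℝ) (𝓤 : Set (Set ℝ)) :
    PullbackIndex f 𝓤 → Set X :=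
  fun p => p.1.2

/-- The MultiNerve Mapper. -/
abbrev MultiNerveMapper {X : Type u} [TopologicalSpace X] (f : X → ℝ) (𝓤 : Set (Set ℝ)) : Type u :=
  Multinerve (pullbackCover f 𝓤)

end

/-! ### Path components and locally factoring functions -/

/-! Both graphs are made of path components, so a telescope need not be compared with `X` as a
space. Each critical value of a telescope carries an open interval `(lo, hi)`. The components of its
slice correspond to those of `f⁻¹(lo, hi)`, and the components of the cylinder between two
consecutive slices correspond to those over the intersection of their two intervals. This is the
predicate `Realises`.

For `T_X` the interval of a critical value reaches to the two neighbouring critical values. A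
critical slice is a retract of this star, because the cylinders are compact and `X` is Hausdorff
(`MorseType.cell_slice`). The operations act on the intervals in a simple way. A Merge replaces a
block of them by their union, by a van Kampen argument for components
(`Represents.exists_extension`, `Represents.joinedIn_iff`, `Realises.merge`). A Split repeats an
entry, and a Shift moves a height and keeps the interval.

After all four steps there is one critical value for each element `U` of the gomic. It absorbs the
forks of the proper part of `U` and one fork from each intersection of `U` with a neighbour. Its
interval therefore contains the same critical values of `f` as `U`
(`Perturbation.realises_telescope`), and the intersection of two consecutive intervals contains the
same ones as `U ∩ V`. Away from critical values `f` is a product, so two intervals have the same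
components if both have all their critical values in a common non-empty open subinterval
(`MorseType.joinedIn_congr`). This matches nodes, edges and incidences
(`Perturbation.exists_comparison`, `GraphComparison.nonempty_iso`). The bound on the dimension holds
since three elements of a gomic never meet (`OrderedCover.not_triple`). -/

theorem Set.OrdConnected.joinedIn {J : Set ℝ} (hJ : J.OrdConnected) {s t : ℝ} (hs : s ∈ J)
    (ht : t ∈ J) : JoinedIn J s t :=
  (hJ.convex.isPathConnected ⟨s, hs⟩).joinedIn s hs t ht

/-- A function which is locally constant on joined points is constant on joined points. -/
theorem eq_of_joinedIn {A α : Type*} [TopologicalSpace A] {K : Set A} {g : A → α}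
    (h : ∀ a ∈ K, ∃ U ∈ 𝓝 a, ∀ b b', JoinedIn (U ∩ K) b b' → g b = g b') {a b : A}
    (hab : JoinedIn K a b) : g a = g b := by
  -- No component has to be open. Along the path, `g ∘ γ` is locally constant, because a small
  -- interval around `t` is mapped into `U ∩ K` and joins its image points there.
  obtain ⟨γ, hγ⟩ := hab
  have hK : ∀ t, γ.extend t ∈ K := fun t => by
    have : γ.extend t ∈ range γ := by rw [← γ.extend_range]; exact mem_range_self t
    obtain ⟨s, hs⟩ := this
    exact hs ▸ hγ s
  have hl : IsLocallyConstant fun t => g (γ.extend t) := by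
    rw [IsLocallyConstant.iff_eventually_eq]
    intro t
    obtain ⟨U, hU, hg⟩ := h _ (hK t)
    obtain ⟨δ, hδ, hb⟩ := Metric.mem_nhds_iff.1 (γ.continuous_extend.continuousAt hU)
    filter_upwards [Metric.ball_mem_nhds t hδ] with s hs
    refine hg _ _ (JoinedIn.mono (((convex_ball t δ).ordConnected.joinedIn hs
      (Metric.mem_ball_self hδ)).map γ.continuous_extend) ?_)
    rintro _ ⟨r, hr, rfl⟩
    exact ⟨hb hr, hK r⟩
  have := hl.apply_eq_of_preconnectedSpace 0 1
  simpa using this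

theorem JoinedIn.joined_map {A W : Type*} [TopologicalSpace A] [TopologicalSpace W] {U : Set A}
    {r : A → W} (hr : ContinuousOn r U) {a b : A} (h : JoinedIn U a b) : Joined (r a) (r b) :=
  (h.map_continuousOn hr).joined

/-- The intervals with endpoints in the extended real numbers. -/
def realIoo (l h : EReal) : Set ℝ := {t | l < t ∧ (t : EReal) < h}

theorem mem_realIoo {l h : EReal} {t : ℝ} : t ∈ realIoo l h ↔ l < t ∧ (t : EReal) < h := Iff.rfl

theorem isOpen_realIoo (l h : EReal) : IsOpen (realIoo l h) :=
  (isOpen_Ioi.preimage continuous_coe_real_ereal).inter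
    (isOpen_Iio.preimage continuous_coe_real_ereal)

theorem ordConnected_realIoo (l h : EReal) : (realIoo l h).OrdConnected :=
  ⟨fun _ hx _ hy _ hz => ⟨hx.1.trans_le (EReal.coe_le_coe_iff.2 hz.1),
    (EReal.coe_le_coe_iff.2 hz.2).trans_lt hy.2⟩⟩

theorem realIoo_subset {l h l' h' : EReal} (hl : l' ≤ l) (hh : h ≤ h') :
    realIoo l h ⊆ realIoo l' h' := fun _ ht => ⟨hl.trans_lt ht.1, ht.2.trans_le hh⟩

theorem realIoo_inter {l h l' h' : EReal} {t : ℝ} (ht : t ∈ realIoo l h) (ht' : t ∈ realIoo l' h') :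
    t ∈ realIoo l h' := ⟨ht.1, ht'.2⟩

/-- The map `κ` identifies the components of `W` with the components of `f⁻¹(J)`. -/
structure Cell {X W : Type*} [TopologicalSpace X] [TopologicalSpace W] (f : X → ℝ) (J : Set ℝ)
    (κ : W → X) : Prop where
  joined_iff : ∀ w w', JoinedIn (f ⁻¹' J) (κ w) (κ w') ↔ Joined w w'
  surj : ∀ x, f x ∈ J → ∃ w, JoinedIn (f ⁻¹' J) (κ w) x

namespace Cell

variable {X W : Type*} [TopologicalSpace X] [TopologicalSpace W] {f : X → ℝ} {J : Set ℝ}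
  {κ : W → X}

theorem mem (h : Cell f J κ) (w : W) : f (κ w) ∈ J :=
  ((h.joined_iff w w).2 (Joined.refl w)).source_mem

/-- The components of `f⁻¹(J)` are those of `W`, so functions of components transport from `W` to
`X`. Outside `f⁻¹(J)` the value is arbitrary, as no path in question passes there. -/
theorem lift (h : Cell f J κ) {α : Type*} [Nonempty α] (F : W → α)
    (hF : ∀ w w', Joined w w' → F w = F w') :
    ∃ g : X → α, (∀ x x', JoinedIn (f ⁻¹' J) x x' → g x = g x') ∧ ∀ w, g (κ w) = F w := by
  classical
  refine ⟨fun x => if hx : f x ∈ J then F (h.surj x hx).choose else Classical.arbitrary α,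
    fun x x' hxx' => ?_, fun w => ?_⟩
  · have hx : f x ∈ J := hxx'.source_mem
    have hx' : f x' ∈ J := hxx'.target_mem
    simp only [hx, hx', dif_pos]
    exact hF _ _ ((h.joined_iff _ _).1 (((h.surj x hx).choose_spec.trans hxx').trans
      (h.surj x' hx').choose_spec.symm))
  · simp only [h.mem w, dif_pos]
    exact hF _ _ ((h.joined_iff _ _).1 (h.surj (κ w) (h.mem w)).choose_spec)

end Cell

/-- Van Kampen for components: a function on the union of two open sets. -/
theorem eq_of_joinedIn_union {X α : Type*} [TopologicalSpace X] {f : X → ℝ} (hf : Continuous f)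
    {J₁ J₂ : Set ℝ} (h₁ : IsOpen J₁) (h₂ : IsOpen J₂) {g : X → α}
    (hg₁ : ∀ x x', JoinedIn (f ⁻¹' J₁) x x' → g x = g x')
    (hg₂ : ∀ x x', JoinedIn (f ⁻¹' J₂) x x' → g x = g x') {J : Set ℝ} (hJ : J ⊆ J₁ ∪ J₂) {x x' : X}
    (h : JoinedIn (f ⁻¹' J) x x') : g x = g x' := by
  refine eq_of_joinedIn (fun a ha => ?_) h
  rcases hJ ha with ha | ha
  · exact ⟨f ⁻¹' J₁, (h₁.preimage hf).mem_nhds ha, fun b b' hb => hg₁ _ _ (hb.mono inter_subset_left)⟩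
  · exact ⟨f ⁻¹' J₂, (h₂.preimage hf).mem_nhds ha, fun b b' hb => hg₂ _ _ (hb.mono inter_subset_left)⟩

/-! ### Morse-type functions -/

theorem ordConnected_openGap {n : ℕ} (a : Fin n → ℝ) (i : Fin (n + 1)) :
    (openGap a i).OrdConnected :=
  ⟨fun _ hx _ hy _ hz => ⟨fun j hj => (hx.1 j hj).trans_le hz.1,
    fun j hj => hz.2.trans_lt (hy.2 j hj)⟩⟩

theorem ordConnected_closedGap {n : ℕ} (a : Fin n → ℝ) (i : Fin (n + 1)) :
    (closedGap a i).OrdConnected :=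
  ⟨fun _ hx _ hy _ hz => ⟨fun j hj => (hx.1 j hj).trans hz.1,
    fun j hj => hz.2.trans (hy.2 j hj)⟩⟩

theorem isOpen_openGap {n : ℕ} (a : Fin n → ℝ) (i : Fin (n + 1)) : IsOpen (openGap a i) := by
  have : openGap a i = (⋂ j : Fin n, {t | j.castSucc < i → a j < t}) ∩
      ⋂ j : Fin n, {t | i ≤ j.castSucc → t < a j} := by
    ext t; simp [openGap]
  rw [this]
  refine (isOpen_iInter_of_finite fun j => ?_).inter (isOpen_iInter_of_finite fun j => ?_)
  · by_cases h : j.castSucc < i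
    · simp only [h, forall_const]; exact isOpen_Ioi
    · simp [h]
  · by_cases h : i ≤ j.castSucc
    · simp only [h, forall_const]; exact isOpen_Iio
    · simp [h]

theorem isClosed_closedGap {n : ℕ} (a : Fin n → ℝ) (i : Fin (n + 1)) : IsClosed (closedGap a i) := by
  have : closedGap a i = (⋂ j : Fin n, {t | j.castSucc < i → a j ≤ t}) ∩
      ⋂ j : Fin n, {t | i ≤ j.castSucc → t ≤ a j} := by
    ext t; simp [closedGap]
  rw [this]
  refine (isClosed_iInter fun j => ?_).inter (isClosed_iInter fun j => ?_)
  · by_cases h : j.castSucc < i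
    · simp only [h, forall_const]; exact isClosed_Ici
    · simp [h]
  · by_cases h : i ≤ j.castSucc
    · simp only [h, forall_const]; exact isClosed_Iic
    · simp [h]

/-- A number is a critical value or lies in an open gap. -/
theorem exists_mem_openGap {n : ℕ} {a : Fin n → ℝ} (ha : StrictMono a) {t : ℝ}
    (ht : ∀ i, a i ≠ t) : ∃ i, t ∈ openGap a i := by
  classical
  -- The gap that contains `t` is numbered by the number of critical values below `t`; by
  -- monotonicity these are the first `s.card` ones.
  let s : Finset (Fin n) := Finset.univ.filter fun j => a j < t
  have hcard : s.card < n + 1 := by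
    have := Finset.card_le_univ s
    simp only [Fintype.card_fin] at this
    omega
  have key : ∀ j : Fin n, a j < t ↔ j.val < s.card := by
    intro j
    constructor
    · intro h
      have hsub : Finset.Iic j ⊆ s := fun k hk => by
        simp only [s, Finset.mem_filter, Finset.mem_univ, true_and]
        exact (ha.monotone (Finset.mem_Iic.1 hk)).trans_lt h
      have := Finset.card_le_card hsub
      rw [Fin.card_Iic] at this
      omega
    · intro h
      by_contra hj
      have hsub : s ⊆ Finset.Iio j := fun k hk => by
        simp only [s, Finset.mem_filter, Finset.mem_univ, true_and] at hk
        refine Finset.mem_Iio.2 (lt_of_not_ge fun hjk => ?_)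
        exact hj ((ha.monotone hjk).trans_lt hk)
      have := Finset.card_le_card hsub
      rw [Fin.card_Iio] at this
      omega
  refine ⟨⟨s.card, hcard⟩, fun j hj => (key j).2 hj, fun j hj => ?_⟩
  have : ¬ a j < t := fun h => absurd ((key j).1 h) (not_lt.2 hj)
  exact lt_of_le_of_ne (not_lt.1 this) fun h => ht j h.symm

namespace MorseType

variable {X : Type u} [TopologicalSpace X] {f : X → ℝ}

theorem f_μbar_mem (M : MorseType f) (i : Fin (M.n + 1)) (y : M.Y i) (t : closedGap M.crit i)
    {J : Set ℝ} (h : t.1 ∈ J) : f (M.μbar i (y, t)) ∈ J := by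
  rw [M.f_μbar]; exact h

/-- Points on a vertical line of a cylinder are joined. -/
theorem joinedIn_μbar (M : MorseType f) (i : Fin (M.n + 1)) {J : Set ℝ} (hJ : J.OrdConnected)
    {y y' : M.Y i} (hy : Joined y y') (t t' : closedGap M.crit i) (ht : t.1 ∈ J) (ht' : t'.1 ∈ J) :
    JoinedIn (f ⁻¹' J) (M.μbar i (y, t) : X) (M.μbar i (y', t')) := by
  have h1 : JoinedIn {s : closedGap M.crit i | s.1 ∈ J} t t' := by
    have hc : (J ∩ closedGap M.crit i).OrdConnected := hJ.inter (ordConnected_closedGap _ _)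
    obtain ⟨γ, hγ⟩ := hc.joinedIn ⟨ht, t.2⟩ ⟨ht', t'.2⟩
    exact ⟨⟨⟨fun s => ⟨γ s, (hγ s).2⟩, by fun_prop⟩, by ext; simp, by ext; simp⟩,
      fun s => (hγ s).1⟩
  have h2 := ((joinedIn_univ.2 hy).prod h1).map (continuous_subtype_val.comp (M.μbar i).continuous)
  refine h2.mono ?_
  rintro _ ⟨⟨z, s⟩, hs, rfl⟩
  exact M.f_μbar_mem i z s hs.2

/-- The coordinate in the cylinder of a point over an open gap. -/
theorem exists_μbar_eq (M : MorseType f) (i : Fin (M.n + 1)) (x : X) (hx : f x ∈ openGap M.crit i) :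
    ∃ y : M.Y i, (M.μbar i (y, ⟨f x, openGap_subset _ _ hx⟩) : X) = x := by
  refine ⟨((M.μ i).symm ⟨x, hx⟩).1, ?_⟩
  have h2 : (((M.μ i).symm ⟨x, hx⟩).2 : ℝ) = f x := by
    rw [← M.f_μ, Homeomorph.apply_symm_apply]
  have h3 : (((M.μ i).symm ⟨x, hx⟩).1, (⟨f x, hx⟩ : openGap M.crit i)) = (M.μ i).symm ⟨x, hx⟩ :=
    Prod.ext rfl (Subtype.ext h2.symm)
  rw [M.μbar_eq i _ (f x) hx, h3, Homeomorph.apply_symm_apply]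

theorem μbar_injective (M : MorseType f) (i : Fin (M.n + 1)) {y y' : M.Y i}
    {t t' : closedGap M.crit i} (ht : t.1 ∈ openGap M.crit i)
    (h : (M.μbar i (y, t) : X) = M.μbar i (y', t')) : y = y' ∧ t = t' := by
  have htt : t = t' := by
    have := congrArg f h
    rw [M.f_μbar, M.f_μbar] at this
    exact Subtype.ext this
  subst htt
  obtain ⟨t, h'⟩ := t
  rw [M.μbar_eq i y t ht, M.μbar_eq i y' t ht] at h
  exact ⟨congrArg Prod.fst ((M.μ i).injective (Subtype.ext h)), rfl⟩

/-- Over the open gap the coordinate in the cylinder is a continuous function, given by the inverse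
of `μ`. This fails over the closed gap, where `μbar` need not be injective. -/
theorem joined_of_joinedIn_openGap (M : MorseType f) (i : Fin (M.n + 1)) {y y' : M.Y i}
    {t t' : closedGap M.crit i} (ht : t.1 ∈ openGap M.crit i) (ht' : t'.1 ∈ openGap M.crit i)
    (h : JoinedIn (f ⁻¹' openGap M.crit i) (M.μbar i (y, t) : X) (M.μbar i (y', t'))) :
    Joined y y' := by
  have h1 := (h.joined_subtype.map (M.μ i).symm.continuous).map continuous_fst
  obtain ⟨t, _⟩ := t
  obtain ⟨t', _⟩ := t'
  have e : ∀ (z : M.Y i) (s : ℝ) (hs : s ∈ openGap M.crit i) (hs' : s ∈ closedGap M.crit i)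
      (h'), ((M.μ i).symm ⟨(M.μbar i (z, ⟨s, hs'⟩) : X), h'⟩).1 = z := by
    intro z s hs hs' h'
    have : (⟨(M.μbar i (z, ⟨s, hs'⟩) : X), h'⟩ : f ⁻¹' openGap M.crit i) = M.μ i (z, ⟨s, hs⟩) :=
      Subtype.ext (M.μbar_eq i z s hs hs')
    rw [this, Homeomorph.symm_apply_apply]
  rwa [e y t ht, e y' t' ht'] at h1

/-- A cylinder realises the components over an interval within a gap. -/
theorem cell_cylinder (M : MorseType f) (i : Fin (M.n + 1)) {J : Set ℝ} (hJ : J.OrdConnected)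
    (hJi : J ⊆ openGap M.crit i) {t : ℝ} (ht : t ∈ J) :
    Cell f J fun y : M.Y i => (M.μbar i (y, ⟨t, openGap_subset _ _ (hJi ht)⟩) : X) where
  joined_iff y y' := ⟨fun h => M.joined_of_joinedIn_openGap i (hJi ht) (hJi ht)
    (h.mono (preimage_mono hJi)), fun h => M.joinedIn_μbar i hJ h _ _ ht ht⟩
  surj x hx := by
    obtain ⟨y, hy⟩ := M.exists_μbar_eq i x (hJi hx)
    refine ⟨y, ?_⟩
    have := M.joinedIn_μbar i hJ (Joined.refl y) ⟨t, openGap_subset _ _ (hJi ht)⟩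
      ⟨f x, openGap_subset _ _ (hJi hx)⟩ ht hx
    rwa [hy] at this

/-- The retraction of a closed part of a gap to its end is continuous. -/
theorem continuousOn_retract [T2Space X] (M : MorseType f) (i : Fin (M.n + 1)) {c : ℝ}
    (hc : c ∈ closedGap M.crit i) {Q : Set ℝ} (hQ : IsCompact Q) (hQi : Q \ {c} ⊆ openGap M.crit i)
    (hcQ : c ∈ Q) {r : X → X} (hr : ∀ x, f x = c → r x = x)
    (hr' : ∀ y t, t.1 ∈ openGap M.crit i → r (M.μbar i (y, t)) = M.μbar i (y, ⟨c, hc⟩)) :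
    ContinuousOn r (f ⁻¹' Q) := by
  have := M.compact i
  have hQ' : Q ⊆ closedGap M.crit i := fun t ht => by
    by_cases h : t = c
    · exact h ▸ hc
    · exact openGap_subset _ _ (hQi ⟨ht, h⟩)
  have hrt : ∀ y (t : closedGap M.crit i), t.1 ∈ Q →
      r (M.μbar i (y, t)) = M.μbar i (y, ⟨c, hc⟩) := by
    rintro y ⟨t, ht'⟩ ht
    by_cases h : t = c
    · subst h; exact hr _ (M.f_μbar _ _ _ _)
    · exact hr' _ _ (hQi ⟨ht, h⟩)
  -- The preimage of a closed set `K` consists of the points of `K` at height `c` and of the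
  -- vertical lines over `{y | μbar (y, c) ∈ K}`. The second part is the image of a compact set,
  -- hence closed in the Hausdorff space `X`.
  rw [continuousOn_iff_isClosed]
  intro K hK
  refine ⟨(K ∩ f ⁻¹' {c}) ∪ (fun p => (M.μbar i p : X)) ''
    ({y | (M.μbar i (y, ⟨c, hc⟩) : X) ∈ K} ×ˢ (Subtype.val ⁻¹' Q)), ?_, ?_⟩
  · refine (hK.inter (isClosed_singleton.preimage M.continuous)).union (IsCompact.isClosed ?_)
    refine IsCompact.image (IsCompact.prod (IsClosed.isCompact ?_) ?_)
      (continuous_subtype_val.comp (M.μbar i).continuous)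
    · exact hK.preimage (continuous_subtype_val.comp ((M.μbar i).continuous.comp (by fun_prop)))
    · exact (isClosed_closedGap _ _).isClosedEmbedding_subtypeVal.isCompact_preimage hQ
  · ext x
    constructor
    · rintro ⟨hxK, hxQ⟩
      refine ⟨?_, hxQ⟩
      by_cases h : f x = c
      · left; rw [mem_preimage, hr x h] at hxK; exact ⟨hxK, h⟩
      · right
        obtain ⟨y, hy⟩ := M.exists_μbar_eq i x (hQi ⟨hxQ, h⟩)
        refine ⟨(y, ⟨f x, hQ' hxQ⟩), ⟨?_, hxQ⟩, hy⟩
        have := hrt y ⟨f x, hQ' hxQ⟩ hxQ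
        rw [hy] at this
        rw [mem_preimage, this] at hxK
        exact hxK
    · rintro ⟨⟨hxK, hxc⟩ | ⟨⟨y, t⟩, ⟨hy, ht⟩, rfl⟩, hxQ⟩
      · exact ⟨by rw [mem_preimage, hr x hxc]; exact hxK, hxQ⟩
      · refine ⟨?_, hxQ⟩
        rw [mem_preimage, hrt y t ht]
        exact hy

end MorseType

/-! ### Retraction of a star onto its critical slice. -/

theorem IsOpen.exists_lt_mem {J : Set ℝ} (hJ : IsOpen J) {c t : ℝ} (hc : c ∈ J) (ht : t < c) :
    ∃ s ∈ J, t < s ∧ s < c := by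
  have h := (hJ.mem_nhds hc)
  obtain ⟨ε, hε, hb⟩ := Metric.mem_nhds_iff.1 h
  refine ⟨c - min (ε / 2) ((c - t) / 2), hb ?_, ?_, ?_⟩
  · rw [Metric.mem_ball, Real.dist_eq, abs_lt]
    have := min_le_left (ε / 2) ((c - t) / 2)
    have : 0 < min (ε / 2) ((c - t) / 2) := lt_min (by linarith) (by linarith)
    constructor <;> linarith
  · have := min_le_right (ε / 2) ((c - t) / 2); linarith
  · have : 0 < min (ε / 2) ((c - t) / 2) := lt_min (by linarith) (by linarith)
    linarith

theorem IsOpen.exists_gt_mem {J : Set ℝ} (hJ : IsOpen J) {c t : ℝ} (hc : c ∈ J) (ht : c < t) :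
    ∃ s ∈ J, c < s ∧ s < t := by
  have h := (hJ.mem_nhds hc)
  obtain ⟨ε, hε, hb⟩ := Metric.mem_nhds_iff.1 h
  have h0 : 0 < min (ε / 2) ((t - c) / 2) := lt_min (by linarith) (by linarith)
  refine ⟨c + min (ε / 2) ((t - c) / 2), hb ?_, ?_, ?_⟩
  · rw [Metric.mem_ball, Real.dist_eq, abs_lt]
    have := min_le_left (ε / 2) ((t - c) / 2)
    constructor <;> linarith
  · linarith
  · have := min_le_right (ε / 2) ((t - c) / 2); linarith

namespace MorseType

variable {X : Type u} [TopologicalSpace X] {f : X → ℝ}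

theorem lt_crit_of_mem (M : MorseType f) (i : Fin M.n) {t : ℝ}
    (ht : t ∈ openGap M.crit i.castSucc) : t < M.crit i := ht.2 i le_rfl

theorem crit_lt_of_mem (M : MorseType f) (i : Fin M.n) {t : ℝ}
    (ht : t ∈ openGap M.crit i.succ) : M.crit i < t := ht.1 i Fin.castSucc_lt_succ

/-- A critical slice is a retract of its star. -/
theorem exists_retract [T2Space X] (M : MorseType f) (i : Fin M.n) {J : Set ℝ} (hJ : J.OrdConnected)
    (hJo : IsOpen J) (hi : M.crit i ∈ J)
    (hJi : ∀ t ∈ J, t ∈ openGap M.crit i.castSucc ∨ t = M.crit i ∨ t ∈ openGap M.crit i.succ) :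
    ∃ r : X → X, ContinuousOn r (f ⁻¹' J) ∧ (∀ x, f x = M.crit i → r x = x) ∧
      ∀ x, f x ∈ J → f (r x) = M.crit i := by
  classical
  let c₁ := M.crit_mem_closedGap_castSucc i
  let c₂ := M.crit_mem_closedGap_succ i
  -- A point over one of the two adjacent gaps slides along its vertical line to the slice; all
  -- other points stay where they are.
  let r : X → X := fun x =>
    if h : f x ∈ openGap M.crit i.castSucc then
      M.μbar i.castSucc ((M.exists_μbar_eq _ x h).choose, ⟨_, c₁⟩)
    else if h : f x ∈ openGap M.crit i.succ then
      M.μbar i.succ ((M.exists_μbar_eq _ x h).choose, ⟨_, c₂⟩)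
    else x
  have hr : ∀ x, f x = M.crit i → r x = x := fun x hx => by
    have h1 : f x ∉ openGap M.crit i.castSucc := fun h => (M.lt_crit_of_mem i h).ne hx
    have h2 : f x ∉ openGap M.crit i.succ := fun h => (M.crit_lt_of_mem i h).ne' hx
    simp only [r, h1, h2, dif_neg, not_false_iff]
  have hr₁ : ∀ y t, t.1 ∈ openGap M.crit i.castSucc →
      r (M.μbar i.castSucc (y, t)) = M.μbar i.castSucc (y, ⟨M.crit i, c₁⟩) := fun y t ht => by
    have h : f (M.μbar i.castSucc (y, t)) ∈ openGap M.crit i.castSucc := M.f_μbar_mem _ _ _ ht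
    simp only [r, h, dif_pos]
    have := (M.exists_μbar_eq _ _ h).choose_spec
    rw [(M.μbar_injective _ h this).1]
  have hr₂ : ∀ y t, t.1 ∈ openGap M.crit i.succ →
      r (M.μbar i.succ (y, t)) = M.μbar i.succ (y, ⟨M.crit i, c₂⟩) := fun y t ht => by
    have h : f (M.μbar i.succ (y, t)) ∈ openGap M.crit i.succ := M.f_μbar_mem _ _ _ ht
    have h1 : f (M.μbar i.succ (y, t)) ∉ openGap M.crit i.castSucc := fun h' =>
      lt_asymm (M.lt_crit_of_mem i h') (M.crit_lt_of_mem i h)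
    simp only [r, h, h1, dif_pos, dif_neg, not_false_iff]
    have := (M.exists_μbar_eq _ _ h).choose_spec
    rw [(M.μbar_injective _ h this).1]
  refine ⟨r, fun x hx => ContinuousAt.continuousWithinAt ?_, hr, fun x hx => ?_⟩
  -- Choose `p < q` in `J` such that `f x` and the critical value lie strictly between them. The map
  -- is continuous on each of the two closed sides, and these together form a neighbourhood of `x`.
  -- The summands `-1` and `+1` are arbitrary bounds.
  · obtain ⟨p, hpJ, -, hp⟩ := hJo.exists_lt_mem (t := min (f x) (M.crit i) - 1) (c := min (f x) (M.crit i))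
      (by rcases min_choice (f x) (M.crit i) with h | h <;> rw [h]; exacts [hx, hi]) (by linarith)
    obtain ⟨q, hqJ, hq, -⟩ := hJo.exists_gt_mem (t := max (f x) (M.crit i) + 1) (c := max (f x) (M.crit i))
      (by rcases max_choice (f x) (M.crit i) with h | h <;> rw [h]; exacts [hx, hi]) (by linarith)
    rw [lt_min_iff] at hp
    rw [max_lt_iff] at hq
    have A := M.continuousOn_retract i.castSucc c₁ (Q := Icc p (M.crit i)) isCompact_Icc
      (fun t ht => (hJi t (hJ.out hpJ hi ht.1)).resolve_right fun h => h.elim ht.2 fun h =>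
        absurd (M.crit_lt_of_mem i h) (not_lt.2 ht.1.2)) ⟨hp.2.le, le_rfl⟩ hr hr₁
    have B := M.continuousOn_retract i.succ c₂ (Q := Icc (M.crit i) q) isCompact_Icc
      (fun t ht => ((hJi t (hJ.out hi hqJ ht.1)).resolve_left fun h =>
        absurd (M.lt_crit_of_mem i h) (not_lt.2 ht.1.1)).resolve_left ht.2) ⟨le_rfl, hq.2.le⟩ hr hr₂
    have C := A.union_of_isClosed B (isClosed_Icc.preimage M.continuous)
      (isClosed_Icc.preimage M.continuous)
    rw [← preimage_union, Icc_union_Icc_eq_Icc hp.2.le hq.2.le] at C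
    exact C.continuousAt (Filter.mem_of_superset
      ((isOpen_Ioo.preimage M.continuous).mem_nhds ⟨hp.1, hq.1⟩) (preimage_mono Ioo_subset_Icc_self))
  · rcases hJi _ hx with h | h | h
    · obtain ⟨y, hy⟩ := M.exists_μbar_eq _ x h
      have := hr₁ y ⟨f x, openGap_subset _ _ h⟩ h
      rw [hy] at this
      rw [this, M.f_μbar]
    · rw [hr x h, h]
    · obtain ⟨y, hy⟩ := M.exists_μbar_eq _ x h
      have := hr₂ y ⟨f x, openGap_subset _ _ h⟩ h
      rw [hy] at this
      rw [this, M.f_μbar]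

/-- A critical slice realises the components over its star. -/
theorem cell_slice [T2Space X] (M : MorseType f) (i : Fin M.n) {J : Set ℝ} (hJ : J.OrdConnected)
    (hJo : IsOpen J) (hi : M.crit i ∈ J)
    (hJi : ∀ t ∈ J, t ∈ openGap M.crit i.castSucc ∨ t = M.crit i ∨ t ∈ openGap M.crit i.succ) :
    Cell f J fun x : M.slice i => (x.1 : X) where
  joined_iff x x' := by
    constructor
    · intro h
      -- The retraction pushes a path over the star into the level set and fixes its end points.
      obtain ⟨r, hrc, hr, hrJ⟩ := M.exists_retract i hJ hJo hi hJi
      have h1 := h.map_continuousOn hrc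
      rw [hr _ x.2, hr _ x'.2] at h1
      have h2 : JoinedIn (f ⁻¹' {M.crit i}) x.1 x'.1 := h1.mono <| by
        rintro _ ⟨z, hz, rfl⟩; exact hrJ z hz
      exact h2.joined_subtype
    · intro h
      refine ((joinedIn_iff_joined (F := f ⁻¹' {M.crit i}) x.2 x'.2).2 h).mono ?_
      intro z hz
      exact (show f z ∈ J from (show f z = M.crit i from hz) ▸ hi)
  surj x hx := by
    rcases hJi _ hx with h | h | h
    · obtain ⟨y, hy⟩ := M.exists_μbar_eq _ x h
      refine ⟨⟨_, M.f_μbar _ y _ (M.crit_mem_closedGap_castSucc i)⟩, ?_⟩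
      have := M.joinedIn_μbar _ hJ (Joined.refl y) ⟨_, M.crit_mem_closedGap_castSucc i⟩
        ⟨f x, openGap_subset _ _ h⟩ hi hx
      rwa [hy] at this
    · exact ⟨⟨x, h⟩, JoinedIn.refl hx⟩
    · obtain ⟨y, hy⟩ := M.exists_μbar_eq _ x h
      refine ⟨⟨_, M.f_μbar _ y _ (M.crit_mem_closedGap_succ i)⟩, ?_⟩
      have := M.joinedIn_μbar _ hJ (Joined.refl y) ⟨_, M.crit_mem_closedGap_succ i⟩
        ⟨f x, openGap_subset _ _ h⟩ hi hx
      rwa [hy] at this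

/-- An open interval contained in a larger one with the same critical values meets the same gaps. -/
theorem exists_mem_inter_openGap (M : MorseType f) {J₀ J : Set ℝ} (h : J₀ ⊆ J)
    (hJ : J.OrdConnected) (hJ₀ : IsOpen J₀) (hne : J₀.Nonempty)
    (hcrit : ∀ i, M.crit i ∈ J → M.crit i ∈ J₀) (i : Fin (M.n + 1)) {t : ℝ} (htJ : t ∈ J)
    (ht : t ∈ openGap M.crit i) : ∃ s ∈ J₀, s ∈ openGap M.crit i := by
  obtain ⟨s₀, hs₀⟩ := hne
  by_cases hs : s₀ ∈ openGap M.crit i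
  · exact ⟨s₀, hs₀, hs⟩
  · rw [openGap, mem_ofPred_eq, not_and_or] at hs
    push Not at hs
    rcases hs with ⟨j, hj, hsj⟩ | ⟨j, hj, hsj⟩
    -- A critical value separates `s₀` from the gap. The end `M.crit j₀` of the gap on that side
    -- lies between `s₀` and `t`, hence in `J` and so in `J₀`. Being open, `J₀` reaches from there
    -- into the gap.
    · obtain ⟨j₀, rfl⟩ := Fin.exists_succ_eq.2 (Fin.ne_zero_of_lt hj)
      have h1 : M.crit j₀ < t := M.crit_lt_of_mem j₀ ht
      have h2 : M.crit j ≤ M.crit j₀ := M.strictMono.monotone (Fin.castSucc_lt_succ_iff.1 hj)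
      obtain ⟨s, hs, hs1, hs2⟩ := hJ₀.exists_gt_mem
        (hcrit j₀ (hJ.out (h hs₀) htJ ⟨hsj.trans h2, h1.le⟩)) h1
      exact ⟨s, hs, fun k hk => (M.strictMono.monotone (Fin.castSucc_lt_succ_iff.1 hk)).trans_lt hs1,
        fun k hk => hs2.trans (ht.2 k hk)⟩
    · obtain ⟨j₀, rfl⟩ := Fin.exists_castSucc_eq.2 (Fin.ne_last_of_lt
        (hj.trans_lt (Fin.castSucc_lt_last j)))
      have h1 : t < M.crit j₀ := M.lt_crit_of_mem j₀ ht
      have h2 : M.crit j₀ ≤ M.crit j := M.strictMono.monotone (Fin.castSucc_le_castSucc_iff.1 hj)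
      obtain ⟨s, hs, hs1, hs2⟩ := hJ₀.exists_lt_mem
        (hcrit j₀ (hJ.out htJ (h hs₀) ⟨h1.le, h2.trans hsj⟩)) h1
      exact ⟨s, hs, fun k hk => (ht.1 k hk).trans hs1,
        fun k hk => hs2.trans_le (M.strictMono.monotone (Fin.castSucc_le_castSucc_iff.1 hk))⟩

/-- All critical values of `J` are in `J₀`, so a point that is not over `J₀` lies over a gap. This
gap meets `J₀`, and the vertical line through the point leads there. -/
theorem exists_joinedIn_of_crit_subset (M : MorseType f) {J₀ J : Set ℝ} (h : J₀ ⊆ J)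
    (hJ : J.OrdConnected) (hJ₀ : IsOpen J₀) (hne : J₀.Nonempty)
    (hcrit : ∀ i, M.crit i ∈ J → M.crit i ∈ J₀) {x : X} (hx : f x ∈ J) :
    ∃ x₀, f x₀ ∈ J₀ ∧ JoinedIn (f ⁻¹' J) x x₀ := by
  by_cases hx₀ : f x ∈ J₀
  · exact ⟨x, hx₀, JoinedIn.refl hx⟩
  · obtain ⟨i, hi⟩ := exists_mem_openGap M.strictMono (t := f x)
      fun i hi => hx₀ (hi ▸ hcrit i (hi ▸ hx))
    obtain ⟨s, hs, hsi⟩ := M.exists_mem_inter_openGap h hJ hJ₀ hne hcrit i hx hi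
    obtain ⟨y, hy⟩ := M.exists_μbar_eq i x hi
    refine ⟨M.μbar i (y, ⟨s, openGap_subset _ _ hsi⟩), M.f_μbar_mem _ _ _ hs, ?_⟩
    have := M.joinedIn_μbar i hJ (Joined.refl y) ⟨f x, openGap_subset _ _ hi⟩
      ⟨s, openGap_subset _ _ hsi⟩ hx (h hs)
    rwa [hy] at this

/-- Points over an open interval that are joined over a larger interval with the same critical
values are joined over the smaller one. -/
theorem joinedIn_of_crit_subset (M : MorseType f) {J₀ J : Set ℝ} (h : J₀ ⊆ J)
    (hJ : J.OrdConnected) (hJ₀ : IsOpen J₀) (hJ₀' : J₀.OrdConnected)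
    (hcrit : ∀ i, M.crit i ∈ J → M.crit i ∈ J₀) {x x' : X} (hx : f x ∈ J₀) (hx' : f x' ∈ J₀)
    (hxx' : JoinedIn (f ⁻¹' J) x x') : JoinedIn (f ⁻¹' J₀) x x' := by
  classical
  have hne : J₀.Nonempty := ⟨_, hx⟩
  -- Instead of a continuous retraction to `f⁻¹(J₀)`, only the component reached by sliding along a
  -- vertical line is recorded. `G z` is the component of `z` over `J₀`, and `g` extends it to the
  -- points over `J`; its constancy along paths is all that is needed.
  let G : X → Set X := fun z => {w | JoinedIn (f ⁻¹' J₀) z w}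
  have hG : ∀ z w, JoinedIn (f ⁻¹' J₀) z w → G z = G w := fun z w hzw => by
    ext v; exact ⟨fun hv => hzw.symm.trans hv, fun hv => hzw.trans hv⟩
  have key : ∃ g : X → Set X, (∀ z, f z ∈ J₀ → g z = G z) ∧ ∀ i (y : M.Y i) (t s : closedGap M.crit i),
      t.1 ∈ J → t.1 ∈ openGap M.crit i → s.1 ∈ J₀ → g (M.μbar i (y, t)) = G (M.μbar i (y, s)) := by
    have hc : ∀ z, ∃ A, (f z ∈ J₀ → A = G z) ∧ ∀ i (y : M.Y i) (t s : closedGap M.crit i),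
        t.1 ∈ J → t.1 ∈ openGap M.crit i → s.1 ∈ J₀ → z = M.μbar i (y, t) →
          A = G (M.μbar i (y, s)) := by
      intro z
      by_cases hz : f z ∈ J₀
      · refine ⟨G z, fun _ => rfl, fun i y t s _ _ hs hzt => hG _ _ ?_⟩
        rw [hzt, M.f_μbar] at hz
        rw [hzt]
        exact M.joinedIn_μbar i hJ₀' (Joined.refl y) _ _ hz hs
      · by_cases hz' : ∃ i, ∃ y : M.Y i, ∃ t s : closedGap M.crit i, t.1 ∈ openGap M.crit i ∧ s.1 ∈ J₀ ∧
            z = M.μbar i (y, t)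
        · obtain ⟨i, y, t, s, ht, hs, rfl⟩ := hz'
          refine ⟨G (M.μbar i (y, s)), fun h => absurd h hz, fun j y' t' s' _ ht' hs' he => hG _ _ ?_⟩
          have hij : i = j := by
            have hfe := congrArg f he
            rw [M.f_μbar, M.f_μbar] at hfe
            by_contra hij
            rw [← hfe] at ht'
            rcases lt_or_gt_of_ne hij with hij | hij
            · obtain ⟨k, rfl⟩ := Fin.exists_castSucc_eq.2 (Fin.ne_last_of_lt hij)
              exact lt_asymm (M.lt_crit_of_mem k ht) (ht'.1 k hij)
            · obtain ⟨k, rfl⟩ := Fin.exists_castSucc_eq.2 (Fin.ne_last_of_lt hij)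
              exact lt_asymm (M.lt_crit_of_mem k ht') (ht.1 k hij)
          subst hij
          obtain ⟨rfl, rfl⟩ := M.μbar_injective i ht he
          exact M.joinedIn_μbar i hJ₀' (Joined.refl y) _ _ hs hs'
        · exact ⟨∅, fun h => absurd h hz, fun i y t s _ ht hs he =>
            absurd ⟨i, y, t, s, ht, hs, he⟩ hz'⟩
    choose g hg using hc
    exact ⟨g, fun z => (hg z).1, fun i y t s h1 h2 h3 => (hg _).2 i y t s h1 h2 h3 rfl⟩
  obtain ⟨g, hg, hg'⟩ := key
  have : g x = g x' := by
    refine eq_of_joinedIn (fun a ha => ?_) hxx'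
    by_cases ha₀ : f a ∈ J₀
    · refine ⟨f ⁻¹' J₀, (hJ₀.preimage M.continuous).mem_nhds ha₀, fun b b' hb => ?_⟩
      have hb' := hb.mono inter_subset_left
      rw [hg _ hb'.source_mem, hg _ hb'.target_mem]
      exact hG _ _ hb'
    · obtain ⟨i, hi⟩ := exists_mem_openGap M.strictMono (t := f a)
        fun i hi => ha₀ (hi ▸ hcrit i (hi ▸ ha))
      obtain ⟨s, hs, hsi⟩ := M.exists_mem_inter_openGap h hJ hJ₀ hne hcrit i ha hi
      -- Points joined over the gap have joined coordinates in the cylinder, so the points at height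
      -- `s` on their vertical lines are joined over `J₀`.
      refine ⟨f ⁻¹' openGap M.crit i, ((isOpen_openGap _ _).preimage M.continuous).mem_nhds hi,
        fun b b' hb => ?_⟩
      have hbi := hb.source_mem
      have hbi' := hb.target_mem
      obtain ⟨y, hy⟩ := M.exists_μbar_eq i b hbi.1
      obtain ⟨y', hy'⟩ := M.exists_μbar_eq i b' hbi'.1
      have e := hg' i y ⟨f b, openGap_subset _ _ hbi.1⟩ ⟨s, openGap_subset _ _ hsi⟩ hbi.2 hbi.1 hs
      have e' := hg' i y' ⟨f b', openGap_subset _ _ hbi'.1⟩ ⟨s, openGap_subset _ _ hsi⟩ hbi'.2 hbi'.1 hs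
      rw [hy] at e
      rw [hy'] at e'
      rw [e, e']
      refine hG _ _ (M.joinedIn_μbar i hJ₀' ?_ _ _ hs hs)
      have hb' := hb.mono inter_subset_left
      rw [← hy, ← hy'] at hb'
      exact M.joined_of_joinedIn_openGap i (t := ⟨f b, openGap_subset _ _ hbi.1⟩)
        (t' := ⟨f b', openGap_subset _ _ hbi'.1⟩) hbi.1 hbi'.1 hb'
  rw [hg x hx, hg x' hx'] at this
  exact (this.symm ▸ JoinedIn.refl hx' : x' ∈ G x)

end MorseType

/-! ### Decorated telescopes

A decoration of a telescope is a list of triples `(c, lo, hi)`, one for every critical value `c`. The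
slice at `c` is to represent the components of a space over `(lo, hi)`, and the cylinder between two
consecutive slices is to represent the components over the intersection of their intervals. -/

/-- The lower bound of the first interval of a decoration. -/
def firstLo : List (ℝ × EReal × EReal) → EReal → EReal
  | [], l => l
  | e :: _, _ => e.2.1

/-- The upper bound of the last interval of a decoration. -/
def lastHi : List (ℝ × EReal × EReal) → EReal → EReal
  | [], h => h
  | e :: dl, _ => lastHi dl e.2.2

/-- The interval represented by the part of a telescope at height `t`. -/
noncomputable def localSet : List (ℝ × EReal × EReal) → EReal → EReal → ℝ → Set ℝ
  | [], h, l, _ => realIoo l h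
  -- `h` is the upper bound of the preceding entry, so `(e.2.1, h)` belongs to the cylinder below
  -- `e.1`. In the same way `l` serves as a lower bound for the cylinder above the last entry.
  | e :: dl, h, l, t => if t < e.1 then realIoo e.2.1 h else
      if t = e.1 then realIoo e.2.1 e.2.2 else localSet dl e.2.2 l t

/-- A star of a critical slice in the disjoint union of the pieces: the whole cylinder below, the
slice, and an open part `U` of what lies above. All is checked on the three summands. -/
theorem continuousOn_starSum {P Q R W : Type*} [TopologicalSpace P] [TopologicalSpace Q]
    [TopologicalSpace R] [TopologicalSpace W] {U : Set R} (hU : IsOpen U) {a : P → W} {b : Q → W}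
    {r : R → W} (ha : Continuous a) (hb : Continuous b) (hr : ContinuousOn r U) :
    IsOpen {q : P ⊕ (Q ⊕ R) | ∀ p, q = Sum.inr (Sum.inr p) → p ∈ U} ∧
      ContinuousOn (Sum.elim a (Sum.elim b r)) {q | ∀ p, q = Sum.inr (Sum.inr p) → p ∈ U} := by
  have hV : IsOpen {q : P ⊕ (Q ⊕ R) | ∀ p, q = Sum.inr (Sum.inr p) → p ∈ U} := by
    rw [isOpen_sum_iff, isOpen_sum_iff]
    refine ⟨?_, ?_, ?_⟩
    · convert isOpen_univ; simp
    · convert isOpen_univ; simp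
    · convert hU; ext; simp
  refine ⟨hV, fun q hq => ContinuousAt.continuousWithinAt ?_⟩
  rcases q with q | q | q
  · exact (Topology.IsOpenEmbedding.inl.continuousAt_iff (g := Sum.elim a _)).1 ha.continuousAt
  · refine (Topology.IsOpenEmbedding.inr.continuousAt_iff (g := Sum.elim a (Sum.elim b r))).1 ?_
    exact (Topology.IsOpenEmbedding.inl.continuousAt_iff (g := Sum.elim b r)).1 hb.continuousAt
  · refine (Topology.IsOpenEmbedding.inr.continuousAt_iff (g := Sum.elim a (Sum.elim b r))).1 ?_
    exact (Topology.IsOpenEmbedding.inr.continuousAt_iff (g := Sum.elim b r)).1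
      (hr.continuousAt (hU.mem_nhds (hq q rfl)))

/-- Extends a chart of the upper pieces to all pieces; `w` is a mere default value outside the
domain of the chart. -/
theorem continuousOn_inr_inr {P Q R W : Type*} [TopologicalSpace P] [TopologicalSpace Q]
    [TopologicalSpace R] [TopologicalSpace W] {U : Set R} (hU : IsOpen U) {r : R → W}
    (hr : ContinuousOn r U) (w : W) :
    IsOpen ((fun p => (Sum.inr (Sum.inr p) : P ⊕ (Q ⊕ R))) '' U) ∧
      ContinuousOn (Sum.elim (fun _ => w) (Sum.elim (fun _ => w) r))
        ((fun p => (Sum.inr (Sum.inr p) : P ⊕ (Q ⊕ R))) '' U) := by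
  have h := continuousOn_starSum (P := P) (Q := Q) hU (continuous_const (y := w))
    (continuous_const (y := w)) hr
  refine ⟨(isOpenMap_inr.comp isOpenMap_inr) _ hU, h.2.mono ?_⟩
  rintro _ ⟨p, hp, rfl⟩ q hq
  obtain rfl := Sum.inr_injective (Sum.inr_injective hq)
  exact hp

namespace Telescope

variable {X : Type u} [TopologicalSpace X]

/-- The telescope `T` with decoration `dl` represents the components of `X`, where the lowest cylinder
lies below the height `h`, is mapped to `X` by `κ`, and the highest cylinder lies above `l` and is
mapped to `X` by `κ'`. -/
def Realises (f : X → ℝ) : {Y Z : TopCat.{u}} → Telescope Y Z → List (ℝ × EReal × EReal) →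
    EReal → (Y → X) → EReal → (Z → X) → Prop
  | _, _, nil _, [], h, κ, l, κ' => l < h ∧ Cell f (realIoo l h) κ ∧ κ' = κ
  | _, _, nil _, _ :: _, _, _, _, _ => False
  | _, _, cons _ _ _ _ _, [], _, _, _, _ => False
  -- The inequalities make both bounds weakly increase from entry to entry, so that consecutive
  -- intervals intersect in the interval of the cylinder between them. The maps to `X` need not be
  -- continuous, and they respect the attaching maps only up to components over the interval of the
  -- slice.
  | _, _, cons (Y' := Y') S c ψ φ T, e :: dl, h, κ, l, κ' =>
      e.1 = c ∧ e.2.1 < h ∧ h ≤ e.2.2 ∧ e.2.1 ≤ firstLo dl l ∧ Cell f (realIoo e.2.1 h) κ ∧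
      ∃ (κS : S → X) (κ₁ : Y' → X), Cell f (realIoo e.2.1 e.2.2) κS ∧
        (∀ y, JoinedIn (f ⁻¹' realIoo e.2.1 e.2.2) (κ y) (κS (ψ y))) ∧
        (∀ y, JoinedIn (f ⁻¹' realIoo e.2.1 e.2.2) (κ₁ y) (κS (φ y))) ∧
        Realises f T dl e.2.2 κ₁ l κ'

/-- The same condition, for a map on the pieces of the telescope. -/
def Represents (f : X → ℝ) : {Y Z : TopCat.{u}} → (T : Telescope Y Z) → (S : Set ℝ) →
    List (ℝ × EReal × EReal) → EReal → EReal → (T.Pieces S → X) → Prop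
  | Y, _, nil _, S, [], h, l, k => l < h ∧ ∃ κ : Y → X, Cell f (realIoo l h) κ ∧
      ∀ (y : Y) (t : S), k (y, t) = κ y
  | _, _, nil _, _, _ :: _, _, _, _ => False
  | _, _, cons _ _ _ _ _, _, [], _, _, _ => False
  | Y, _, cons (Y' := Y') A c ψ φ T, S, e :: dl, h, l, k =>
      e.1 = c ∧ e.2.1 < h ∧ h ≤ e.2.2 ∧ e.2.1 ≤ firstLo dl l ∧
      (∃ κ : Y → X, Cell f (realIoo e.2.1 h) κ ∧
        (∀ (y : Y) (t : ↥(S ∩ Iic c)), k (Sum.inl (y, t)) = κ y) ∧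
        ∀ y, JoinedIn (f ⁻¹' realIoo e.2.1 e.2.2) (κ y) (k (Sum.inr (Sum.inl (ψ y))))) ∧
      Cell f (realIoo e.2.1 e.2.2) (fun x : A => k (Sum.inr (Sum.inl x))) ∧
      (∀ (y : Y') (p : T.Pieces (Ici c)) t, T.IsLowPoint (Ici c) y t p →
        JoinedIn (f ⁻¹' realIoo e.2.1 e.2.2) (k (Sum.inr (Sum.inr p)))
          (k (Sum.inr (Sum.inl (φ y))))) ∧
      T.Represents f (Ici c) dl e.2.2 l (fun p => k (Sum.inr (Sum.inr p)))

/-- The maps on the cylinders and slices are collected into one map `k`, which ignores the height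
within each cylinder. -/
theorem Realises.exists_represents {f : X → ℝ} {Y Z : TopCat.{u}} {T : Telescope Y Z}
    {dl : List (ℝ × EReal × EReal)} {h l : EReal} {κ : Y → X} {κ' : Z → X}
    (H : T.Realises f dl h κ l κ') (S : Set ℝ) :
    ∃ k : T.Pieces S → X, T.Represents f S dl h l k ∧
      (∀ y t p, T.IsLowPoint S y t p → k p = κ y) ∧
      ∀ t hS ht z, k (T.highPoint S t hS ht z) = κ' z := by
  induction T generalizing S dl h with
  | nil Y =>
    match dl, H with
    | [], ⟨hlh, hc, hκ⟩ =>
      refine ⟨fun p => κ p.1, ⟨hlh, κ, hc, fun _ _ => rfl⟩, ?_, fun _ _ _ _ => by rw [hκ]; rfl⟩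
      rintro y t _ ⟨_, rfl⟩
      rfl
  | @cons Y Y' Z A c ψ φ T ih =>
    match dl, H with
    | e :: dl, ⟨h1, h2, h3, h4, h5, κS, κ₁, h6, h7, h8, h9⟩ =>
      obtain ⟨k, hk, hlow, hhigh⟩ := ih h9 (Ici c)
      refine ⟨Sum.elim (fun p => κ p.1) (Sum.elim κS k), ⟨h1, h2, h3, h4,
        ⟨κ, h5, fun _ _ => rfl, h7⟩, h6, fun y p t hp => ?_, hk⟩, ?_, fun t hS ht z => hhigh _ _ _ z⟩
      · have := h8 y
        rw [← hlow y t p hp] at this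
        exact this
      · rintro y t _ ⟨_, rfl⟩
        rfl

theorem le_piecesHeight {Y Z : TopCat.{u}} (T : Telescope Y Z) (S : Set ℝ) {a : ℝ}
    (hS : ∀ t ∈ S, a ≤ t) (hT : ∀ c ∈ T.crit, a ≤ c) (p : T.Pieces S) : a ≤ T.piecesHeight S p := by
  induction T generalizing S with
  | nil Y => exact hS _ p.2.2
  | cons A c ψ φ T ih =>
    have hc := hT c (List.mem_cons_self ..)
    rcases p with p | p | p
    · exact hS _ p.2.2.1
    · exact hc
    · exact ih (Ici c) (fun t ht => hc.trans ht) (fun c' hc' => hT c' (List.mem_cons_of_mem _ hc')) p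

theorem continuous_piecesHeight {Y Z : TopCat.{u}} (T : Telescope Y Z) (S : Set ℝ) :
    Continuous (T.piecesHeight S) := by
  induction T generalizing S with
  | nil Y => exact continuous_subtype_val.comp continuous_snd
  | cons A c ψ φ T ih =>
    exact Continuous.sumElim (continuous_subtype_val.comp continuous_snd)
      (Continuous.sumElim continuous_const (ih _))

/-- A neighbourhood of the bottom of the lowest cylinder. -/
theorem exists_lowStar {Y Z : TopCat.{u}} (T : Telescope Y Z) {c : ℝ}
    (hc : ∀ c' ∈ T.crit, c < c') (hT : T.crit.Pairwise (· < ·)) {W : TopCat.{u}} (φ : C(Y, W))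
    (w : W) :
    ∃ (U : Set (T.Pieces (Ici c))) (r : T.Pieces (Ici c) → W), IsOpen U ∧
      (∀ p, T.piecesHeight (Ici c) p ≤ c → p ∈ U) ∧
      (∀ p q, T.Glue (Ici c) p q → p ∉ U ∧ q ∉ U) ∧
      ContinuousOn r U ∧ (∀ y t p, T.IsLowPoint (Ici c) y t p → r p = φ y) ∧
      (∀ y p, T.IsLowPoint (Ici c) y c p → p ∈ U) ∧
      ∀ p ∈ U, ∃ y t, T.IsLowPoint (Ici c) y t p := by
  cases T with
  | nil Y =>
    refine ⟨univ, fun p => φ p.1, isOpen_univ, fun _ _ => trivial, fun _ _ h => h.elim,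
      (φ.continuous.comp continuous_fst).continuousOn, ?_, fun _ _ _ => trivial,
      fun p _ => ⟨p.1, p.2, p.2.2, rfl⟩⟩
    rintro y t _ ⟨_, rfl⟩
    rfl
  | @cons Y Y' Z A c₂ ψ φ' T =>
    have hc₂ := hc c₂ (List.mem_cons_self ..)
    have hge := T.le_piecesHeight (Ici c₂) (a := c₂) (fun t ht => ht)
      (fun c' hc' => ((List.pairwise_cons.1 hT).1 c' hc').le)
    -- The neighbourhood stops strictly below the next critical value, so no identification within
    -- `T` touches it.
    refine ⟨Sum.inl '' {q | (q.2 : ℝ) < c₂}, Sum.elim (fun q => φ q.1) (fun _ => w),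
      isOpenMap_inl _ (isOpen_lt (by fun_prop) continuous_const), ?_, ?_, ?_, ?_, ?_, ?_⟩
    · rintro (q | x | p) hp
      · exact ⟨q, lt_of_le_of_lt hp hc₂, rfl⟩
      · exact absurd hp (not_le.2 hc₂)
      · exact absurd hp (not_le.2 (hc₂.trans_le (hge p)))
    · rintro p q (⟨y, h, rfl, rfl⟩ | ⟨y, p', h, rfl, rfl⟩ | ⟨p', q', h, rfl, rfl⟩)
      · refine ⟨?_, ?_⟩
        · rintro ⟨q, hq, he⟩
          obtain rfl := Sum.inl_injective he
          exact lt_irrefl c₂ hq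
        · rintro ⟨q, hq, he⟩; cases he
      · constructor <;> (rintro ⟨q, hq, he⟩; cases he)
      · constructor <;> (rintro ⟨q, hq, he⟩; cases he)
    · exact Continuous.continuousOn (Continuous.sumElim (φ.continuous.comp continuous_fst)
        continuous_const)
    · rintro y t _ ⟨_, rfl⟩
      rfl
    · rintro y _ ⟨h, rfl⟩
      exact ⟨_, hc₂, rfl⟩
    · rintro _ ⟨q, hq, rfl⟩
      exact ⟨q.1, q.2, q.2.2, rfl⟩

/-- Near `p`, the space is described by a continuous map to a space whose components are mapped to
components over `D`. -/
def HasChart (f : X → ℝ) {Y Z : TopCat.{u}} (T : Telescope Y Z) (S : Set ℝ) (k : T.Pieces S → X)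
    (p : T.Pieces S) (D : Set ℝ) : Prop :=
  ∃ (U : Set (T.Pieces S)) (W : TopCat.{u}) (r : T.Pieces S → W), IsOpen U ∧ p ∈ U ∧
    -- `U` is saturated and `r` is compatible with the identifications, so both descend to the
    -- adjunction space.
    (∀ q q', T.Glue S q q' → (q ∈ U ↔ q' ∈ U)) ∧ (∀ q q', T.Glue S q q' → q ∈ U → r q = r q') ∧
    ContinuousOn r U ∧ ∀ q q', q ∈ U → q' ∈ U → Joined (r q) (r q') →
      JoinedIn (f ⁻¹' D) (k q) (k q')

/-- There are three kinds of charts. The open part of a cylinder projects to the cylinder. The star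
of a slice retracts to the slice by the attaching maps. In the upper part charts exist by induction,
cut down to heights above `e.1` to stay clear of the identifications at `e.1`. -/
theorem Represents.hasChart {f : X → ℝ} {Y Z : TopCat.{u}} {T : Telescope Y Z} {S : Set ℝ}
    {dl : List (ℝ × EReal × EReal)} {h l : EReal} {k : T.Pieces S → X}
    (H : T.Represents f S dl h l k) (hT : T.crit.Pairwise (· < ·)) (p : T.Pieces S) :
    T.HasChart f S k p (localSet dl h l (T.piecesHeight S p)) := by
  induction T generalizing S dl h with
  | nil Y =>
    match dl, H with
    | [], ⟨_, κ, hκ, hk⟩ =>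
      refine ⟨univ, Y, fun q => q.1, isOpen_univ, trivial, fun _ _ h => h.elim,
        fun _ _ h => h.elim, continuous_fst.continuousOn, ?_⟩
      rintro ⟨y, t⟩ ⟨y', t'⟩ - - hj
      rw [hk, hk]
      exact (hκ.joined_iff _ _).2 hj
  | @cons Y Y' Z A c ψ φ T ih =>
    match dl, H with
    | e :: dl, ⟨h1, h2, h3, h4, ⟨κ, h5, h6, h7⟩, h8, h9, h10⟩ =>
      subst h1
      obtain ⟨hT1, hT2⟩ := List.pairwise_cons.1 hT
      have hge := T.le_piecesHeight (Ici e.1) (a := e.1) (fun t ht => ht)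
        (fun c' hc' => (hT1 c' hc').le)
      -- The point `x` only supplies a value of the chart map outside the star.
      have star : ∀ x : A, ∀ p, (cons A e.1 ψ φ T).piecesHeight S p = e.1 →
          (cons A e.1 ψ φ T).HasChart f S k p (realIoo e.2.1 e.2.2) := by
        intro x p hp
        obtain ⟨U, r, hU, hUc, hUg, hr, hrl, hUl, hUe⟩ := T.exists_lowStar hT1 hT2 φ x
        let R : (cons A e.1 ψ φ T).Pieces S → A :=
          Sum.elim (fun q : Y × ↥(S ∩ Iic e.1) => ψ q.1) (Sum.elim id r)
        let V : Set ((cons A e.1 ψ φ T).Pieces S) := {q | ∀ p', q = Sum.inr (Sum.inr p') → p' ∈ U}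
        have hR : ∀ q ∈ V, JoinedIn (f ⁻¹' realIoo e.2.1 e.2.2) (k q)
            (k (Sum.inr (Sum.inl (R q)))) := by
          rintro (⟨y, t⟩ | x | q) hq
          · rw [h6]; exact h7 y
          · exact JoinedIn.refl (h8.mem x)
          · obtain ⟨y, t, hy⟩ := hUe q (hq q rfl)
            have := h9 y q t hy
            rw [← hrl y t q hy] at this
            exact this
        refine ⟨V, A, R, ?_, ?_, ?_, ?_, ?_, ?_⟩
        · exact (continuousOn_starSum hU (ψ.continuous.comp continuous_fst) continuous_id hr).1
        · rintro q rfl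
          exact hUc q hp.le
        · rintro p q (⟨y, h, rfl, rfl⟩ | ⟨y, p', h, rfl, rfl⟩ | ⟨p', q', h, rfl, rfl⟩)
          · exact iff_of_true (fun _ he => by cases he) (fun _ he => by cases he)
          · refine iff_of_true (fun p he => ?_) (fun _ he => by cases he)
            obtain rfl := Sum.inr_injective (Sum.inr_injective he)
            exact hUl y _ h
          · exact iff_of_false (fun h' => (hUg _ _ h).1 (h' _ rfl))
              (fun h' => (hUg _ _ h).2 (h' _ rfl))
        · rintro p q (⟨y, h, rfl, rfl⟩ | ⟨y, p', h, rfl, rfl⟩ | ⟨p', q', h, rfl, rfl⟩) hq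
          · rfl
          · exact hrl y _ _ h
          · exact absurd (hq _ rfl) (hUg _ _ h).1
        · exact (continuousOn_starSum hU (ψ.continuous.comp continuous_fst) continuous_id hr).2
        · intro q q' hq hq' hj
          exact ((hR q hq).trans ((h8.joined_iff _ _).2 hj)).trans (hR q' hq').symm
      rcases lt_trichotomy ((cons A e.1 ψ φ T).piecesHeight S p) e.1 with hp | hp | hp
      · rw [localSet, if_pos hp]
        rcases p with ⟨y₀, t₀⟩ | x | p
        · refine ⟨Sum.inl '' {q | (q.2 : ℝ) < e.1}, Y, Sum.elim (fun q => q.1) (fun _ => y₀),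
            isOpenMap_inl _ (isOpen_lt (by fun_prop) continuous_const), ⟨_, hp, rfl⟩, ?_, ?_,
            Continuous.continuousOn (Continuous.sumElim continuous_fst continuous_const), ?_⟩
          · rintro p q (⟨y, h, rfl, rfl⟩ | ⟨y, p', h, rfl, rfl⟩ | ⟨p', q', h, rfl, rfl⟩)
            · refine iff_of_false ?_ ?_
              · rintro ⟨q, hq, he⟩
                obtain rfl := Sum.inl_injective he
                exact lt_irrefl e.1 hq
              · rintro ⟨q, hq, he⟩; cases he
            · apply iff_of_false <;> (rintro ⟨q, hq, he⟩; cases he)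
            · apply iff_of_false <;> (rintro ⟨q, hq, he⟩; cases he)
          · rintro p q (⟨y, h, rfl, rfl⟩ | ⟨y, p', h, rfl, rfl⟩ | ⟨p', q', h, rfl, rfl⟩) ⟨q, hq, he⟩
            · obtain rfl := Sum.inl_injective he
              exact (lt_irrefl e.1 hq).elim
            · cases he
            · cases he
          · rintro _ _ ⟨⟨y, t⟩, _, rfl⟩ ⟨⟨y', t'⟩, _, rfl⟩ hj
            rw [h6, h6]
            exact (h5.joined_iff _ _).2 hj
        · exact absurd hp (lt_irrefl _)
        · exact absurd hp (not_lt.2 (hge p))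
      · rw [localSet, if_neg hp.not_lt, if_pos hp]
        rcases p with ⟨y₀, t₀⟩ | x | p
        · exact star (ψ y₀) _ hp
        · exact star x _ hp
        -- A point of the upper pieces at height `e.1` can only be at the bottom of the lowest
        -- cylinder, which is thus non-empty and yields a point of the slice.
        · have : ∃ y : Y', True := by
            cases T with
            | nil Y => exact ⟨p.1, trivial⟩
            | cons A' c' ψ' φ' T' =>
              have hc' := hT1 c' (List.mem_cons_self ..)
              rcases p with p | x | p
              · exact ⟨p.1, trivial⟩
              · exact absurd hp hc'.ne'
              · exact absurd hp (hc'.trans_le (T'.le_piecesHeight (Ici c') (a := c')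
                  (fun t ht => ht) (fun c'' hc'' => ((List.pairwise_cons.1 hT2).1 c'' hc'').le) p)).ne'
          exact star (φ this.choose) _ hp
      · rw [localSet, if_neg hp.not_gt, if_neg hp.ne']
        rcases p with ⟨y₀, t₀⟩ | x | p
        · exact absurd hp (not_lt.2 t₀.2.2)
        · exact absurd hp (lt_irrefl _)
        · obtain ⟨U, W, r, hU, hpU, hUg, hrg, hr, hk⟩ := ih h10 hT2 p
          have hU' := hU.inter (isOpen_lt (continuous_const (y := e.1))
            (T.continuous_piecesHeight (Ici e.1)))
          have hc := continuousOn_inr_inr (P := Y × ↥(S ∩ Iic e.1)) (Q := A) hU'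
            (hr.mono inter_subset_left) (r p)
          refine ⟨_, W, _, hc.1, ⟨p, ⟨hpU, hp⟩, rfl⟩, ?_, ?_, hc.2, ?_⟩
          · rintro p q (⟨y, h, rfl, rfl⟩ | ⟨y, p', h, rfl, rfl⟩ | ⟨p', q', h, rfl, rfl⟩)
            · apply iff_of_false <;> (rintro ⟨q, hq, he⟩; cases he)
            · refine iff_of_false ?_ (by rintro ⟨q, hq, he⟩; cases he)
              rintro ⟨q, hq, he⟩
              obtain rfl := Sum.inr_injective (Sum.inr_injective he)
              have h' : e.1 < T.piecesHeight (Ici e.1) q := hq.2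
              rw [T.piecesHeight_isLowPoint _ _ _ _ h] at h'
              exact lt_irrefl _ h'
            · have e1 := hUg _ _ h
              have e2 := T.piecesHeight_glue _ _ _ h
              constructor
              · rintro ⟨q, hq, he⟩
                obtain rfl := Sum.inr_injective (Sum.inr_injective he)
                exact ⟨q', ⟨e1.1 hq.1, by have := hq.2; rwa [mem_ofPred_eq, e2] at this⟩, rfl⟩
              · rintro ⟨q, hq, he⟩
                obtain rfl := Sum.inr_injective (Sum.inr_injective he)
                exact ⟨p', ⟨e1.2 hq.1, by have := hq.2; rwa [mem_ofPred_eq, ← e2] at this⟩, rfl⟩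
          · rintro p q (⟨y, h, rfl, rfl⟩ | ⟨y, p', h, rfl, rfl⟩ | ⟨p', q', h, rfl, rfl⟩) ⟨q, hq, he⟩
            · cases he
            · obtain rfl := Sum.inr_injective (Sum.inr_injective he)
              have h' : e.1 < T.piecesHeight (Ici e.1) q := hq.2
              rw [T.piecesHeight_isLowPoint _ _ _ _ h] at h'
              exact (lt_irrefl _ h').elim
            · obtain rfl := Sum.inr_injective (Sum.inr_injective he)
              exact hrg _ _ h hq.1
          · rintro _ _ ⟨q, hq, rfl⟩ ⟨q', hq', rfl⟩ hj
            exact hk q q' hq.1 hq'.1 hj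

end Telescope

/-! ### Paths in a telescope and components of the represented space. -/

theorem joinedIn_subtype_of_ordConnected {J K : Set ℝ} (hJ : J.OrdConnected) (hK : K.OrdConnected)
    (t t' : K) (ht : t.1 ∈ J) (ht' : t'.1 ∈ J) : JoinedIn {s : K | s.1 ∈ J} t t' := by
  obtain ⟨γ, hγ⟩ := (hJ.inter hK).joinedIn ⟨ht, t.2⟩ ⟨ht', t'.2⟩
  exact ⟨⟨⟨fun s => ⟨γ s, (hγ s).2⟩, by fun_prop⟩, by ext; simp, by ext; simp⟩,
    fun s => (hγ s).1⟩

theorem isOpen_localSet (dl : List (ℝ × EReal × EReal)) (h l : EReal) (t : ℝ) :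
    IsOpen (localSet dl h l t) := by
  induction dl generalizing h with
  | nil => exact isOpen_realIoo _ _
  | cons e dl ih =>
    rw [localSet]
    split_ifs
    · exact isOpen_realIoo _ _
    · exact isOpen_realIoo _ _
    · exact ih _

theorem localSet_of_forall_lt {dl : List (ℝ × EReal × EReal)} {h l : EReal} {t : ℝ}
    (ht : ∀ e ∈ dl, t < e.1) : localSet dl h l t = realIoo (firstLo dl l) h := by
  cases dl with
  | nil => rfl
  | cons e dl => rw [localSet, if_pos (ht e (List.mem_cons_self ..))]; rfl

namespace Telescope

variable {X : Type u} [TopologicalSpace X] {f : X → ℝ}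

/-- The point of the adjunction space given by a point of a piece. -/
def point {Y Z : TopCat.{u}} (T : Telescope Y Z) (p : T.Pieces univ) : T.Space := Quot.mk _ p

/-- A representative of a point of the adjunction space. -/
noncomputable def rep {Y Z : TopCat.{u}} (T : Telescope Y Z) (P : T.Space) : T.Pieces univ :=
  (Quot.exists_rep P).choose

theorem point_rep {Y Z : TopCat.{u}} (T : Telescope Y Z) (P : T.Space) : T.point (T.rep P) = P :=
  (Quot.exists_rep P).choose_spec

theorem piecesHeight_rep {Y Z : TopCat.{u}} (T : Telescope Y Z) (P : T.Space) :
    T.piecesHeight univ (T.rep P) = T.height P := congrArg T.height (T.point_rep P)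

/-- The saturated set and the chart map pass to the quotient. Representatives of one point have the
same chart value, so the choice made by `rep` does not change the component over `D`. -/
theorem HasChart.exists_nhds {Y Z : TopCat.{u}} {T : Telescope Y Z} {k : T.Pieces univ → X}
    {p : T.Pieces univ} {D : Set ℝ} (H : T.HasChart f univ k p D) :
    JoinedIn (f ⁻¹' D) (k p) (k (T.rep (T.point p))) ∧
    ∃ V ∈ 𝓝 (T.point p), ∀ P Q, JoinedIn V P Q →
      JoinedIn (f ⁻¹' D) (k (T.rep P)) (k (T.rep Q)) := by
  classical
  obtain ⟨U, W, r, hU, hp, hUg, hrg, hr, hk⟩ := H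
  let inU : T.Space → Prop := Quot.lift (fun q => q ∈ U) fun q q' hq => propext (hUg q q' hq)
  let R : T.Space → W := Quot.lift (fun q => if q ∈ U then r q else r p) fun q q' hq => by
    by_cases h : q ∈ U
    · simp only [h, (hUg q q' hq).1 h, if_true]; exact hrg q q' hq h
    · simp only [h, mt (hUg q q' hq).2 h, if_false]
  have hV : IsOpen {P | inU P} := isOpen_coinduced.2 hU
  have hout : ∀ P, inU P → (T.rep P) ∈ U := fun P hP => by
    have : inU (T.point (T.rep P)) := by rw [T.point_rep]; exact hP
    exact this
  have hR : ∀ q, q ∈ U → R (T.point q) = r q := fun q hq => if_pos hq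
  have hRout : ∀ P, inU P → R P = r (T.rep P) := fun P hP => by
    rw [← hR _ (hout P hP), T.point_rep]
  have hRc : ContinuousOn R {P | inU P} := by
    rw [continuousOn_open_iff hV]
    intro O hO
    refine isOpen_coinduced.2 ?_
    have : Quot.mk (T.Glue univ) ⁻¹' ({P | inU P} ∩ R ⁻¹' O) = U ∩ r ⁻¹' O := by
      ext q
      constructor
      · rintro ⟨h1, h2⟩
        have h1' : q ∈ U := h1
        refine ⟨h1', ?_⟩
        have h2' : R (T.point q) ∈ O := h2
        rwa [hR q h1'] at h2'
      · rintro ⟨h1, h2⟩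
        refine ⟨h1, ?_⟩
        have h2' : R (T.point q) ∈ O := by rw [hR q h1]; exact h2
        exact h2'
    exact this ▸ (hr.isOpen_inter_preimage hU hO)
  have hpV : inU (T.point p) := hp
  refine ⟨hk _ _ hp (hout _ hpV) ?_, {P | inU P}, hV.mem_nhds hpV, fun P Q hPQ => ?_⟩
  · rw [← hRout _ hpV, hR p hp]
  · have := hPQ.joined_map hRc
    rw [hRout P hPQ.source_mem, hRout Q hPQ.target_mem] at this
    exact hk _ _ (hout P hPQ.source_mem) (hout Q hPQ.target_mem) this

/-- The map `k ∘ rep` need not be continuous, but by the charts the component of its value over `J`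
is locally constant along paths. So `eq_of_joinedIn` applies. -/
theorem Represents.joinedIn_of_joinedIn {Y Z : TopCat.{u}} {T : Telescope Y Z}
    {dl : List (ℝ × EReal × EReal)} {h l : EReal} {k : T.Pieces univ → X}
    (H : T.Represents f univ dl h l k) (hT : T.crit.Pairwise (· < ·)) {J' J : Set ℝ}
    (hJ : ∀ t ∈ J', localSet dl h l t ⊆ J) {P Q : T.Space} (hPQ : JoinedIn (T.height ⁻¹' J') P Q) :
    JoinedIn (f ⁻¹' J) (k (T.rep P)) (k (T.rep Q)) := by
  have key : ∀ R : T.Space, T.height R ∈ J' → JoinedIn (f ⁻¹' J) (k (T.rep R)) (k (T.rep R)) ∧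
      ∃ V ∈ 𝓝 R, ∀ P Q, JoinedIn V P Q → JoinedIn (f ⁻¹' J) (k (T.rep P)) (k (T.rep Q)) := by
    intro R hR
    have hR' : T.point (T.rep R) = R := T.point_rep R
    have h1 := (H.hasChart hT (T.rep R)).exists_nhds
    have h2 : T.piecesHeight univ (T.rep R) = T.height R := T.piecesHeight_rep R
    rw [hR', h2] at h1
    obtain ⟨h3, V, hV, h4⟩ := h1
    exact ⟨h3.mono (preimage_mono (hJ _ hR)), V, hV,
      fun P Q h => (h4 P Q h).mono (preimage_mono (hJ _ hR))⟩
  have := eq_of_joinedIn (g := fun P : T.Space => {x | JoinedIn (f ⁻¹' J) (k (T.rep P)) x})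
    (fun R hR => ?_) hPQ
  · have h1 : k (T.rep Q) ∈ {x | JoinedIn (f ⁻¹' J) (k (T.rep Q)) x} := (key Q hPQ.target_mem).1
    rw [← this] at h1
    exact h1
  · obtain ⟨-, V, hV, h4⟩ := key R hR
    refine ⟨V, hV, fun P Q h => ?_⟩
    have := h4 P Q (h.mono inter_subset_left)
    ext x
    exact ⟨fun hx => this.symm.trans hx, fun hx => this.trans hx⟩

theorem Represents.map_fst {Y Z : TopCat.{u}} {T : Telescope Y Z} {S : Set ℝ}
    {dl : List (ℝ × EReal × EReal)} {h l : EReal} {k : T.Pieces S → X}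
    (H : T.Represents f S dl h l k) : dl.map Prod.fst = T.crit := by
  induction T generalizing S dl h with
  | nil Y =>
    match dl, H with
    | [], _ => rfl
  | cons A c ψ φ T ih =>
    match dl, H with
    | e :: dl, H => rw [List.map_cons, ih H.2.2.2.2.2.2.2, H.1]; rfl

theorem Represents.firstLo_lt {Y Z : TopCat.{u}} {T : Telescope Y Z} {S : Set ℝ}
    {dl : List (ℝ × EReal × EReal)} {h l : EReal} {k : T.Pieces S → X}
    (H : T.Represents f S dl h l k) {t s : ℝ} (hs : s ∈ localSet dl h l t) : firstLo dl l < s := by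
  induction T generalizing S dl h with
  | nil Y =>
    match dl, H with
    | [], _ => exact hs.1
  | cons A c ψ φ T ih =>
    match dl, H with
    | e :: dl, H =>
      rw [localSet] at hs
      split_ifs at hs
      · exact hs.1
      · exact hs.1
      · exact H.2.2.2.1.trans_lt (ih H.2.2.2.2.2.2.2 hs)

theorem Represents.exists_low {Y Z : TopCat.{u}} {T : Telescope Y Z} {S : Set ℝ}
    {dl : List (ℝ × EReal × EReal)} {h l : EReal} {k : T.Pieces S → X}
    (H : T.Represents f S dl h l k) : ∃ κ : Y → X, Cell f (realIoo (firstLo dl l) h) κ ∧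
      ∀ y t p, T.IsLowPoint S y t p → k p = κ y := by
  cases T with
  | nil Y =>
    match dl, H with
    | [], ⟨_, κ, hκ, hk⟩ =>
      refine ⟨κ, hκ, ?_⟩
      rintro y t _ ⟨ht, rfl⟩
      exact hk _ _
  | cons A c ψ φ T =>
    match dl, H with
    | e :: dl, ⟨_, _, _, _, ⟨κ, hκ, hk, _⟩, _⟩ =>
      refine ⟨κ, hκ, ?_⟩
      rintro y t _ ⟨ht, rfl⟩
      exact hk _ _

theorem Represents.exists_of_mem_localSet {Y Z : TopCat.{u}} {T : Telescope Y Z} {S : Set ℝ}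
    {dl : List (ℝ × EReal × EReal)} {h l : EReal} {k : T.Pieces S → X}
    (H : T.Represents f S dl h l k) {t : ℝ} (ht : t ∈ S) {x : X} (hx : f x ∈ localSet dl h l t) :
    ∃ p, T.piecesHeight S p = t ∧ JoinedIn (f ⁻¹' localSet dl h l t) (k p) x := by
  induction T generalizing S dl h with
  | nil Y =>
    match dl, H with
    | [], ⟨_, κ, hκ, hk⟩ =>
      obtain ⟨y, hy⟩ := hκ.surj x hx
      exact ⟨(y, ⟨t, ht⟩), rfl, by rw [hk]; exact hy⟩
  | @cons Y Y' Z A c ψ φ T ih =>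
    match dl, H with
    | e :: dl, ⟨h1, h2, h3, h4, ⟨κ, h5, h6, h7⟩, h8, h9, h10⟩ =>
      subst h1
      rw [localSet] at hx ⊢
      split_ifs at hx ⊢ with c1 c2
      · obtain ⟨y, hy⟩ := h5.surj x hx
        exact ⟨Sum.inl (y, ⟨t, ht, c1.le⟩), rfl, by rw [h6]; exact hy⟩
      · obtain ⟨y, hy⟩ := h8.surj x hx
        exact ⟨Sum.inr (Sum.inl y), c2.symm, hy⟩
      · obtain ⟨p, hp, hk⟩ := ih h10 (not_lt.1 c1) hx
        exact ⟨Sum.inr (Sum.inr p), hp, hk⟩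

/-- `G` is constant on the components of the pieces of the telescope over `J` and compatible with
the identifications over `J`. -/
def Invariant {α : Type*} (J : Set ℝ) : {Y Z : TopCat.{u}} → (T : Telescope Y Z) → (S : Set ℝ) →
    (T.Pieces S → α) → Prop
  | Y, _, nil _, S, G => ∀ (y y' : Y) (t t' : S), t.1 ∈ J → t'.1 ∈ J → Joined y y' →
      G (y, t) = G (y', t')
  | Y, _, cons (Y' := Y') A c ψ φ T, S, G =>
      (∀ (y y' : Y) (t t' : ↥(S ∩ Iic c)), t.1 ∈ J → t'.1 ∈ J → Joined y y' →
        G (Sum.inl (y, t)) = G (Sum.inl (y', t'))) ∧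
      (c ∈ J → ∀ x x' : A, Joined x x' → G (Sum.inr (Sum.inl x)) = G (Sum.inr (Sum.inl x'))) ∧
      (c ∈ J → ∀ (y : Y) (hc : c ∈ S ∩ Iic c),
        G (Sum.inl (y, ⟨c, hc⟩)) = G (Sum.inr (Sum.inl (ψ y)))) ∧
      (c ∈ J → ∀ (y : Y') (p : T.Pieces (Ici c)), T.IsLowPoint (Ici c) y c p →
        G (Sum.inr (Sum.inr p)) = G (Sum.inr (Sum.inl (φ y)))) ∧
      T.Invariant J (Ici c) (fun p => G (Sum.inr (Sum.inr p)))

/-- Meant for the function that sends a point of a piece to its component in the telescope over `J`: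
paths inside one piece and identifications do not change that component. -/
theorem invariant_of_joinedIn {α : Type*} {J : Set ℝ} (hJ : J.OrdConnected) {Y Z : TopCat.{u}}
    (T : Telescope Y Z) (S : Set ℝ) (hS : S.OrdConnected) (G : T.Pieces S → α)
    (h1 : ∀ p q, JoinedIn (T.piecesHeight S ⁻¹' J) p q → G p = G q)
    (h2 : ∀ p q, T.Glue S p q → T.piecesHeight S p ∈ J → G p = G q) : T.Invariant J S G := by
  induction T generalizing S with
  | nil Y =>
    intro y y' t t' ht ht' hy
    exact h1 _ _ (((joinedIn_univ.2 hy).prod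
      (joinedIn_subtype_of_ordConnected hJ hS t t' ht ht')).mono fun q hq => hq.2)
  | @cons Y Y' Z A c ψ φ T ih =>
    refine ⟨fun y y' t t' ht ht' hy => h1 _ _ ?_, fun hc x x' hx => h1 _ _ ?_,
      fun hc y h => h2 _ _ (Or.inl ⟨y, h, rfl, rfl⟩) hc,
      fun hc y p hp => h2 _ _ (Or.inr (Or.inl ⟨y, p, hp, rfl, rfl⟩)) ?_,
      ih (Ici c) ordConnected_Ici _ (fun p q hpq => h1 _ _ ?_)
        (fun p q hpq hp => h2 _ _ (Or.inr (Or.inr ⟨p, q, hpq, rfl, rfl⟩)) hp)⟩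
    · refine ((((joinedIn_univ.2 hy).prod (joinedIn_subtype_of_ordConnected hJ
        (hS.inter ordConnected_Iic) t t' ht ht'))).map (continuous_inl)).mono ?_
      rintro _ ⟨q, hq, rfl⟩
      exact hq.2
    · refine ((joinedIn_univ.2 hx).map (continuous_inr.comp continuous_inl)).mono ?_
      rintro _ ⟨q, hq, rfl⟩
      exact hc
    · change T.piecesHeight (Ici c) p ∈ J
      rw [T.piecesHeight_isLowPoint _ _ _ _ hp]; exact hc
    · refine (hpq.map (continuous_inr.comp continuous_inr)).mono ?_
      rintro _ ⟨q, hq, rfl⟩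
      exact hq

theorem exists_isLowPoint {Y Z : TopCat.{u}} (T : Telescope Y Z) {S : Set ℝ} {t : ℝ} (ht : t ∈ S)
    (hc : ∀ c ∈ T.crit, t ≤ c) (y : Y) : ∃ p, T.IsLowPoint S y t p := by
  cases T with
  | nil Y => exact ⟨(y, ⟨t, ht⟩), ht, rfl⟩
  | cons A c ψ φ T =>
    have h : t ∈ S ∩ Iic c := ⟨ht, hc c (List.mem_cons_self ..)⟩
    exact ⟨Sum.inl (y, ⟨t, h⟩), h, rfl⟩

/-- Van Kampen for telescopes: an invariant function on the pieces over `J` comes from a function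
on the represented part of `X`. -/
theorem Represents.exists_extension (hf : Continuous f) {α : Type*} [Nonempty α] {Y Z : TopCat.{u}}
    {T : Telescope Y Z} {S : Set ℝ} {dl : List (ℝ × EReal × EReal)} {h l : EReal}
    {k : T.Pieces S → X} (H : T.Represents f S dl h l k) (hT : T.crit.Pairwise (· < ·))
    (hS : ∀ c ∈ T.crit, c ∈ S) {J : Set ℝ} (hJ : J.OrdConnected) (G : T.Pieces S → α)
    (hG : T.Invariant J S G) :
    ∃ g : X → α, (∀ x x', JoinedIn (f ⁻¹' ⋃ t ∈ J ∩ S, localSet dl h l t) x x' → g x = g x') ∧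
      ∀ p, T.piecesHeight S p ∈ J → g (k p) = G p := by
  classical
  induction T generalizing S dl h with
  | nil Y =>
    match dl, H with
    | [], ⟨_, κ, hκ, hk⟩ =>
      by_cases hne : (J ∩ S).Nonempty
      · obtain ⟨t, ht⟩ := hne
        obtain ⟨g, hg, hg'⟩ := hκ.lift (fun y => G (y, ⟨t, ht.2⟩))
          fun y y' hy => hG y y' _ _ ht.1 ht.1 hy
        refine ⟨g, fun x x' hx => hg x x' (hx.mono (preimage_mono ?_)), ?_⟩
        · exact iUnion₂_subset fun s _ => subset_rfl
        · rintro ⟨y, s⟩ hs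
          rw [hk, hg']
          exact hG y y _ _ ht.1 hs (Joined.refl y)
      · refine ⟨fun _ => Classical.arbitrary α, fun _ _ _ => rfl, fun p hp => ?_⟩
        exact absurd ⟨_, hp, p.2.2⟩ hne
  | @cons Y Y' Z A c ψ φ T ih =>
    match dl, H with
    | e :: dl, ⟨h1, h2, h3, h4, ⟨κ, h5, h6, h7⟩, h8, h9, h10⟩ =>
      subst h1
      obtain ⟨hT1, hT2⟩ := List.pairwise_cons.1 hT
      obtain ⟨g1, g2, g3, g4, g5⟩ := hG
      have hge := T.le_piecesHeight (Ici e.1) (a := e.1) (fun t ht => ht)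
        (fun c' hc' => (hT1 c' hc').le)
      have ih' := ih h10 hT2 (fun c hc => (hT1 c hc).le) _ g5
      -- If `e.1 ∈ J`, the represented set is covered by two open sets, the interval of the slice
      -- and the set `J3` represented by the rest, and functions on the two are glued. Otherwise `J`
      -- lies on one side of `e.1`, and only the lowest cylinder or only the rest counts.
      by_cases hc : e.1 ∈ J
      · obtain ⟨G1, hG1, hG1'⟩ := h8.lift (fun x => G (Sum.inr (Sum.inl x))) (g2 hc)
        obtain ⟨G3, hG3, hG3'⟩ := ih'
        obtain ⟨κ₁, hκ₁, hκ₁'⟩ := h10.exists_low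
        have hls : localSet dl e.2.2 l e.1 = realIoo (firstLo dl l) e.2.2 := by
          refine localSet_of_forall_lt fun e' he' => hT1 _ ?_
          rw [← h10.map_fst]
          exact List.mem_map_of_mem he'
        set J3 := ⋃ t ∈ J ∩ Ici e.1, localSet dl e.2.2 l t with hJ3
        have hE : realIoo (firstLo dl l) e.2.2 ⊆ J3 := by
          rw [← hls]
          exact subset_iUnion₂_of_subset e.1 ⟨hc, mem_Ici.2 le_rfl⟩ subset_rfl
        -- The overlap lies in the interval of the cylinder above the slice. Each point there is
        -- joined to the image of a point at the bottom of this cylinder, where the two functions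
        -- agree because `G` respects `φ`.
        have hover : ∀ x, f x ∈ realIoo e.2.1 e.2.2 → f x ∈ J3 → G1 x = G3 x := by
          intro x hx1 hx3
          obtain ⟨t, ht, hx3⟩ := mem_iUnion₂.1 hx3
          have hxE : f x ∈ realIoo (firstLo dl l) e.2.2 := ⟨h10.firstLo_lt hx3, hx1.2⟩
          obtain ⟨y, hy⟩ := hκ₁.surj x hxE
          obtain ⟨p, hp⟩ := T.exists_isLowPoint (S := Ici e.1) (mem_Ici.2 le_rfl)
            (fun c' hc' => (hT1 c' hc').le) y
          have e1 := hG1 _ _ (hy.mono (preimage_mono (realIoo_subset h4 le_rfl)))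
          have e3 := hG3 _ _ (hy.mono (preimage_mono hE))
          have hkp := hκ₁' y _ p hp
          have e4 := hG1 _ _ (h9 y p _ hp)
          have e5 := hG3' p (by rw [T.piecesHeight_isLowPoint _ _ _ _ hp]; exact hc)
          rw [hkp] at e4 e5
          rw [← e1, ← e3, e4, e5, hG1', g4 hc y p hp]
        have hg3 : ∀ x, f x ∈ J3 → (if f x ∈ realIoo e.2.1 e.2.2 then G1 x else G3 x) = G3 x := by
          intro x hx
          split_ifs with hx1
          · exact hover x hx1 hx
          · rfl
        refine ⟨fun x => if f x ∈ realIoo e.2.1 e.2.2 then G1 x else G3 x, fun x x' hx => ?_, ?_⟩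
        · refine eq_of_joinedIn_union hf (isOpen_realIoo e.2.1 e.2.2) (J₂ := J3)
            (isOpen_biUnion fun t _ => isOpen_localSet _ _ _ _) (g := fun x => if f x ∈ realIoo e.2.1 e.2.2 then G1 x else G3 x)
            (fun x x' hx => ?_) (fun x x' hx => ?_) ?_ hx
          · have m1 : f x ∈ realIoo e.2.1 e.2.2 := hx.source_mem
            have m2 : f x' ∈ realIoo e.2.1 e.2.2 := hx.target_mem
            simp only [m1, m2, if_true]
            exact hG1 _ _ hx
          · have m1 : f x ∈ J3 := hx.source_mem
            have m2 : f x' ∈ J3 := hx.target_mem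
            simp only [hg3 x m1, hg3 x' m2]
            exact hG3 _ _ hx
          · refine iUnion₂_subset fun t ht => ?_
            rw [localSet]
            split_ifs with c1 c2
            · exact (realIoo_subset le_rfl h3).trans subset_union_left
            · exact subset_union_left
            · exact fun z hz => Or.inr (mem_iUnion₂.2 ⟨t, ⟨ht.1, not_lt.1 c1⟩, hz⟩)
        · rintro (⟨y, t⟩ | x | p) hp
          · have m : f (κ y) ∈ realIoo e.2.1 e.2.2 := realIoo_subset le_rfl h3 (h5.mem y)
            -- The point at height `e.1` of the lower cylinder is a piece since `S` contains the
            -- critical values. It links `(y, t)` with `ψ y`.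
            have hcS : e.1 ∈ S ∩ Iic e.1 := ⟨hS _ (List.mem_cons_self ..), mem_Iic.2 le_rfl⟩
            simp only [h6, m, if_true]
            rw [hG1 _ _ (h7 y), hG1', ← g3 hc y hcS]
            exact g1 y y _ _ hc hp (Joined.refl y)
          · have m : f (k (Sum.inr (Sum.inl x))) ∈ realIoo e.2.1 e.2.2 := h8.mem x
            simp only [m, if_true]
            exact hG1' x
          · have m : f (k (Sum.inr (Sum.inr p))) ∈ J3 := by
              obtain ⟨U, W, r, _, hpU, _, _, _, hk⟩ := h10.hasChart hT2 p
              have := (hk p p hpU hpU (Joined.refl _)).source_mem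
              have hs : localSet dl e.2.2 l (T.piecesHeight (Ici e.1) p) ⊆ J3 :=
                subset_iUnion₂_of_subset (T.piecesHeight (Ici e.1) p)
                  (show _ ∈ J ∩ Ici e.1 from ⟨hp, hge p⟩) subset_rfl
              exact hs this
            exact (hg3 _ m).trans (hG3' p hp)
      · by_cases hlt : ∀ t ∈ J, t < e.1
        · by_cases hne : (J ∩ S).Nonempty
          · obtain ⟨t, ht⟩ := hne
            have ht' : t ∈ S ∩ Iic e.1 := ⟨ht.2, (hlt t ht.1).le⟩
            obtain ⟨g, hg, hg'⟩ := h5.lift (fun y => G (Sum.inl (y, ⟨t, ht'⟩)))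
              fun y y' hy => g1 y y' _ _ ht.1 ht.1 hy
            refine ⟨g, fun x x' hx => hg x x' (hx.mono (preimage_mono ?_)), ?_⟩
            · refine iUnion₂_subset fun s hs => ?_
              rw [localSet, if_pos (hlt s hs.1)]
            · rintro (⟨y, s⟩ | x | p) hp
              · rw [h6, hg']
                exact g1 y y _ _ ht.1 hp (Joined.refl y)
              · exact absurd hp hc
              · exact absurd (hlt _ hp) (not_lt.2 (hge p))
          · refine ⟨fun _ => Classical.arbitrary α, fun _ _ _ => rfl, ?_⟩
            rintro (⟨y, s⟩ | x | p) hp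
            · exact absurd ⟨_, hp, s.2.1⟩ hne
            · exact absurd hp hc
            · exact absurd (hlt _ hp) (not_lt.2 (hge p))
        · push Not at hlt
          obtain ⟨t₀, ht₀, hlt⟩ := hlt
          have hgt : ∀ t ∈ J, e.1 < t := fun t ht => by
            by_contra hle
            exact hc (hJ.out ht ht₀ ⟨not_lt.1 hle, hlt⟩)
          obtain ⟨g, hg, hg'⟩ := ih'
          refine ⟨g, fun x x' hx => hg x x' (hx.mono (preimage_mono ?_)), ?_⟩
          · refine iUnion₂_subset fun s hs => ?_
            rw [localSet, if_neg (hgt s hs.1).not_gt, if_neg (hgt s hs.1).ne']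
            exact subset_iUnion₂_of_subset s (show s ∈ J ∩ Ici e.1 from ⟨hs.1, (hgt s hs.1).le⟩) subset_rfl
          · rintro (⟨y, s⟩ | x | p) hp
            · exact absurd (hgt _ hp) (not_lt.2 s.2.2)
            · exact absurd hp hc
            · exact hg' p hp

end Telescope

/-- The conditions on the numbers in a decoration. -/
def Decoration : List (ℝ × EReal × EReal) → EReal → EReal → Prop
  | [], h, l => l < h
  | e :: dl, h, l => e.2.1 < h ∧ h ≤ e.2.2 ∧ e.2.1 ≤ firstLo dl l ∧ Decoration dl e.2.2 l

/-! ### The union of the intervals of a decoration. -/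

namespace Decoration

variable {dl : List (ℝ × EReal × EReal)} {h l : EReal}

theorem firstLo_lt (H : Decoration dl h l) : firstLo dl l < h := by
  cases dl with
  | nil => exact H
  | cons e dl => exact H.1

theorem le_lastHi (H : Decoration dl h l) : h ≤ lastHi dl h := by
  induction dl generalizing h with
  | nil => exact le_rfl
  | cons e dl ih => exact H.2.1.trans (ih H.2.2.2)

theorem localSet_subset (H : Decoration dl h l) (t : ℝ) :
    localSet dl h l t ⊆ realIoo (firstLo dl l) (lastHi dl h) := by
  induction dl generalizing h with
  | nil => exact subset_rfl
  | cons e dl ih =>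
    have h1 := H.2.2.2.le_lastHi
    rw [localSet]
    split_ifs
    · exact realIoo_subset le_rfl (H.2.1.trans h1)
    · exact realIoo_subset le_rfl h1
    · exact (ih H.2.2.2).trans (realIoo_subset H.2.2.1 le_rfl)

/-- A number below the upper bound of the first interval is found at the height of the first slice,
and any other number in the rest. In the rest it does not occur at height `e.1`, where only numbers
below `e.2.2` are represented. -/
theorem iUnion_localSet (H : Decoration dl h l) (hdl : (dl.map Prod.fst).Pairwise (· < ·))
    {a b : ℝ} (hab : a ≤ b) (hd : ∀ e ∈ dl, a ≤ e.1 ∧ e.1 ≤ b) :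
    ⋃ t ∈ Icc a b, localSet dl h l t = realIoo (firstLo dl l) (lastHi dl h) := by
  refine subset_antisymm (iUnion₂_subset fun t _ => H.localSet_subset t) ?_
  induction dl generalizing h a with
  | nil => exact fun x hx => mem_iUnion₂.2 ⟨a, ⟨le_rfl, hab⟩, hx⟩
  | cons e dl ih =>
    intro x hx
    rw [List.map_cons, List.pairwise_cons] at hdl
    have he := hd e (List.mem_cons_self ..)
    have hlt : ∀ e' ∈ dl, e.1 < e'.1 := fun e' he' => hdl.1 _ (List.mem_map_of_mem he')
    rcases lt_or_ge (x : EReal) e.2.2 with hxe | hxe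
    · refine mem_iUnion₂.2 ⟨e.1, he, ?_⟩
      rw [localSet, if_neg (lt_irrefl _), if_pos rfl]
      exact ⟨hx.1, hxe⟩
    · have h1 := ih H.2.2.2 hdl.2 he.2
        (fun e' he' => ⟨(hlt e' he').le, (hd e' (List.mem_cons_of_mem _ he')).2⟩)
        ⟨H.2.2.2.firstLo_lt.trans_le hxe, hx.2⟩
      obtain ⟨t, ht, hxt⟩ := mem_iUnion₂.1 h1
      rcases ht.1.eq_or_lt with rfl | hlt'
      · rw [localSet_of_forall_lt hlt] at hxt
        exact absurd hxt.2 (not_lt.2 hxe)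
      · refine mem_iUnion₂.2 ⟨t, ⟨he.1.trans ht.1, ht.2⟩, ?_⟩
        rw [localSet, if_neg hlt'.not_gt, if_neg hlt'.ne']
        exact hxt

end Decoration

theorem localSet_append {d₁ d₂ : List (ℝ × EReal × EReal)} {h l : EReal} {t : ℝ}
    (ht : ∀ e ∈ d₁, e.1 < t) : localSet (d₁ ++ d₂) h l t = localSet d₂ (lastHi d₁ h) l t := by
  induction d₁ generalizing h with
  | nil => rfl
  | cons e dl ih =>
    have := ht e (List.mem_cons_self ..)
    rw [List.cons_append, localSet, if_neg this.not_gt, if_neg this.ne',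
      ih fun e he => ht e (List.mem_cons_of_mem _ he)]
    rfl

namespace Telescope

variable {X : Type u} [TopologicalSpace X] {f : X → ℝ} {Y Z : TopCat.{u}} {T : Telescope Y Z}
  {dl : List (ℝ × EReal × EReal)} {h l : EReal}

theorem Realises.decoration {κ : Y → X} {κ' : Z → X} (H : T.Realises f dl h κ l κ') :
    Decoration dl h l := by
  induction T generalizing dl h with
  | nil Y =>
    match dl, H with
    | [], H => exact H.1
  | cons A c ψ φ T ih =>
    match dl, H with
    | e :: dl, ⟨_, h2, h3, h4, _, _, _, _, _, _, h9⟩ => exact ⟨h2, h3, h4, ih h9⟩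

theorem Realises.map_fst {κ : Y → X} {κ' : Z → X} (H : T.Realises f dl h κ l κ') :
    dl.map Prod.fst = T.crit := by
  obtain ⟨k, hk, -⟩ := H.exists_represents univ
  exact hk.map_fst

theorem Represents.joinedIn_rep {k : T.Pieces univ → X} (H : T.Represents f univ dl h l k)
    (hT : T.crit.Pairwise (· < ·)) (p : T.Pieces univ) :
    JoinedIn (f ⁻¹' localSet dl h l (T.piecesHeight univ p)) (k p) (k (T.rep (T.point p))) :=
  (H.hasChart hT p).exists_nhds.1

/-- The components of a part of a represented telescope are those of the represented part. -/
theorem Represents.joinedIn_iff (hf : Continuous f) {k : T.Pieces univ → X}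
    (H : T.Represents f univ dl h l k) (hT : T.crit.Pairwise (· < ·)) {J : Set ℝ}
    (hJ : J.OrdConnected) {P Q : T.Space} (hP : T.height P ∈ J) (hQ : T.height Q ∈ J) :
    JoinedIn (T.height ⁻¹' J) P Q ↔
      JoinedIn (f ⁻¹' ⋃ t ∈ J, localSet dl h l t) (k (T.rep P)) (k (T.rep Q)) := by
  -- The charts give one direction. For the other, the component of a point of the telescope over
  -- `J` is an invariant function on the pieces, and its extension to `X` is constant along the
  -- given path.
  refine ⟨H.joinedIn_of_joinedIn hT fun t ht => subset_biUnion_of_mem (u := localSet dl h l) ht,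
    fun hj => ?_⟩
  have hG := invariant_of_joinedIn hJ T univ ordConnected_univ
    (fun p => {R | JoinedIn (T.height ⁻¹' J) (T.point p) R}) ?_ ?_
  · obtain ⟨g, hg, hg'⟩ := H.exists_extension hf hT (fun _ _ => trivial) hJ _ hG
    rw [inter_univ] at hg
    have h1 := hg _ _ hj
    rw [hg' _ (by rw [piecesHeight_rep]; exact hP), hg' _ (by rw [piecesHeight_rep]; exact hQ),
      point_rep, point_rep] at h1
    exact (h1.symm ▸ JoinedIn.refl hQ : Q ∈ {R | JoinedIn (T.height ⁻¹' J) P R})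
  · intro p q hpq
    have : JoinedIn (T.height ⁻¹' J) (T.point p) (T.point q) := by
      refine (hpq.map (f := T.point) continuous_quot_mk).mono ?_
      rintro _ ⟨r, hr, rfl⟩
      exact hr
    ext R
    exact ⟨fun hR => this.symm.trans hR, fun hR => this.trans hR⟩
  · intro p q hpq _
    have : T.point p = T.point q := Quot.sound hpq
    simp only [this]

theorem Represents.exists_joinedIn {k : T.Pieces univ → X} (H : T.Represents f univ dl h l k)
    (hT : T.crit.Pairwise (· < ·)) {t : ℝ} {x : X} (hx : f x ∈ localSet dl h l t) :
    ∃ P, T.height P = t ∧ JoinedIn (f ⁻¹' localSet dl h l t) (k (T.rep P)) x := by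
  obtain ⟨p, rfl, hpx⟩ := H.exists_of_mem_localSet (mem_univ t) hx
  exact ⟨T.point p, rfl, (H.joinedIn_rep hT p).symm.trans hpx⟩

theorem isLowPoint_lowPoint (T : Telescope Y Z) (S : Set ℝ) (t : ℝ) (hS : t ∈ S)
    (ht : ∀ c ∈ T.crit, t ≤ c) (y : Y) : T.IsLowPoint S y t (T.lowPoint S t hS ht y) := by
  cases T <;> exact ⟨_, rfl⟩

/-- A slab of a telescope realises the components of the part represented by the telescope. -/
theorem Realises.exists_cell_slab (hf : Continuous f) {κ : Y → X} {κ' : Z → X}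
    (H : T.Realises f dl h κ l κ') (hT : T.crit.Pairwise (· < ·)) {a b : ℝ} (hab : a ≤ b)
    (ha : ∀ c ∈ T.crit, a ≤ c) (hb : ∀ c ∈ T.crit, c ≤ b) :
    ∃ κS : T.Slab a b → X, Cell f (realIoo (firstLo dl l) (lastHi dl h)) κS ∧
      (∀ y, JoinedIn (f ⁻¹' realIoo (firstLo dl l) (lastHi dl h)) (κ y)
        (κS (T.slabLow a b hab ha y))) ∧
      ∀ z, JoinedIn (f ⁻¹' realIoo (firstLo dl l) (lastHi dl h)) (κ' z)
        (κS (T.slabHigh a b hab hb z)) := by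
  obtain ⟨k, hk, hlow, hhigh⟩ := H.exists_represents univ
  have hdl := H.map_fst
  have hU := H.decoration.iUnion_localSet (hdl ▸ hT) hab fun e he =>
    have := hdl ▸ List.mem_map_of_mem (f := Prod.fst) he
    ⟨ha _ this, hb _ this⟩
  refine ⟨fun P => k (T.rep P.1), ⟨fun P Q => ?_, fun x hx => ?_⟩, fun y => ?_, fun z => ?_⟩
  · rw [← hU, ← hk.joinedIn_iff hf hT ordConnected_Icc P.2 Q.2]
    exact joinedIn_iff_joined P.2 Q.2
  · rw [← hU] at hx
    obtain ⟨t, ht, hx⟩ := mem_iUnion₂.1 hx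
    obtain ⟨P, rfl, hP⟩ := hk.exists_joinedIn hT hx
    exact ⟨⟨P, ht⟩, hP.mono (preimage_mono (H.decoration.localSet_subset _))⟩
  · rw [← hlow y a _ (T.isLowPoint_lowPoint univ a trivial ha y)]
    exact (hk.joinedIn_rep hT _).mono (preimage_mono (H.decoration.localSet_subset _))
  · rw [← hhigh b trivial hb z]
    exact (hk.joinedIn_rep hT _).mono (preimage_mono (H.decoration.localSet_subset _))

end Telescope

/-! ### The effect of Merge, Split and Shift on decorations. -/

theorem firstLo_append (d₁ d₂ : List (ℝ × EReal × EReal)) (l : EReal) :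
    firstLo (d₁ ++ d₂) l = firstLo d₁ (firstLo d₂ l) := by
  cases d₁ <;> rfl

theorem lastHi_append (d₁ d₂ : List (ℝ × EReal × EReal)) (h : EReal) :
    lastHi (d₁ ++ d₂) h = lastHi d₂ (lastHi d₁ h) := by
  induction d₁ generalizing h with
  | nil => rfl
  | cons e d₁ ih => exact ih _

theorem Decoration.firstLo_append_le {d₁ d₂ : List (ℝ × EReal × EReal)} {h l : EReal}
    (H : Decoration (d₁ ++ d₂) h l) : firstLo (d₁ ++ d₂) l ≤ firstLo d₂ l := by
  induction d₁ generalizing h with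
  | nil => exact le_rfl
  | cons e d₁ ih => exact H.2.2.1.trans (ih H.2.2.2)

namespace Telescope

variable {X : Type u} [TopologicalSpace X] {f : X → ℝ} {Y W Z : TopCat.{u}}

theorem Realises.cell_low {T : Telescope Y Z} {dl : List (ℝ × EReal × EReal)} {h l : EReal}
    {κ : Y → X} {κ' : Z → X} (H : T.Realises f dl h κ l κ') :
    Cell f (realIoo (firstLo dl l) h) κ := by
  cases T with
  | nil Y =>
    match dl, H with
    | [], H => exact H.2.1
  | cons A c ψ φ T =>
    match dl, H with
    | e :: dl, H => exact H.2.2.2.2.1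

/-- The common cylinder `W` has lower bound `firstLo d₂ l`, supplied by the upper telescope, and
upper bound `lastHi d₁ h`, supplied by the lower one; both use the same map `κW`. -/
theorem Realises.append {T₁ : Telescope Y W} {T₂ : Telescope W Z}
    {d₁ d₂ : List (ℝ × EReal × EReal)} {h l : EReal} {κ : Y → X} {κW : W → X} {κ' : Z → X}
    (H₁ : T₁.Realises f d₁ h κ (firstLo d₂ l) κW) (H₂ : T₂.Realises f d₂ (lastHi d₁ h) κW l κ') :
    (T₁.append T₂).Realises f (d₁ ++ d₂) h κ l κ' := by
  induction T₁ generalizing d₁ h with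
  | nil Y =>
    match d₁, H₁ with
    | [], ⟨_, _, e⟩ => subst e; exact H₂
  | cons A c ψ φ T ih =>
    match d₁, H₁ with
    | e :: d₁, ⟨h1, h2, h3, h4, h5, κS, κ₁, h6, h7, h8, h9⟩ =>
      exact ⟨h1, h2, h3, (firstLo_append d₁ d₂ l).symm ▸ h4, h5, κS, κ₁, h6, h7, h8, ih h9 H₂⟩

theorem Realises.exists_of_append {T₁ : Telescope Y W} {T₂ : Telescope W Z}
    {dl : List (ℝ × EReal × EReal)} {h l : EReal} {κ : Y → X} {κ' : Z → X}
    (H : (T₁.append T₂).Realises f dl h κ l κ') :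
    ∃ d₁ d₂ κW, dl = d₁ ++ d₂ ∧ T₁.Realises f d₁ h κ (firstLo d₂ l) κW ∧
      T₂.Realises f d₂ (lastHi d₁ h) κW l κ' := by
  induction T₁ generalizing dl h with
  | nil Y => exact ⟨[], dl, κ, rfl, ⟨H.decoration.firstLo_lt, H.cell_low, rfl⟩, H⟩
  | cons A c ψ φ T ih =>
    match dl, H with
    | e :: dl, ⟨h1, h2, h3, h4, h5, κS, κ₁, h6, h7, h8, h9⟩ =>
      obtain ⟨d₁, d₂, κW, rfl, i1, i2⟩ := ih h9
      exact ⟨e :: d₁, d₂, κW, rfl, ⟨h1, h2, h3, by rw [← firstLo_append]; exact h4, h5, κS, κ₁, h6,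
        h7, h8, i1⟩, i2⟩

theorem cut_of_pos {P : ℝ → Prop} {Y' A : TopCat.{u}} {c : ℝ} (h : P c) (ψ : C(Y, A))
    (φ : C(Y', A)) (T : Telescope Y' Z) : (cons A c ψ φ T).cut P =
      ⟨(T.cut P).1, cons A c ψ φ (T.cut P).2.1, (T.cut P).2.2⟩ := if_pos h

theorem cut_of_neg {P : ℝ → Prop} {Y' A : TopCat.{u}} {c : ℝ} (h : ¬ P c) (ψ : C(Y, A))
    (φ : C(Y', A)) (T : Telescope Y' Z) : (cons A c ψ φ T).cut P =
      ⟨Y, nil Y, cons A c ψ φ T⟩ := if_neg h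

theorem append_cut (P : ℝ → Prop) (T : Telescope Y Z) :
    (T.cut P).2.1.append (T.cut P).2.2 = T := by
  induction T with
  | nil Y => rfl
  | cons A c ψ φ T ih =>
    by_cases h : P c
    · rw [cut_of_pos h]; exact congrArg (cons A c ψ φ) ih
    · rw [cut_of_neg h]; rfl

open Classical in
theorem crit_cut_fst (P : ℝ → Prop) (T : Telescope Y Z) :
    (T.cut P).2.1.crit = T.crit.takeWhile fun c => decide (P c) := by
  induction T with
  | nil Y => rfl
  | cons A c ψ φ T ih =>
    by_cases h : P c
    · rw [cut_of_pos h, crit, crit, List.takeWhile_cons_of_pos (by simpa using h), ← ih]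
    · rw [cut_of_neg h, crit, crit, List.takeWhile_cons_of_neg (by simpa using h)]

open Classical in
theorem crit_cut_snd (P : ℝ → Prop) (T : Telescope Y Z) :
    (T.cut P).2.2.crit = T.crit.dropWhile fun c => decide (P c) := by
  induction T with
  | nil Y => rfl
  | cons A c ψ φ T ih =>
    by_cases h : P c
    · rw [cut_of_pos h, crit, List.dropWhile_cons_of_pos (by simpa using h), ← ih]
    · rw [cut_of_neg h, crit, List.dropWhile_cons_of_neg (by simpa using h)]

/-- Cutting a telescope with increasing critical values at a height. -/
theorem mem_crit_cut {P : ℝ → Prop} (hP : ∀ a b, a ≤ b → P b → P a) (T : Telescope Y Z)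
    (hT : T.crit.Pairwise (· < ·)) :
    (∀ c ∈ (T.cut P).2.1.crit, P c ∧ c ∈ T.crit) ∧ ∀ c ∈ (T.cut P).2.2.crit, ¬ P c ∧ c ∈ T.crit := by
  classical
  rw [crit_cut_fst, crit_cut_snd]
  refine ⟨fun c hc => ⟨by simpa using List.mem_takeWhile_imp hc,
    List.takeWhile_subset _ hc⟩, fun c hc => ⟨?_, List.dropWhile_subset _ hc⟩⟩
  generalize T.crit = L at *
  induction L with
  | nil => cases hc
  | cons a L ih =>
    rw [List.pairwise_cons] at hT
    by_cases h : P a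
    · rw [List.dropWhile_cons_of_pos (by simpa using h)] at hc
      exact ih hT.2 hc
    · rw [List.dropWhile_cons_of_neg (by simpa using h)] at hc
      rcases List.mem_cons.1 hc with rfl | hc
      · exact h
      · exact fun h' => h (hP _ _ (hT.1 c hc).le h')

theorem crit_append {T₁ : Telescope Y W} {T₂ : Telescope W Z} :
    (T₁.append T₂).crit = T₁.crit ++ T₂.crit := by
  induction T₁ with
  | nil Y => rfl
  | cons A c ψ φ T ih => exact congrArg (c :: ·) ih

/-- The slab of the block `d₂` represents the union of the intervals of the block. Writing the
bounds with `d₂ ++ d₃` and `d₁ ++ d₂` covers an empty block too: the new slice then gets the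
interval of the cylinder that is cut. -/
theorem Realises.merge (hf : Continuous f) {T : Telescope Y Z} {dl : List (ℝ × EReal × EReal)}
    {h l : EReal} {κ : Y → X} {κ' : Z → X} (H : T.Realises f dl h κ l κ')
    (hT : T.crit.Pairwise (· < ·)) {a b : ℝ} (hab : a ≤ b) :
    ∃ d₁ d₂ d₃, dl = d₁ ++ (d₂ ++ d₃) ∧ (∀ e ∈ d₁, e.1 < a) ∧ (∀ e ∈ d₂, a ≤ e.1 ∧ e.1 ≤ b) ∧
      (∀ e ∈ d₃, b < e.1) ∧ (T.merge a b).Realises f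
        (d₁ ++ ((a + b) / 2, firstLo (d₂ ++ d₃) l, lastHi (d₁ ++ d₂) h) :: d₃) h κ l κ' := by
  set low := (T.cut (· < a)).2.1 with hlow
  set rest := (T.cut (· < a)).2.2 with hrest
  set mid := (rest.cut (· ≤ b)).2.1 with hmid
  set high := (rest.cut (· ≤ b)).2.2 with hhigh
  have e1 : low.append rest = T := T.append_cut _
  have e2 : mid.append high = rest := rest.append_cut _
  have hlr : (low.crit ++ rest.crit).Pairwise (· < ·) := by
    rw [← crit_append, e1]; exact hT
  have hr := (List.pairwise_append.1 hlr).2.1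
  have hmh : (mid.crit ++ high.crit).Pairwise (· < ·) := by
    rw [← crit_append, e2]; exact hr
  have m1 := T.mem_crit_cut (P := (· < a)) (fun x y hxy hy => lt_of_le_of_lt hxy hy) hT
  have m2 := rest.mem_crit_cut (P := (· ≤ b)) (fun x y hxy hy => le_trans hxy hy) hr
  have ha : ∀ c ∈ mid.crit, a ≤ c := fun c hc => not_lt.1 (m1.2 c (m2.1 c hc).2).1
  have hb : ∀ c ∈ mid.crit, c ≤ b := fun c hc => (m2.1 c hc).1
  have em : T.merge a b = low.append (cons (mid.Slab a b) ((a + b) / 2)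
      (mid.slabLow a b hab ha) (mid.slabHigh a b hab hb) high) := by
    rw [Telescope.merge]
    exact dif_pos ⟨hab, fun c hc => ⟨ha c hc, hb c hc⟩⟩
  rw [em]
  rw [← e1] at H
  obtain ⟨d₁, dr, κ₁, rfl, H1, Hr⟩ := H.exists_of_append
  rw [← e2] at Hr
  obtain ⟨d₂, d₃, κ₂, rfl, H2, H3⟩ := Hr.exists_of_append
  have k1 := H1.map_fst
  have k2 := H2.map_fst
  have k3 := H3.map_fst
  refine ⟨d₁, d₂, d₃, rfl, fun e he => (m1.1 _ (k1 ▸ List.mem_map_of_mem he)).1,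
    fun e he => ⟨ha _ (k2 ▸ List.mem_map_of_mem he), hb _ (k2 ▸ List.mem_map_of_mem he)⟩,
    fun e he => not_le.1 (m2.2 _ (k3 ▸ List.mem_map_of_mem he)).1, ?_⟩
  obtain ⟨κS, c1, c2, c3⟩ := H2.exists_cell_slab hf ((List.pairwise_append.1 hmh).1) hab ha hb
  have D2 := H2.decoration
  refine Realises.append (d₂ := (_, _, _) :: d₃) H1 ?_
  rw [lastHi_append, firstLo_append]
  exact ⟨rfl, D2.firstLo_lt, D2.le_lastHi, firstLo_append d₂ d₃ l ▸ Hr.decoration.firstLo_append_le,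
    H2.cell_low, κS, κ₂, c1, c2, c3, H3⟩

/-- Both forks inherit the interval of the old slice, and so does the cylinder between them. The
earlier labels must differ from `e.1` because `split` acts on the first match. -/
theorem Realises.split {T : Telescope Y Z} {d₁ d₂ : List (ℝ × EReal × EReal)}
    {e : ℝ × EReal × EReal} {h l : EReal} {κ : Y → X} {κ' : Z → X}
    (H : T.Realises f (d₁ ++ e :: d₂) h κ l κ') (he : ∀ e' ∈ d₁, e'.1 ≠ e.1) (ε : ℝ) :
    (T.split ε e.1).Realises f (d₁ ++ (e.1 - ε, e.2) :: (e.1 + ε, e.2) :: d₂) h κ l κ' := by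
  induction T generalizing d₁ h with
  | nil Y =>
    match d₁, H with
    | [], H => exact H.elim
    | _ :: _, H => exact H.elim
  | cons A c ψ φ T ih =>
    match d₁, H with
    | [], ⟨h1, h2, h3, h4, h5, κS, κ₁, h6, h7, h8, h9⟩ =>
      rw [Telescope.split, if_pos h1.symm, ← h1]
      exact ⟨rfl, h2, h3, le_rfl, h5, κS, κS, h6, h7, fun x => JoinedIn.refl (h6.mem x), rfl,
        h2.trans_le h3, le_rfl, h4, h6, κS, κ₁, h6, fun x => JoinedIn.refl (h6.mem x), h8, h9⟩
    | e₁ :: d₁, ⟨h1, h2, h3, h4, h5, κS, κ₁, h6, h7, h8, h9⟩ =>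
      rw [Telescope.split, if_neg (h1 ▸ he e₁ (List.mem_cons_self ..))]
      refine ⟨h1, h2, h3, ?_, h5, κS, κ₁, h6, h7, h8,
        ih h9 fun e' he' => he e' (List.mem_cons_of_mem _ he')⟩
      cases d₁ <;> exact h4

/-- `Realises` compares labels with critical values but does not ask for any order of them, so
moving a slice leaves all other data unchanged. -/
theorem Realises.shift {T : Telescope Y Z} {d₁ d₂ : List (ℝ × EReal × EReal)}
    {e : ℝ × EReal × EReal} {h l : EReal} {κ : Y → X} {κ' : Z → X}
    (H : T.Realises f (d₁ ++ e :: d₂) h κ l κ') (he : ∀ e' ∈ d₁, e'.1 ≠ e.1) (δ : ℝ) :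
    (T.shift δ e.1).Realises f (d₁ ++ (e.1 + δ, e.2) :: d₂) h κ l κ' := by
  induction T generalizing d₁ h with
  | nil Y =>
    match d₁, H with
    | [], H => exact H.elim
    | _ :: _, H => exact H.elim
  | cons A c ψ φ T ih =>
    match d₁, H with
    | [], ⟨h1, h2, h3, h4, h5, κS, κ₁, h6, h7, h8, h9⟩ =>
      rw [Telescope.shift, if_pos h1.symm, ← h1]
      exact ⟨rfl, h2, h3, h4, h5, κS, κ₁, h6, h7, h8, h9⟩
    | e₁ :: d₁, ⟨h1, h2, h3, h4, h5, κS, κ₁, h6, h7, h8, h9⟩ =>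
      rw [Telescope.shift, if_neg (h1 ▸ he e₁ (List.mem_cons_self ..))]
      refine ⟨h1, h2, h3, ?_, h5, κS, κ₁, h6, h7, h8,
        ih h9 fun e' he' => he e' (List.mem_cons_of_mem _ he')⟩
      cases d₁ <;> exact h4

/-- The decoration of a telescope after the Merges in a list. -/
noncomputable def mergeEntry (dl : List (ℝ × EReal × EReal)) (h l : EReal) (ab : ℝ × ℝ) :
    ℝ × EReal × EReal :=
  ((ab.1 + ab.2) / 2, firstLo (dl.filter fun e => ab.1 ≤ e.1) l,
    lastHi (dl.filter fun e => e.1 ≤ ab.2) h)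

/-- Induction from the lowest interval upwards, with the finished entries in `d₀`. Every other entry
lies in one of the intervals, so in the end one entry is left for each interval. -/
theorem Realises.mergeList (hf : Continuous f) (L : List (ℝ × ℝ)) {T : Telescope Y Z}
    {d₀ dl : List (ℝ × EReal × EReal)} {h l : EReal} {κ : Y → X} {κ' : Z → X}
    (H : T.Realises f (d₀ ++ dl) h κ l κ') (hT : T.crit.Pairwise (· < ·))
    (hL : L.Pairwise fun x y => x.2 < y.1) (hL' : ∀ x ∈ L, x.1 ≤ x.2)
    (h₀ : ∀ e ∈ d₀, ∀ x ∈ L, e.1 < x.1) (hdl : ∀ e ∈ dl, ∃ x ∈ L, e.1 ∈ Icc x.1 x.2) :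
    (T.mergeList L).Realises f (d₀ ++ L.map (mergeEntry dl (lastHi d₀ h) l)) h κ l κ' := by
  induction L generalizing T d₀ dl with
  | nil =>
    match dl, hdl with
    | [], _ => exact H
    | e :: dl, hdl => obtain ⟨x, hx, _⟩ := hdl e (List.mem_cons_self ..); cases hx
  | cons ab L ih =>
    obtain ⟨a, b⟩ := ab
    have hab : a ≤ b := hL' _ (List.mem_cons_self ..)
    obtain ⟨hL1, hL2⟩ := List.pairwise_cons.1 hL
    obtain ⟨d₁, d₂, d₃, e1, l1, l2, l3, Hm⟩ := H.merge hf hT hab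
    have hge : ∀ e ∈ dl, a ≤ e.1 := fun e he => by
      obtain ⟨x, hx, hex⟩ := hdl e he
      rcases List.mem_cons.1 hx with rfl | hx
      · exact hex.1
      · exact hab.trans ((hL1 x hx).le.trans hex.1)
    -- Both decompositions separate the labels below `a` from the others, so filtering at `a`
    -- identifies them.
    have e2 : d₀ = d₁ ∧ dl = d₂ ++ d₃ := by
      have f1 := congrArg (List.filter fun e => e.1 < a) e1
      have f2 := congrArg (List.filter fun e => a ≤ e.1) e1
      simp only [List.filter_append] at f1 f2
      rw [List.filter_eq_self.2 fun e he => by simpa using h₀ e he _ (List.mem_cons_self ..),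
        List.filter_eq_nil_iff.2 fun e he => by simpa using hge e he,
        List.filter_eq_self.2 fun e he => by simpa using l1 e he,
        List.filter_eq_nil_iff.2 fun e he => by simpa using (l2 e he).1,
        List.filter_eq_nil_iff.2 fun e he => by simpa using hab.trans (l3 e he).le] at f1
      rw [List.filter_eq_nil_iff.2 fun e he => by simpa using h₀ e he _ (List.mem_cons_self ..),
        List.filter_eq_self.2 fun e he => by simpa using hge e he,
        List.filter_eq_nil_iff.2 fun e he => by simpa using l1 e he,
        List.filter_eq_self.2 fun e he => by simpa using (l2 e he).1,
        List.filter_eq_self.2 fun e he => by simpa using hab.trans (l3 e he).le] at f2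
      simpa using And.intro f1 f2
    obtain ⟨rfl, rfl⟩ := e2
    have hm := Hm.map_fst
    have hd3 : d₂.filter (fun e => e.1 ≤ b) = d₂ := List.filter_eq_self.2 fun e he => by
      simpa using (l2 e he).2
    have hd3' : d₃.filter (fun e => e.1 ≤ b) = [] := List.filter_eq_nil_iff.2 fun e he => by
      simpa using l3 e he
    have hen : mergeEntry (d₂ ++ d₃) (lastHi d₀ h) l (a, b) =
        ((a + b) / 2, firstLo (d₂ ++ d₃) l, lastHi (d₀ ++ d₂) h) := by
      rw [mergeEntry, List.filter_eq_self.2 fun e he => by simpa using hge e he,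
        List.filter_append, hd3, hd3', List.append_nil, lastHi_append]
    -- For the later intervals the block `d₂` matters only through the last upper bound, which
    -- `lastHi` carries along.
    have hmap : ∀ x ∈ L, mergeEntry (d₂ ++ d₃) (lastHi d₀ h) l x =
        mergeEntry d₃ (lastHi (d₀ ++ d₂) h) l x := fun x hx => by
      have hbx : b < x.1 := hL1 x hx
      have hx' := hL' x (List.mem_cons_of_mem _ hx)
      rw [mergeEntry, mergeEntry, List.filter_append, List.filter_append,
        List.filter_eq_nil_iff.2 fun e he => by simpa using (l2 e he).2.trans_lt hbx, List.nil_append,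
        List.filter_eq_self (l := d₂) |>.2 fun e he => by
          simpa using (l2 e he).2.trans (hbx.le.trans hx'), lastHi_append, lastHi_append]
    rw [List.map_cons, hen, List.map_congr_left hmap]
    have := ih (T := T.merge a b) (d₀ := d₀ ++ [((a + b) / 2, firstLo (d₂ ++ d₃) l,
      lastHi (d₀ ++ d₂) h)]) (dl := d₃) (by simpa using Hm) ?_ hL2
      (fun x hx => hL' x (List.mem_cons_of_mem _ hx)) ?_ ?_
    · change Realises f ((T.merge a b).mergeList L) _ _ _ _ _
      simpa only [lastHi_append, lastHi, List.append_assoc, List.singleton_append] using this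
    · have hs := H.map_fst
      rw [← hs] at hT
      rw [← hm]
      simp only [List.map_append, List.map_cons, List.pairwise_append, List.pairwise_cons,
        List.mem_map, List.mem_append, List.mem_cons] at hT ⊢
      refine ⟨hT.1, ⟨?_, hT.2.1.2.1⟩, ?_⟩
      · rintro _ ⟨e, he, rfl⟩
        have := l3 e he
        linarith
      · rintro _ ⟨e, he, rfl⟩ _ (rfl | ⟨e', he', rfl⟩)
        · have := l1 e he
          linarith
        · exact (l1 e he).trans (hab.trans_lt (l3 e' he'))
    · intro e he x hx
      have hbx : b < x.1 := hL1 x hx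
      rcases List.mem_append.1 he with he | he
      · exact h₀ e he x (List.mem_cons_of_mem _ hx)
      · rw [List.mem_singleton.1 he]
        change (a + b) / 2 < x.1
        linarith
    · intro e he
      obtain ⟨x, hx, hex⟩ := hdl e (List.mem_append_right _ he)
      rcases List.mem_cons.1 hx with rfl | hx
      · exact absurd hex.2 (not_le.2 (l3 e he))
      · exact ⟨x, hx, hex⟩

/-- The separation hypothesis keeps the forks already made below the critical values still to be
split, so each Split finds the intended entry. -/
theorem Realises.splitAll {T : Telescope Y Z} {dl : List (ℝ × EReal × EReal)} {h l : EReal}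
    {κ : Y → X} {κ' : Z → X} (H : T.Realises f dl h κ l κ') {ε : ℝ → ℝ}
    (hε : ∀ e ∈ dl, 0 < ε e.1)
    (hdl : dl.Pairwise fun e e' => e.1 + ε e.1 < e'.1 - ε e'.1) :
    (T.splitAll ε).Realises f (dl.flatMap fun e => [(e.1 - ε e.1, e.2), (e.1 + ε e.1, e.2)])
      h κ l κ' := by
  rw [Telescope.splitAll, ← H.map_fst]
  suffices ∀ (T : Telescope Y Z) (d₀ : List (ℝ × EReal × EReal)),
      T.Realises f (d₀ ++ dl) h κ l κ' → (∀ e' ∈ d₀, ∀ e ∈ dl, e'.1 < e.1 - ε e.1) →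
      ((dl.map Prod.fst).foldl (fun S c => S.split (ε c) c) T).Realises f
        (d₀ ++ dl.flatMap fun e => [(e.1 - ε e.1, e.2), (e.1 + ε e.1, e.2)]) h κ l κ' from
    this T [] H (by simp)
  clear H T
  induction dl with
  | nil => exact fun T d₀ H _ => H
  | cons e dl ih =>
    intro T d₀ H h₀
    obtain ⟨hd1, hd2⟩ := List.pairwise_cons.1 hdl
    have he := hε e (List.mem_cons_self ..)
    have := ih (fun e he => hε e (List.mem_cons_of_mem _ he)) hd2 (T.split (ε e.1) e.1)
      (d₀ ++ [(e.1 - ε e.1, e.2), (e.1 + ε e.1, e.2)])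
      (by simpa using H.split (fun e' he' => by
        have := h₀ e' he' e (List.mem_cons_self ..)
        exact (this.trans (by linarith)).ne) (ε e.1)) ?_
    · simpa using this
    · intro e' he' e'' he''
      have h1 := hd1 e'' he''
      simp only [List.mem_append, List.mem_cons, List.not_mem_nil, or_false] at he'
      rcases he' with he' | rfl | rfl
      · exact h₀ e' he' e'' (List.mem_cons_of_mem _ he'')
      · exact (show e.1 - ε e.1 < e''.1 - ε e''.1 by linarith)
      · exact h1

-- The forks of an entry, in their final position, are compared with the unshifted down-fork of each
-- later entry, since this is where that fork still is when they move. So every Shift finds the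
-- intended fork.
open Classical in
theorem Realises.shiftForks {T : Telescope Y Z} {dl : List (ℝ × EReal × EReal)} {h l : EReal}
    {κ : Y → X} {κ' : Z → X} {ε : ℝ → ℝ}
    (H : T.Realises f (dl.flatMap fun e => [(e.1 - ε e.1, e.2), (e.1 + ε e.1, e.2)]) h κ l κ')
    (hε : ∀ e ∈ dl, 0 < ε e.1) (up down : ℝ → ℝ) (p : ℝ → Prop)
    (hdl : dl.Pairwise fun e e' => (if p e.1 then e.1 - ε e.1 + down e.1 else e.1 - ε e.1) <
      e'.1 - ε e'.1 ∧ (if p e.1 then e.1 + ε e.1 + up e.1 else e.1 + ε e.1) < e'.1 - ε e'.1) :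
    (T.shiftForks ε up down ((dl.map Prod.fst).filter fun c => p c)).Realises f
      (dl.flatMap fun e => [(if p e.1 then e.1 - ε e.1 + down e.1 else e.1 - ε e.1, e.2),
        (if p e.1 then e.1 + ε e.1 + up e.1 else e.1 + ε e.1, e.2)]) h κ l κ' := by
  rw [Telescope.shiftForks, List.foldl_filter]
  suffices ∀ (T : Telescope Y Z) (d₀ : List (ℝ × EReal × EReal)),
      T.Realises f (d₀ ++ dl.flatMap fun e => [(e.1 - ε e.1, e.2), (e.1 + ε e.1, e.2)]) h κ l κ' →
      (∀ e' ∈ d₀, ∀ e ∈ dl, e'.1 < e.1 - ε e.1) →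
      ((dl.map Prod.fst).foldl (fun S c => if decide (p c) = true then
        (S.shift (up c) (c + ε c)).shift (down c) (c - ε c) else S) T).Realises f
        (d₀ ++ dl.flatMap fun e => [(if p e.1 then e.1 - ε e.1 + down e.1 else e.1 - ε e.1, e.2),
        (if p e.1 then e.1 + ε e.1 + up e.1 else e.1 + ε e.1, e.2)]) h κ l κ' from
    this T [] H (by simp)
  clear H T
  induction dl with
  | nil => exact fun T d₀ H _ => H
  | cons e dl ih =>
    intro T d₀ H h₀
    obtain ⟨hd1, hd2⟩ := List.pairwise_cons.1 hdl
    have he := hε e (List.mem_cons_self ..)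
    have h₀' := fun e' he' => h₀ e' he' e (List.mem_cons_self ..)
    rw [List.map_cons, List.foldl_cons]
    have ih' := ih (fun e he => hε e (List.mem_cons_of_mem _ he)) hd2
    have hstep : ∀ e' ∈ d₀ ++ [(if p e.1 then e.1 - ε e.1 + down e.1 else e.1 - ε e.1, e.2),
        (if p e.1 then e.1 + ε e.1 + up e.1 else e.1 + ε e.1, e.2)], ∀ e'' ∈ dl,
        e'.1 < e''.1 - ε e''.1 := by
      intro e' he' e'' he''
      have h1 := hd1 e'' he''
      simp only [List.mem_append, List.mem_cons, List.not_mem_nil, or_false] at he'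
      rcases he' with he' | rfl | rfl
      · exact h₀ e' he' e'' (List.mem_cons_of_mem _ he'')
      · exact h1.1
      · exact h1.2
    by_cases hp : p e.1
    · simp only [hp, if_true, decide_true] at hstep ⊢
      have H1 := Realises.shift (T := T) (d₁ := d₀ ++ [(e.1 - ε e.1, e.2)])
        (e := (e.1 + ε e.1, e.2)) (by simpa using H) (fun e' he' => by
          simp only [List.mem_append, List.mem_cons, List.not_mem_nil, or_false] at he'
          rcases he' with he' | rfl
          · have := h₀' e' he'
            exact (this.trans (by change _ < e.1 + ε e.1; linarith)).ne
          · exact (show e.1 - ε e.1 < e.1 + ε e.1 by linarith).ne) (up e.1)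
      have H2 := Realises.shift (d₁ := d₀) (e := (e.1 - ε e.1, e.2)) (by simpa using H1)
        (fun e' he' => (h₀' e' he').ne) (down e.1)
      have := ih' _ (d₀ ++ [_, _]) (by simpa using H2) hstep
      simpa [hp] using this
    · simp only [hp, if_false, decide_false, Bool.false_eq_true] at hstep ⊢
      have := ih' T (d₀ ++ [_, _]) (by simpa using H) hstep
      simpa [hp] using this

end Telescope

/-! ### The decoration of the telescope of a Morse-type function. -/

theorem sSup_image_coe_lt {S : Set ℝ} (hS : S.Finite) {t : ℝ} :
    sSup ((↑) '' S : Set EReal) < t ↔ ∀ s ∈ S, s < t := by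
  rcases S.eq_empty_or_nonempty with rfl | hne
  · simp
  · rw [(hS.image _).csSup_lt_iff (hne.image _)]
    simp

theorem lt_sInf_image_coe {S : Set ℝ} (hS : S.Finite) {t : ℝ} :
    t < sInf ((↑) '' S : Set EReal) ↔ ∀ s ∈ S, t < s := by
  rcases S.eq_empty_or_nonempty with rfl | hne
  · simp
  · rw [(hS.image _).lt_csInf_iff (hne.image _)]
    simp

/-- The supremum of the elements of `K` below `t`. -/
noncomputable def supBelow (K : Set ℝ) (t : ℝ) : EReal := sSup ((↑) '' (K ∩ Iio t))

/-- The infimum of the elements of `K` above `t`. -/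
noncomputable def infAbove (K : Set ℝ) (t : ℝ) : EReal := sInf ((↑) '' (K ∩ Ioi t))

/-- The bounds live in `EReal`, so a missing element of `K` on one side gives an infinite bound.
Finiteness of `K` makes a strict inequality for the supremum or infimum one for the elements. -/
theorem mem_realIoo_supBelow {K : Set ℝ} (hK : K.Finite) {a b t : ℝ} :
    t ∈ realIoo (supBelow K a) (infAbove K b) ↔
      (∀ c ∈ K, c < a → c < t) ∧ ∀ c ∈ K, b < c → t < c := by
  rw [mem_realIoo, supBelow, infAbove, sSup_image_coe_lt (hK.inter_of_left _),
    lt_sInf_image_coe (hK.inter_of_left _)]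
  simp

theorem supBelow_mono (K : Set ℝ) {a b : ℝ} (h : a ≤ b) : supBelow K a ≤ supBelow K b :=
  sSup_le_sSup (image_mono (inter_subset_inter_right _ (Iio_subset_Iio h)))

theorem infAbove_mono (K : Set ℝ) {a b : ℝ} (h : a ≤ b) : infAbove K a ≤ infAbove K b :=
  sInf_le_sInf (image_mono (inter_subset_inter_right _ (Ioi_subset_Ioi h)))

namespace Telescope

variable {X : Type u} [TopologicalSpace X] {f : X → ℝ}

/-- A slice takes its lower bound from the cylinder below it and its upper bound from the cylinder
above it; monotonicity of the bounds gives the inequalities of a decoration. -/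
theorem realises_ofFin (n : ℕ) (Y : Fin (n + 1) → TopCat.{u}) (A : Fin n → TopCat.{u})
    (a : Fin n → ℝ) (ψ : ∀ i, C(Y i.castSucc, A i)) (φ : ∀ i, C(Y i.succ, A i))
    (L H : Fin (n + 1) → EReal) (κ : ∀ i, Y i → X) (κS : ∀ i, A i → X) (hLH : ∀ i, L i < H i)
    (hL : Monotone L) (hH : Monotone H) (h₁ : ∀ i, Cell f (realIoo (L i) (H i)) (κ i))
    (h₂ : ∀ i : Fin n, Cell f (realIoo (L i.castSucc) (H i.succ)) (κS i))
    (h₃ : ∀ (i : Fin n) y,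
      JoinedIn (f ⁻¹' realIoo (L i.castSucc) (H i.succ)) (κ i.castSucc y) (κS i (ψ i y)))
    (h₄ : ∀ (i : Fin n) y,
      JoinedIn (f ⁻¹' realIoo (L i.castSucc) (H i.succ)) (κ i.succ y) (κS i (φ i y))) :
    (ofFin n Y A a ψ φ).Realises f (List.ofFn fun i => (a i, L i.castSucc, H i.succ)) (H 0) (κ 0)
      (L (Fin.last n)) (κ (Fin.last n)) := by
  induction n with
  | zero => exact ⟨hLH 0, h₁ 0, rfl⟩
  | succ n ih =>
    rw [List.ofFn_succ]
    have ih' := ih (fun i => Y i.succ) (fun i => A i.succ) (fun i => a i.succ)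
      (fun i => ψ i.succ) (fun i => φ i.succ) (fun i => L i.succ) (fun i => H i.succ)
      (fun i => κ i.succ) (fun i => κS i.succ) (fun i => hLH _)
      (fun i j hij => hL (Fin.succ_le_succ_iff.2 hij))
      (fun i j hij => hH (Fin.succ_le_succ_iff.2 hij)) (fun i => h₁ _) (fun i => h₂ i.succ)
      (fun i => h₃ i.succ) (fun i => h₄ i.succ)
    refine ⟨rfl, hLH 0, hH (Fin.zero_le _), ?_, h₁ 0, κS 0, κ 1, h₂ 0, h₃ 0, h₄ 0, ih'⟩
    cases n with
    | zero => exact hL (Fin.zero_le _)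
    | succ n => rw [List.ofFn_succ]; exact hL (Fin.zero_le _)

end Telescope

namespace MorseType

variable {X : Type u} [TopologicalSpace X] {f : X → ℝ}

/-- The ends of the gaps. -/
noncomputable def gapLow (M : MorseType f) (i : Fin (M.n + 1)) : EReal :=
  sSup ((↑) '' (M.crit '' {j | j.castSucc < i}))

/-- The upper ends of the gaps. -/
noncomputable def gapHigh (M : MorseType f) (i : Fin (M.n + 1)) : EReal :=
  sInf ((↑) '' (M.crit '' {j | i ≤ j.castSucc}))

theorem mem_realIoo_gap (M : MorseType f) (i j : Fin (M.n + 1)) (t : ℝ) :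
    t ∈ realIoo (M.gapLow i) (M.gapHigh j) ↔
      (∀ k : Fin M.n, k.castSucc < i → M.crit k < t) ∧ ∀ k : Fin M.n, j ≤ k.castSucc → t < M.crit k := by
  rw [mem_realIoo, gapLow, gapHigh, sSup_image_coe_lt ((toFinite _).image _),
    lt_sInf_image_coe ((toFinite _).image _)]
  simp

theorem realIoo_gap (M : MorseType f) (i : Fin (M.n + 1)) :
    realIoo (M.gapLow i) (M.gapHigh i) = openGap M.crit i := by
  ext t; rw [mem_realIoo_gap]; rfl

theorem gapLow_castSucc (M : MorseType f) (i : Fin M.n) :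
    M.gapLow i.castSucc = supBelow (range M.crit) (M.crit i) := by
  rw [gapLow, supBelow]
  congr 2
  ext t
  constructor
  · rintro ⟨j, hj, rfl⟩
    exact ⟨⟨j, rfl⟩, M.strictMono (Fin.castSucc_lt_castSucc_iff.1 hj)⟩
  · rintro ⟨⟨j, rfl⟩, hj⟩
    exact ⟨j, Fin.castSucc_lt_castSucc_iff.2 (M.strictMono.lt_iff_lt.1 hj), rfl⟩

theorem gapHigh_succ (M : MorseType f) (i : Fin M.n) :
    M.gapHigh i.succ = infAbove (range M.crit) (M.crit i) := by
  rw [gapHigh, infAbove]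
  congr 2
  ext t
  constructor
  · rintro ⟨j, hj, rfl⟩
    exact ⟨⟨j, rfl⟩, M.strictMono (Fin.succ_le_castSucc_iff.1 hj)⟩
  · rintro ⟨⟨j, rfl⟩, hj⟩
    exact ⟨j, Fin.succ_le_castSucc_iff.2 (M.strictMono.lt_iff_lt.1 hj), rfl⟩

/-- The decoration of the telescope of a Morse-type function. -/
noncomputable def decoration (M : MorseType f) : List (ℝ × EReal × EReal) :=
  List.ofFn fun i => (M.crit i, supBelow (range M.crit) (M.crit i),
    infAbove (range M.crit) (M.crit i))

/-- Each cylinder is mapped to `X` at some height `t i` of its gap, and each slice by inclusion. The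
attaching maps are restrictions of `μbar`, so vertical lines provide the required paths. -/
theorem realises_telescope [T2Space X] (M : MorseType f) :
    ∃ κ κ', M.telescope.Realises f M.decoration (sInf ((↑) '' range M.crit)) κ
      (sSup ((↑) '' range M.crit)) κ' := by
  choose t ht using openGap_nonempty M.strictMono
  have e0 : M.gapHigh 0 = sInf ((↑) '' range M.crit) := by
    rw [gapHigh, ← image_univ]; congr; ext; simp
  have e1 : M.gapLow (Fin.last M.n) = sSup ((↑) '' range M.crit) := by
    rw [gapLow, ← image_univ]; congr; ext j; simp [Fin.castSucc_lt_last]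
  have hstar : ∀ i : Fin M.n, M.crit i ∈ realIoo (M.gapLow i.castSucc) (M.gapHigh i.succ) := by
    intro i
    rw [mem_realIoo_gap]
    exact ⟨fun k hk => M.strictMono (Fin.castSucc_lt_castSucc_iff.1 hk),
      fun k hk => M.strictMono (Fin.succ_le_castSucc_iff.1 hk)⟩
  have hL : Monotone M.gapLow := fun i j hij =>
    sSup_le_sSup (image_mono (image_mono fun k hk => lt_of_lt_of_le hk hij))
  have hH : Monotone M.gapHigh := fun i j hij =>
    sInf_le_sInf (image_mono (image_mono fun k hk => le_trans hij hk))
  have hsub : ∀ i, t i ∈ realIoo (M.gapLow i) (M.gapHigh i) := fun i => M.realIoo_gap i ▸ ht i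
  let κ : ∀ i, M.Y i → X := fun i y => (M.μbar i (y, ⟨t i, openGap_subset _ _ (ht i)⟩) : X)
  refine ⟨κ 0, κ (Fin.last M.n), ?_⟩
  rw [← e0, ← e1, decoration]
  simp only [← gapLow_castSucc, ← gapHigh_succ]
  refine Telescope.realises_ofFin M.n M.Y M.slice M.crit M.ψ M.φ M.gapLow M.gapHigh
    κ (fun i x => x.1)
    (fun i => (hsub i).1.trans (hsub i).2) hL hH ?_ ?_ ?_ ?_
  · intro i
    rw [realIoo_gap]
    exact M.cell_cylinder i (ordConnected_openGap _ _) subset_rfl (ht i)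
  · intro i
    refine M.cell_slice i (ordConnected_realIoo _ _) (isOpen_realIoo _ _) (hstar i) fun s hs => ?_
    rw [mem_realIoo_gap] at hs
    rcases lt_trichotomy s (M.crit i) with h | h | h
    · exact Or.inl ⟨hs.1, fun j hj => h.trans_le
        (M.strictMono.monotone (Fin.castSucc_le_castSucc_iff.1 hj))⟩
    · exact Or.inr (Or.inl h)
    · exact Or.inr (Or.inr ⟨fun j hj => (M.strictMono.monotone
        (Fin.castSucc_lt_succ_iff.1 hj)).trans_lt h, hs.2⟩)
  · intro i y
    exact M.joinedIn_μbar i.castSucc (ordConnected_realIoo _ _) (Joined.refl y) _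
      ⟨M.crit i, M.crit_mem_closedGap_castSucc i⟩
      (realIoo_subset le_rfl (hH (Fin.castSucc_lt_succ).le) (hsub _)) (hstar i)
  · intro i y
    exact M.joinedIn_μbar i.succ (ordConnected_realIoo _ _) (Joined.refl y) _
      ⟨M.crit i, M.crit_mem_closedGap_succ i⟩
      (realIoo_subset (hL (Fin.castSucc_lt_succ).le) le_rfl (hsub _)) (hstar i)

theorem crit_telescope (M : MorseType f) : M.telescope.crit = List.ofFn M.crit := by
  have : ∀ (n : ℕ) (Y : Fin (n + 1) → TopCat.{u}) (A : Fin n → TopCat.{u}) (a : Fin n → ℝ)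
      (ψ : ∀ i, C(Y i.castSucc, A i)) (φ : ∀ i, C(Y i.succ, A i)),
      (Telescope.ofFin n Y A a ψ φ).crit = List.ofFn a := by
    intro n
    induction n with
    | zero => intros; rfl
    | succ n ih => intro Y A a ψ φ; rw [List.ofFn_succ, ← ih]; rfl
  exact this _ _ _ _ _ _

theorem pairwise_crit_telescope (M : MorseType f) : M.telescope.crit.Pairwise (· < ·) := by
  rw [crit_telescope, List.pairwise_ofFn]
  exact fun i j hij => M.strictMono hij

/-- The decoration of a Merge of the telescope of a Morse-type function. -/
theorem mergeEntry_decoration (M : MorseType f) (ab : ℝ × ℝ) :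
    Telescope.mergeEntry M.decoration (sInf ((↑) '' range M.crit)) (sSup ((↑) '' range M.crit)) ab =
      ((ab.1 + ab.2) / 2, supBelow (range M.crit) ab.1, infAbove (range M.crit) ab.2) := by
  have hmem : ∀ e ∈ M.decoration, ∃ i, e = (M.crit i, supBelow (range M.crit) (M.crit i),
      infAbove (range M.crit) (M.crit i)) := fun e he => by
    obtain ⟨i, hi⟩ := (List.mem_ofFn' _ _).1 he
    exact ⟨i, hi.symm⟩
  have hmem' : ∀ i, (M.crit i, supBelow (range M.crit) (M.crit i),
      infAbove (range M.crit) (M.crit i)) ∈ M.decoration := fun i =>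
    (List.mem_ofFn' _ _).2 ⟨i, rfl⟩
  have hs : M.decoration.Pairwise fun e e' => e.1 < e'.1 := by
    rw [decoration, List.pairwise_ofFn]
    exact fun i j hij => M.strictMono hij
  rw [Telescope.mergeEntry]
  congr 2
  -- If the filter is empty, all critical values are below `ab.1` and the default bound is their
  -- supremum. Otherwise no critical value lies in the part from `ab.1` up to, but excluding, the
  -- first entry, so the two suprema run over the same set.
  · rcases h : M.decoration.filter fun e => ab.1 ≤ e.1 with _ | ⟨e, d⟩
    · rw [h, firstLo, supBelow, inter_eq_left.2]
      rintro _ ⟨i, rfl⟩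
      have := List.filter_eq_nil_iff.1 h _ (hmem' i)
      simpa using this
    · have he : e ∈ M.decoration.filter fun e => ab.1 ≤ e.1 := h ▸ List.mem_cons_self ..
      obtain ⟨he, hae⟩ := List.mem_filter.1 he
      obtain ⟨i, rfl⟩ := hmem e he
      have hp := hs.filter fun e => ab.1 ≤ e.1
      rw [h] at hp
      rw [h]
      change supBelow _ (M.crit i) = _
      refine le_antisymm (sSup_le_sSup (image_mono ?_)) (supBelow_mono _ (by simpa using hae))
      rintro _ ⟨⟨j, rfl⟩, hj⟩
      refine ⟨⟨j, rfl⟩, mem_Iio.2 (not_le.1 fun hle => ?_)⟩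
      have := List.mem_filter (p := fun e => ab.1 ≤ e.1).2 ⟨hmem' j, by simpa using hle⟩
      rw [h] at this
      rcases List.mem_cons.1 this with h' | h'
      · exact (mem_Iio.1 hj).ne (congrArg Prod.fst h')
      · exact lt_asymm hj ((List.pairwise_cons.1 hp).1 _ h')
  · rcases List.eq_nil_or_concat (M.decoration.filter fun e => e.1 ≤ ab.2) with h | ⟨d, e, h⟩
    · rw [h, lastHi, infAbove, inter_eq_left.2]
      rintro _ ⟨i, rfl⟩
      have := List.filter_eq_nil_iff.1 h _ (hmem' i)
      simpa using this
    · have he : e ∈ M.decoration.filter fun e => e.1 ≤ ab.2 := by rw [h]; simp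
      obtain ⟨he, hae⟩ := List.mem_filter.1 he
      obtain ⟨i, rfl⟩ := hmem e he
      have hp := hs.filter fun e => e.1 ≤ ab.2
      rw [h, List.concat_eq_append, List.pairwise_append] at hp
      rw [h, List.concat_eq_append, lastHi_append]
      change infAbove _ (M.crit i) = _
      refine le_antisymm (infAbove_mono _ (by simpa using hae)) (sInf_le_sInf (image_mono ?_))
      rintro _ ⟨⟨j, rfl⟩, hj⟩
      refine ⟨⟨j, rfl⟩, mem_Ioi.2 (not_le.1 fun hle => ?_)⟩
      have := List.mem_filter (p := fun e => e.1 ≤ ab.2).2 ⟨hmem' j, by simpa using hle⟩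
      rw [h, List.concat_eq_append] at this
      rcases List.mem_append.1 this with h' | h'
      · exact lt_asymm hj (hp.2.2 _ h' _ (List.mem_singleton_self _))
      · exact (mem_Ioi.1 hj).ne' (congrArg Prod.fst (List.mem_singleton.1 h'))

end MorseType

/-- The image consists of the finitely many critical values and of the closed gaps with non-empty
cylinder, as `μbar` reaches the ends of each gap. With boundedness it is compact, so the ends of the
proper parts are attained. -/
theorem MorseType.isClosed_range {X : Type u} [TopologicalSpace X] {f : X → ℝ} (M : MorseType f) :
    IsClosed (range f) := by
  have : range f = range M.crit ∪ ⋃ i ∈ {i | Nonempty (M.Y i)}, closedGap M.crit i := by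
    refine subset_antisymm ?_ (union_subset ?_ ?_)
    · rintro _ ⟨x, rfl⟩
      by_cases h : ∀ i, M.crit i ≠ f x
      · obtain ⟨i, hi⟩ := exists_mem_openGap M.strictMono h
        obtain ⟨y, -⟩ := M.exists_μbar_eq i x hi
        exact Or.inr (mem_iUnion₂.2 ⟨i, ⟨y⟩, openGap_subset _ _ hi⟩)
      · push Not at h
        exact Or.inl h
    · rintro _ ⟨i, rfl⟩
      exact M.crit_mem i
    · rintro t ht
      obtain ⟨i, ⟨y⟩, hi⟩ := mem_iUnion₂.1 ht
      exact ⟨_, M.f_μbar i y t hi⟩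
  rw [this]
  exact (finite_range _).isClosed.union
    ((toFinite _).isClosed_biUnion fun i _ => isClosed_closedGap _ _)

/-! ### The order of the elements of a gomic -/

/-- The elements of a gomic are ordered by their proper parts. -/
structure OrderedCover (Z : Set ℝ) (𝓤 : Set (Set ℝ)) : Prop where
  finite : 𝓤.Finite
  cover : ∀ z ∈ Z, ∃ U ∈ 𝓤, z ∈ U
  subset : ∀ U ∈ 𝓤, U ⊆ Z
  interval : ∀ U ∈ 𝓤, ∀ x ∈ U, ∀ y ∈ U, ∀ z ∈ Z, x ≤ z → z ≤ y → z ∈ U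
  low_lt_high : ∀ U ∈ 𝓤, lowEnd 𝓤 U < highEnd 𝓤 U
  low_mem : ∀ U ∈ 𝓤, lowEnd 𝓤 U ∈ U
  high_mem : ∀ U ∈ 𝓤, highEnd 𝓤 U ∈ U
  low_notMem : ∀ U ∈ 𝓤, ∀ V ∈ 𝓤, U ≠ V → lowEnd 𝓤 U ∉ V
  high_notMem : ∀ U ∈ 𝓤, ∀ V ∈ 𝓤, U ≠ V → highEnd 𝓤 U ∉ V
  proper : ∀ U ∈ 𝓤, ∀ z ∈ U, (∀ V ∈ 𝓤, U ≠ V → z ∉ V) → z ∈ Icc (lowEnd 𝓤 U) (highEnd 𝓤 U)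
  ordered : ∀ U ∈ 𝓤, ∀ V ∈ 𝓤, U ≠ V → highEnd 𝓤 U < lowEnd 𝓤 V ∨ highEnd 𝓤 V < lowEnd 𝓤 U

/-- Minimality makes the proper parts non-empty. They arise from the compact set `Z` by removing
open sets, so they contain their ends, and genericity keeps the two ends apart. The list of disjoint
intervals supplies finiteness and the linear order. -/
theorem IsGomic.orderedCover {Z : Set ℝ} {𝓤 : Set (Set ℝ)} (h : IsGomic Z 𝓤) (hZ : IsCompact Z)
    {L : List (ℝ × ℝ)} (hL : ListsIncreasingly L {x | ∃ U ∈ 𝓤, x = (lowEnd 𝓤 U, highEnd 𝓤 U)}) :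
    OrderedCover Z 𝓤 := by
  have hsub : ∀ U ∈ 𝓤, U ⊆ Z := fun U hU => h.cover ▸ subset_sUnion_of_mem hU
  have hcov : ∀ z ∈ Z, ∃ U ∈ 𝓤, z ∈ U := fun z hz => by rwa [← h.cover] at hz
  have hne : ∀ U ∈ 𝓤, (properPart 𝓤 U).Nonempty := fun U hU => by
    by_contra hempty
    rw [not_nonempty_iff_eq_empty, properPart, sdiff_eq_empty] at hempty
    have := h.minimal (𝓤 \ {U}) sdiff_subset (by
      refine subset_antisymm ((sUnion_subset_sUnion sdiff_subset).trans h.cover.subset)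
        fun z hz => ?_
      obtain ⟨V, hV, hzV⟩ := hcov z hz
      by_cases hVU : V = U
      · exact hempty (hVU ▸ hzV)
      · exact ⟨V, ⟨hV, hVU⟩, hzV⟩)
    exact (this.symm ▸ hU : U ∈ 𝓤 \ {U}).2 rfl
  have hcompact : ∀ U ∈ 𝓤, IsCompact (properPart 𝓤 U) := fun U hU => by
    have hO : ∀ V : Set ℝ, ∃ O, IsOpen O ∧ (V ∈ 𝓤 → V = O ∩ Z) := fun V => by
      by_cases hV : V ∈ 𝓤
      · obtain ⟨O, hO, hO'⟩ := h.isOpen V hV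
        exact ⟨O, hO, fun _ => hO'⟩
      · exact ⟨univ, isOpen_univ, fun h => absurd h hV⟩
    choose O hO hO' using hO
    have : properPart 𝓤 U = Z \ ⋃ V ∈ 𝓤 \ {U}, O V := by
      ext z
      simp only [properPart, mem_sdiff, mem_sUnion, mem_iUnion, not_exists, mem_singleton_iff,
        not_and]
      constructor
      · rintro ⟨hzU, hz⟩
        have hzZ := hsub U hU hzU
        refine ⟨hzZ, fun V hV hzV => hz V hV ?_⟩
        rw [hO' V hV.1]; exact ⟨hzV, hzZ⟩
      · rintro ⟨hzZ, hz⟩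
        have hz' : ∀ V, V ∈ 𝓤 ∧ ¬V = U → z ∉ V := fun V hV hzV => hz V hV
          ((hO' V hV.1).subset hzV).1
        refine ⟨?_, hz'⟩
        obtain ⟨V, hV, hzV⟩ := hcov z hzZ
        by_contra hzU
        exact hz' V ⟨hV, fun e => hzU (e ▸ hzV)⟩ hzV
    rw [this]
    exact hZ.diff (isOpen_biUnion fun V _ => hO V)
  have hlow : ∀ U ∈ 𝓤, lowEnd 𝓤 U ∈ properPart 𝓤 U := fun U hU => (hcompact U hU).sInf_mem (hne U hU)
  have hhigh : ∀ U ∈ 𝓤, highEnd 𝓤 U ∈ properPart 𝓤 U := fun U hU =>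
    (hcompact U hU).sSup_mem (hne U hU)
  have hnot : ∀ U V : Set ℝ, V ∈ 𝓤 → U ≠ V → ∀ z ∈ properPart 𝓤 U, z ∉ V := fun U V hV hUV z hz hzV =>
    hz.2 ⟨V, ⟨hV, fun e => hUV e.symm⟩, hzV⟩
  have hIcc : ∀ U ∈ 𝓤, ∀ z ∈ properPart 𝓤 U, z ∈ Icc (lowEnd 𝓤 U) (highEnd 𝓤 U) := fun U hU z hz =>
    ⟨csInf_le (hcompact U hU).bddBelow hz, le_csSup (hcompact U hU).bddAbove hz⟩
  have hinj : ∀ U ∈ 𝓤, ∀ V ∈ 𝓤, lowEnd 𝓤 U = lowEnd 𝓤 V → U = V := fun U hU V hV e => by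
    by_contra hUV
    exact hnot U V hV hUV _ (hlow U hU) (e ▸ (hlow V hV).1)
  refine ⟨?_, hcov, hsub, ?_, ?_, fun U hU => (hlow U hU).1, fun U hU => (hhigh U hU).1,
    fun U hU V hV hUV => hnot U V hV hUV _ (hlow U hU),
    fun U hU V hV hUV => hnot U V hV hUV _ (hhigh U hU), ?_, ?_⟩
  · refine Finite.of_finite_image (f := fun U => (lowEnd 𝓤 U, highEnd 𝓤 U)) ?_ ?_
    · refine (List.finite_toSet L).subset ?_
      rintro _ ⟨U, hU, rfl⟩
      exact (hL.2 _).2 ⟨U, hU, rfl⟩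
    · exact fun U hU V hV e => hinj U hU V hV (congrArg Prod.fst e)
  · intro U hU x hx y hy z hz hxz hzy
    obtain ⟨I, hI, e⟩ := h.interval U hU
    rw [e] at hx hy ⊢
    exact ⟨hI.out hx.1 hy.1 ⟨hxz, hzy⟩, hz⟩
  · intro U hU
    refine lt_of_le_of_ne (hIcc U hU _ (hlow U hU)).2 fun e => ?_
    have hs : properPart 𝓤 U = {lowEnd 𝓤 U} := by
      refine subset_antisymm (fun z hz => ?_) (singleton_subset_iff.2 (hlow U hU))
      have := hIcc U hU z hz
      rw [← e, Icc_self] at this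
      exact this
    refine h.generic U hU {lowEnd 𝓤 U} ⟨lowEnd 𝓤 U, hlow U hU, ?_⟩ _ rfl
    refine subset_antisymm (singleton_subset_iff.2 (mem_pathComponentIn_self (hlow U hU))) ?_
    exact pathComponentIn_subset.trans hs.subset
  · exact fun U hU z hz hz' => hIcc U hU z ⟨hz, fun ⟨V, hV, hzV⟩ => hz' V hV.1 (fun e => hV.2 e.symm) hzV⟩
  · intro U hU V hV hUV
    have hsymm : L.Pairwise fun x y => x.2 < y.1 ∨ y.2 < x.1 := hL.1.imp Or.inl
    have : Std.Symm fun x y : ℝ × ℝ => x.2 < y.1 ∨ y.2 < x.1 := ⟨fun _ _ => Or.symm⟩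
    exact hsymm.forall ((hL.2 _).2 ⟨U, hU, rfl⟩) ((hL.2 _).2 ⟨V, hV, rfl⟩)
      fun e => hUV (hinj U hU V hV (congrArg Prod.fst e))

namespace OrderedCover

variable {Z : Set ℝ} {𝓤 : Set (Set ℝ)} (h : OrderedCover Z 𝓤) {U V W : Set ℝ}
include h

theorem ne_of_lt (hU : U ∈ 𝓤) (hlt : highEnd 𝓤 U < lowEnd 𝓤 V) : U ≠ V := by
  rintro rfl
  exact lt_asymm hlt (h.low_lt_high U hU)

/-- An end of a proper part lies in no other element, whereas an element contains all points of `Z`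
between any two of its points. The later facts about the order rest on this conflict. -/
theorem lt_of_mem_inter (hU : U ∈ 𝓤) (hV : V ∈ 𝓤) (hlt : highEnd 𝓤 U < lowEnd 𝓤 V) {z : ℝ}
    (hz : z ∈ U ∩ V) : highEnd 𝓤 U < z ∧ z < lowEnd 𝓤 V := by
  have hUV := h.ne_of_lt hU hlt
  constructor
  · by_contra hle
    exact h.high_notMem U hU V hV hUV (h.interval V hV z hz.2 _ (h.low_mem V hV) _
      (h.subset U hU (h.high_mem U hU)) (not_lt.1 hle) hlt.le)
  · by_contra hle
    exact h.low_notMem V hV U hU hUV.symm (h.interval U hU _ (h.high_mem U hU) z hz.1 _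
      (h.subset V hV (h.low_mem V hV)) hlt.le (not_lt.1 hle))

/-- There are no elements between two intersecting elements. -/
theorem not_between (hU : U ∈ 𝓤) (hV : V ∈ 𝓤) (hne : (U ∩ V).Nonempty) (hW : W ∈ 𝓤)
    (h₁ : highEnd 𝓤 U < lowEnd 𝓤 W) (h₂ : highEnd 𝓤 W < lowEnd 𝓤 V) : False := by
  obtain ⟨z, hz⟩ := hne
  have hWlt := h.low_lt_high W hW
  rcases le_total (lowEnd 𝓤 W) z with hle | hle
  · exact h.low_notMem W hW U hU (h.ne_of_lt hU h₁).symm (h.interval U hU _ (h.high_mem U hU) z hz.1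
      _ (h.subset W hW (h.low_mem W hW)) h₁.le hle)
  · exact h.low_notMem W hW V hV (h.ne_of_lt hW h₂) (h.interval V hV z hz.2 _ (h.low_mem V hV) _
      (h.subset W hW (h.low_mem W hW)) hle (hWlt.trans h₂).le)

/-- Three distinct elements do not intersect. -/
theorem not_triple (hU : U ∈ 𝓤) (hV : V ∈ 𝓤) (hW : W ∈ 𝓤) (hUV : U ≠ V) (hVW : V ≠ W) (hUW : U ≠ W)
    {z : ℝ} (hzU : z ∈ U) (hzV : z ∈ V) (hzW : z ∈ W) : False := by
  have h1 := h.low_lt_high U hU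
  have h2 := h.low_lt_high V hV
  have h3 := h.low_lt_high W hW
  -- In every linear order of the three, the middle element would lie between two elements that
  -- intersect. The two cyclic patterns contradict the inequalities.
  rcases h.ordered U hU V hV hUV with a | a <;> rcases h.ordered V hV W hW hVW with b | b <;>
    rcases h.ordered U hU W hW hUW with c | c
  · exact h.not_between hU hW ⟨z, hzU, hzW⟩ hV a b
  · linarith
  · exact h.not_between hU hV ⟨z, hzU, hzV⟩ hW c b
  · exact h.not_between hW hV ⟨z, hzW, hzV⟩ hU c a
  · exact h.not_between hV hW ⟨z, hzV, hzW⟩ hU a c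
  · exact h.not_between hV hU ⟨z, hzV, hzU⟩ hW b c
  · linarith
  · exact h.not_between hW hU ⟨z, hzW, hzU⟩ hV b a

theorem mem_of_mem_Icc (hU : U ∈ 𝓤) {z : ℝ} (hz : z ∈ Z) (hzU : z ∈ Icc (lowEnd 𝓤 U) (highEnd 𝓤 U)) :
    z ∈ U := h.interval U hU _ (h.low_mem U hU) _ (h.high_mem U hU) z hz hzU.1 hzU.2

theorem mem_Icc_or {z : ℝ} (hz : z ∈ Z) : (∃ U ∈ 𝓤, z ∈ Icc (lowEnd 𝓤 U) (highEnd 𝓤 U)) ∨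
    ∃ U ∈ 𝓤, ∃ V ∈ 𝓤, z ∈ U ∩ V ∧ highEnd 𝓤 U < z ∧ z < lowEnd 𝓤 V := by
  obtain ⟨U, hU, hzU⟩ := h.cover z hz
  by_cases hp : ∀ V ∈ 𝓤, U ≠ V → z ∉ V
  · exact Or.inl ⟨U, hU, h.proper U hU z hzU hp⟩
  · push Not at hp
    obtain ⟨V, hV, hUV, hzV⟩ := hp
    rcases h.ordered U hU V hV hUV with hlt | hlt
    · exact Or.inr ⟨U, hU, V, hV, ⟨hzU, hzV⟩, h.lt_of_mem_inter hU hV hlt ⟨hzU, hzV⟩⟩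
    · exact Or.inr ⟨V, hV, U, hU, ⟨hzV, hzU⟩, h.lt_of_mem_inter hV hU hlt ⟨hzV, hzU⟩⟩

/-- The points of `Z` between the proper parts of consecutive elements. -/
theorem mem_inter_of_mem_Ioo (hU : U ∈ 𝓤) (hV : V ∈ 𝓤)
    (hcons : ∀ W ∈ 𝓤, highEnd 𝓤 U < lowEnd 𝓤 W → highEnd 𝓤 W < lowEnd 𝓤 V → False) {z : ℝ}
    (hz : z ∈ Z) (hUz : highEnd 𝓤 U < z) (hzV : z < lowEnd 𝓤 V) : z ∈ U ∩ V := by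
  have hUlt := h.low_lt_high U hU
  have hVlt := h.low_lt_high V hV
  rcases h.mem_Icc_or hz with ⟨W, hW, hzW⟩ | ⟨W, hW, W', hW', hzW, h1, h2⟩
  · have hWU : W ≠ U := by rintro rfl; exact absurd hzW.2 (not_le.2 hUz)
    have hWV : W ≠ V := by rintro rfl; exact absurd hzW.1 (not_le.2 hzV)
    have a := (h.ordered U hU W hW hWU.symm).resolve_right fun hlt => by
      have := hzW.2; linarith
    have b := (h.ordered W hW V hV hWV).resolve_right fun hlt => by
      have := hzW.1; linarith
    exact (hcons W hW a b).elim
  · have hWlt := h.low_lt_high W hW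
    have hWlt' := h.low_lt_high W' hW'
    have e1 : W = U := by
      by_contra hWU
      rcases h.ordered W hW U hU hWU with a | a
      · exact h.not_between hW hW' ⟨z, hzW⟩ hU a (hUz.trans h2)
      · exact hcons W hW a (h1.trans hzV)
    have e2 : W' = V := by
      by_contra hWV
      rcases h.ordered W' hW' V hV hWV with a | a
      · exact hcons W' hW' (hUz.trans h2) a
      · exact h.not_between hW hW' ⟨z, hzW⟩ hV (h1.trans hzV) a
    exact ⟨e1 ▸ hzW.1, e2 ▸ hzW.2⟩

omit h in
/-- The open interval between the proper parts of the neighbours of `U`. -/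
def hull (𝓤 : Set (Set ℝ)) (U : Set ℝ) : Set ℝ :=
  {t | ∀ V ∈ 𝓤, (highEnd 𝓤 V < lowEnd 𝓤 U → highEnd 𝓤 V < t) ∧
    (highEnd 𝓤 U < lowEnd 𝓤 V → t < lowEnd 𝓤 V)}

omit h in
theorem ordConnected_hull (𝓤 : Set (Set ℝ)) (U : Set ℝ) : (hull 𝓤 U).OrdConnected :=
  ⟨fun _ hx _ hy _ hz V hV => ⟨fun hlt => ((hx V hV).1 hlt).trans_le hz.1,
    fun hlt => hz.2.trans_lt ((hy V hV).2 hlt)⟩⟩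

theorem isOpen_hull (U : Set ℝ) : IsOpen (hull 𝓤 U) := by
  have : hull 𝓤 U = ⋂ V ∈ 𝓤, {t | (highEnd 𝓤 V < lowEnd 𝓤 U → highEnd 𝓤 V < t) ∧
    (highEnd 𝓤 U < lowEnd 𝓤 V → t < lowEnd 𝓤 V)} := by
    ext t; simp only [hull, mem_iInter]; rfl
  rw [this]
  refine h.finite.isOpen_biInter fun V _ => IsOpen.inter ?_ ?_
  · by_cases hlt : highEnd 𝓤 V < lowEnd 𝓤 U
    · simp only [hlt, forall_const]; exact isOpen_Ioi
    · simp only [hlt, false_imp_iff]; exact isOpen_univ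
  · by_cases hlt : highEnd 𝓤 U < lowEnd 𝓤 V
    · simp only [hlt, forall_const]; exact isOpen_Iio
    · simp only [hlt, false_imp_iff]; exact isOpen_univ

/-- The image of `f` may be disconnected, so `U` need not be an interval of `ℝ`. The hull is an open
interval with the same preimage, to which the results on intervals apply. -/
theorem mem_hull_iff (hU : U ∈ 𝓤) {z : ℝ} (hz : z ∈ Z) : z ∈ hull 𝓤 U ↔ z ∈ U := by
  constructor
  · intro hzU
    rcases h.mem_Icc_or hz with ⟨W, hW, hzW⟩ | ⟨W, hW, W', hW', hzW, h1, h2⟩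
    · by_cases hWU : W = U
      · exact hWU ▸ h.mem_of_mem_Icc hW hz hzW
      · rcases h.ordered W hW U hU hWU with a | a
        · exact absurd ((hzU W hW).1 a) (not_lt.2 hzW.2)
        · exact absurd ((hzU W hW).2 a) (not_lt.2 hzW.1)
    · by_contra hzU'
      have hWlt := h.low_lt_high W hW
      have hWlt' := h.low_lt_high W' hW'
      have hWU : W ≠ U := by rintro rfl; exact hzU' hzW.1
      have hWU' : W' ≠ U := by rintro rfl; exact hzU' hzW.2
      have a := (h.ordered W hW U hU hWU).resolve_right fun a => by
        have := (hzU W hW).2 a; linarith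
      have b := (h.ordered W' hW' U hU hWU').resolve_left fun b => by
        have := (hzU W' hW').1 b; linarith
      exact h.not_between hW hW' ⟨z, hzW⟩ hU a b
  · intro hzU V hV
    constructor
    · intro hlt
      by_contra hle
      exact h.high_notMem V hV U hU (h.ne_of_lt hV hlt) (h.interval U hU z hzU _ (h.low_mem U hU) _
        (h.subset V hV (h.high_mem V hV)) (not_lt.1 hle) hlt.le)
    · intro hlt
      by_contra hle
      exact h.low_notMem V hV U hU (h.ne_of_lt hU hlt).symm (h.interval U hU _ (h.high_mem U hU) z
        hzU _ (h.subset V hV (h.low_mem V hV)) hlt.le (not_lt.1 hle))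

theorem Ioo_subset_hull (hU : U ∈ 𝓤) (hV : V ∈ 𝓤)
    (hcons : ∀ W ∈ 𝓤, highEnd 𝓤 U < lowEnd 𝓤 W → highEnd 𝓤 W < lowEnd 𝓤 V → False) :
    Ioo (highEnd 𝓤 U) (lowEnd 𝓤 V) ⊆ hull 𝓤 U ∩ hull 𝓤 V := by
  have hUlt := h.low_lt_high U hU
  have hVlt := h.low_lt_high V hV
  rintro t ⟨ht1, ht2⟩
  refine ⟨fun W hW => ⟨fun a => by linarith, fun a => ?_⟩, fun W hW => ⟨fun a => ?_, fun _ => by linarith⟩⟩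
  · by_cases hWV : W = V
    · exact hWV ▸ ht2
    · have hWlt := h.low_lt_high W hW
      rcases h.ordered W hW V hV hWV with b | b
      · exact (hcons W hW a b).elim
      · linarith
  · by_cases hWU : W = U
    · exact hWU ▸ ht1
    · have hWlt := h.low_lt_high W hW
      rcases h.ordered W hW U hU hWU with b | b
      · linarith
      · exact (hcons W hW b a).elim

end OrderedCover

/-! ### The stages of the perturbation -/

namespace Perturbation

variable {X : Type u} [TopologicalSpace X] {f : X → ℝ} {M : MorseType f} {𝓤 : Set (Set ℝ)}

/-- The midpoint of an interval. -/
noncomputable def mid (x : ℝ × ℝ) : ℝ := (x.1 + x.2) / 2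

open Classical in
/-- The position of a down-fork after the Shifts. -/
noncomputable def downLabel (P : Perturbation M 𝓤) (c : ℝ) : ℝ :=
  if ∃ I J, BetweenProper 𝓤 I J c then c - P.ε c + P.down c else c - P.ε c

open Classical in
/-- The position of an up-fork after the Shifts. -/
noncomputable def upLabel (P : Perturbation M 𝓤) (c : ℝ) : ℝ :=
  if ∃ I J, BetweenProper 𝓤 I J c then c + P.ε c + P.up c else c + P.ε c

/-- The decoration of an interval after the first Merges. -/
noncomputable def decor (M : MorseType f) (x : ℝ × ℝ) : EReal × EReal :=
  (supBelow (range M.crit) x.1, infAbove (range M.crit) x.2)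

/-- The decoration after the Shifts. -/
noncomputable def shifted (P : Perturbation M 𝓤) : List (ℝ × EReal × EReal) :=
  P.list.flatMap fun x => [(P.downLabel (mid x), decor M x), (P.upLabel (mid x), decor M x)]

variable (P : Perturbation M 𝓤)

theorem properInterval_mem {U : Set ℝ} (hU : U ∈ 𝓤) : (lowEnd 𝓤 U, highEnd 𝓤 U) ∈ P.list :=
  (P.list_spec.2 _).2 (Or.inl ⟨U, hU, rfl⟩)

theorem interInterval_mem {U V : Set ℝ} (hU : U ∈ 𝓤) (hV : V ∈ 𝓤) (hUV : U ≠ V)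
    (hne : (U ∩ V).Nonempty) : (P.α (U ∩ V), P.β (U ∩ V)) ∈ P.list :=
  (P.list_spec.2 _).2 (Or.inr ⟨U, hU, V, hV, hUV, hne, rfl⟩)

variable (h : OrderedCover (range f) 𝓤)
include h

theorem cases_of_mem_list {x : ℝ × ℝ} (hx : x ∈ P.list) :
    (∃ U ∈ 𝓤, x = (lowEnd 𝓤 U, highEnd 𝓤 U)) ∨ ∃ U ∈ 𝓤, ∃ V ∈ 𝓤, (U ∩ V).Nonempty ∧
      highEnd 𝓤 U < lowEnd 𝓤 V ∧ x = (P.α (U ∩ V), P.β (U ∩ V)) ∧ x.1 ≤ x.2 ∧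
      x.1 ∈ U ∩ V ∧ x.2 ∈ U ∩ V ∧ highEnd 𝓤 U < x.1 ∧ x.2 < lowEnd 𝓤 V := by
  rcases (P.list_spec.2 x).1 hx with hU | ⟨U, hU, V, hV, hUV, hne, rfl⟩
  · exact Or.inl hU
  · right
    obtain ⟨h1, h2, h3, -⟩ := P.inter U hU V hV hUV hne
    rcases h.ordered U hU V hV hUV with hlt | hlt
    · exact ⟨U, hU, V, hV, hne, hlt, rfl, h1, h2, h3, (h.lt_of_mem_inter hU hV hlt h2).1,
        (h.lt_of_mem_inter hU hV hlt h3).2⟩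
    · rw [inter_comm] at h1 h2 h3 hne ⊢
      exact ⟨V, hV, U, hU, hne, hlt, rfl, h1, h2, h3, (h.lt_of_mem_inter hV hU hlt h2).1,
        (h.lt_of_mem_inter hV hU hlt h3).2⟩

theorem fst_le_snd {x : ℝ × ℝ} (hx : x ∈ P.list) : x.1 ≤ x.2 := by
  rcases P.cases_of_mem_list h hx with ⟨U, hU, rfl⟩ | ⟨U, hU, V, hV, -, -, -, h1, -⟩
  · exact (h.low_lt_high U hU).le
  · exact h1

theorem mid_mem {x : ℝ × ℝ} (hx : x ∈ P.list) : x.1 ≤ mid x ∧ mid x ≤ x.2 := by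
  have := P.fst_le_snd h hx
  rw [mid]
  constructor <;> linarith

omit h in
theorem trichotomy {x y : ℝ × ℝ} (hx : x ∈ P.list) (hy : y ∈ P.list) :
    x = y ∨ x.2 < y.1 ∨ y.2 < x.1 := by
  by_contra! hne
  have : Std.Symm fun x y : ℝ × ℝ => x.2 < y.1 ∨ y.2 < x.1 := ⟨fun _ _ => Or.symm⟩
  have hsymm : P.list.Pairwise fun x y => x.2 < y.1 ∨ y.2 < x.1 := P.list_spec.1.imp Or.inl
  rcases hsymm.forall hx hy hne.1 with h' | h'
  · exact absurd h' (not_lt.2 hne.2.1)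
  · exact absurd h' (not_lt.2 hne.2.2)

/-- There is a proper part between two intersections. -/
theorem highEnd_lt_of_lt {x y : ℝ × ℝ} {U V U' V' : Set ℝ} (hU : U ∈ 𝓤) (hV : V ∈ 𝓤) (hU' : U' ∈ 𝓤)
    (hV' : V' ∈ 𝓤) (hne : (U ∩ V).Nonempty) (hne' : (U' ∩ V').Nonempty)
    (hUV : highEnd 𝓤 U < lowEnd 𝓤 V) (hUV' : highEnd 𝓤 U' < lowEnd 𝓤 V')
    (ex : x = (P.α (U ∩ V), P.β (U ∩ V))) (ey : y = (P.α (U' ∩ V'), P.β (U' ∩ V')))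
    (hx : x ∈ P.list) (hy : y ∈ P.list) (hUx : highEnd 𝓤 U < x.1) (hUy : highEnd 𝓤 U' < y.1)
    (hyV : y.2 < lowEnd 𝓤 V') (hxy : x.2 < y.1) : highEnd 𝓤 V < y.1 := by
  have hxx := P.fst_le_snd h hx
  have hyy := P.fst_le_snd h hy
  -- If `U = U'`, then also `V = V'`, and the two intervals would coincide. If `U` is below `U'`,
  -- then `V` equals `U'` or is below it. All other orders put an element between two that
  -- intersect.
  by_cases hUU : U = U'
  · subst hUU
    by_cases hVV : V = V'
    · subst hVV
      rw [← ey] at ex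
      rw [ex] at hxy
      exact absurd hxy (not_lt.2 hyy)
    · rcases h.ordered V hV V' hV' hVV with a | a
      · exact (h.not_between hU hV' hne' hV hUV a).elim
      · exact (h.not_between hU hV hne hV' hUV' a).elim
  · rcases h.ordered U hU U' hU' hUU with a | a
    · by_cases hVU : V = U'
      · rw [hVU]; exact hUy
      · rcases h.ordered V hV U' hU' hVU with b | b
        · have := h.low_lt_high U' hU'
          linarith
        · exact (h.not_between hU hV hne hU' a b).elim
    · exact (h.not_between hU' hV' hne' hU a (by linarith)).elim

/-- Two merged intervals are separated by an end of a proper part, either one of the two or the one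
between two intersections. Splits stay between consecutive endpoints, so their forks do not
interleave. -/
theorem exists_endpoint {x y : ℝ × ℝ} (hx : x ∈ P.list) (hy : y ∈ P.list) (hxy : x.2 < y.1) :
    ∃ s ∈ endpoints 𝓤, mid x < s ∧ s < mid y := by
  obtain ⟨mx1, mx2⟩ := P.mid_mem h hx
  obtain ⟨my1, my2⟩ := P.mid_mem h hy
  rcases P.cases_of_mem_list h hx with ⟨U, hU, ex⟩ | ⟨U, hU, V, hV, hne, hUV, ex, -, -, -, hUx, hxV⟩
  · refine ⟨highEnd 𝓤 U, ⟨U, hU, Or.inr rfl⟩, ?_, ?_⟩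
    · have := h.low_lt_high U hU
      rw [ex, mid]
      linarith
    · rw [ex] at hxy
      exact lt_of_lt_of_le hxy my1
  · rcases P.cases_of_mem_list h hy with ⟨V', hV', ey⟩ | ⟨U', hU', V', hV', hne', hUV', ey, -, -, -, hUy, hyV⟩
    · refine ⟨lowEnd 𝓤 V', ⟨V', hV', Or.inl rfl⟩, ?_, ?_⟩
      · rw [ey] at hxy
        exact mx2.trans_lt hxy
      · have := h.low_lt_high V' hV'
        rw [ey, mid]
        linarith
    · have := P.highEnd_lt_of_lt h hU hV hU' hV' hne hne' hUV hUV' ex ey hx hy hUx hUy hyV hxy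
      have := h.low_lt_high V hV
      exact ⟨lowEnd 𝓤 V, ⟨V, hV, Or.inl rfl⟩, by linarith, by linarith⟩

theorem realises_merged [T2Space X] : ∃ κ κ', P.merged.Realises f
    (P.list.map fun x => (mid x, decor M x)) (sInf ((↑) '' range M.crit)) κ
      (sSup ((↑) '' range M.crit)) κ' := by
  obtain ⟨κ, κ', H⟩ := M.realises_telescope
  refine ⟨κ, κ', ?_⟩
  have := Telescope.Realises.mergeList (d₀ := []) (dl := M.decoration) M.continuous P.list H M.pairwise_crit_telescope
    P.list_spec.1 (fun x hx => P.fst_le_snd h hx) (by simp) ?_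
  · rwa [List.nil_append, lastHi, List.map_congr_left fun x _ => M.mergeEntry_decoration x] at this
  -- Each critical value of `f` lies between the ends of a proper part or in a chosen part of an
  -- intersection, so none is left unmerged.
  · intro e he
    obtain ⟨i, rfl⟩ := (List.mem_ofFn' _ _).1 he
    change ∃ x ∈ P.list, M.crit i ∈ Icc x.1 x.2
    rcases h.mem_Icc_or (M.crit_mem i) with ⟨U, hU, hi⟩ | ⟨U, hU, V, hV, hi, h1, h2⟩
    · exact ⟨_, P.properInterval_mem hU, hi⟩
    · have hne := h.ne_of_lt hU (h1.trans h2)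
      exact ⟨_, P.interInterval_mem hU hV hne ⟨_, hi⟩,
        (P.inter U hU V hV hne ⟨_, hi⟩).2.2.2 i hi⟩

theorem mid_mem_crit [T2Space X] {x : ℝ × ℝ} (hx : x ∈ P.list) : mid x ∈ P.merged.crit := by
  obtain ⟨κ, κ', H⟩ := P.realises_merged h
  rw [← H.map_fst]
  simp only [List.map_map, List.mem_map]
  exact ⟨x, hx, rfl⟩

theorem ε_pos [T2Space X] {x : ℝ × ℝ} (hx : x ∈ P.list) : 0 < P.ε (mid x) :=
  (P.ε_spec _ (P.mid_mem_crit h hx)).1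

theorem lt_sub_ε [T2Space X] {x : ℝ × ℝ} (hx : x ∈ P.list) {s : ℝ} (hs : s ∈ endpoints 𝓤)
    (hsx : s < mid x) : s < mid x - P.ε (mid x) := by
  obtain ⟨-, a, b, ⟨-, -, -, hab⟩, h1, h2, h3⟩ := P.ε_spec _ (P.mid_mem_crit h hx)
  have hsa : s ≤ a := not_lt.1 fun h' => hab s hs ⟨h', hsx.trans h2⟩
  have := h3.trans_le (min_le_left _ _)
  linarith

theorem add_ε_lt [T2Space X] {x : ℝ × ℝ} (hx : x ∈ P.list) {s : ℝ} (hs : s ∈ endpoints 𝓤)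
    (hsx : mid x < s) : mid x + P.ε (mid x) < s := by
  obtain ⟨-, a, b, ⟨-, -, -, hab⟩, h1, h2, h3⟩ := P.ε_spec _ (P.mid_mem_crit h hx)
  have hsa : b ≤ s := not_lt.1 fun h' => hab s hs ⟨h1.trans hsx, h'⟩
  have := h3.trans_le (min_le_right _ _)
  linarith

theorem add_ε_lt_sub_ε [T2Space X] {x y : ℝ × ℝ} (hx : x ∈ P.list) (hy : y ∈ P.list)
    (hxy : x.2 < y.1) : mid x + P.ε (mid x) < mid y - P.ε (mid y) := by
  obtain ⟨s, hs, h1, h2⟩ := P.exists_endpoint h hx hy hxy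
  exact (P.add_ε_lt h hx hs h1).trans (P.lt_sub_ε h hy hs h2)

theorem realises_split [T2Space X] : ∃ κ κ', (P.merged.splitAll P.ε).Realises f
    (P.list.flatMap fun x => [(mid x - P.ε (mid x), decor M x), (mid x + P.ε (mid x), decor M x)])
      (sInf ((↑) '' range M.crit)) κ (sSup ((↑) '' range M.crit)) κ' := by
  obtain ⟨κ, κ', H⟩ := P.realises_merged h
  refine ⟨κ, κ', ?_⟩
  have := H.splitAll (ε := P.ε) ?_ ?_
  · rwa [List.flatMap_map] at this
  · intro e he
    obtain ⟨x, hx, rfl⟩ := List.mem_map.1 he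
    exact P.ε_pos h hx
  · rw [List.pairwise_map]
    exact P.list_spec.1.imp_of_mem fun hx hy hxy => P.add_ε_lt_sub_ε h hx hy hxy

theorem mem_crit_split [T2Space X] {x : ℝ × ℝ} (hx : x ∈ P.list) :
    mid x - P.ε (mid x) ∈ (P.merged.splitAll P.ε).crit ∧
      mid x + P.ε (mid x) ∈ (P.merged.splitAll P.ε).crit := by
  obtain ⟨κ, κ', H⟩ := P.realises_split h
  rw [← H.map_fst]
  simp only [List.map_flatMap, List.mem_flatMap, List.map_cons, List.map_nil, List.mem_cons,
    List.not_mem_nil, or_false]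
  exact ⟨⟨x, hx, Or.inl rfl⟩, ⟨x, hx, Or.inr rfl⟩⟩

/-- A shifted down-fork does not pass the critical value before it, and an unshifted one does not
move. -/
theorem lt_downLabel [T2Space X] {x : ℝ × ℝ} (hx : x ∈ P.list) {c : ℝ}
    (hc : c ∈ (P.merged.splitAll P.ε).crit) (hcx : c < mid x - P.ε (mid x)) :
    c < P.downLabel (mid x) := by
  rw [downLabel]
  split_ifs with hp
  · obtain ⟨I, J, hIJ⟩ := hp
    exact (P.down_spec _ (P.mid_mem_crit h hx) I J hIJ).2.2 c hc hcx
  · exact hcx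

theorem upLabel_lt [T2Space X] {x : ℝ × ℝ} (hx : x ∈ P.list) {c : ℝ}
    (hc : c ∈ (P.merged.splitAll P.ε).crit) (hcx : mid x + P.ε (mid x) < c) :
    P.upLabel (mid x) < c := by
  rw [upLabel]
  split_ifs with hp
  · obtain ⟨I, J, hIJ⟩ := hp
    exact (P.up_spec _ (P.mid_mem_crit h hx) I J hIJ).2.2 c hc hcx
  · exact hcx

theorem downLabel_lt_mid [T2Space X] {x : ℝ × ℝ} (hx : x ∈ P.list) :
    P.downLabel (mid x) < mid x := by
  have := P.ε_pos h hx
  rw [downLabel]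
  split_ifs with hp
  · obtain ⟨I, J, hIJ⟩ := hp
    exact (P.down_spec _ (P.mid_mem_crit h hx) I J hIJ).2.1.trans hIJ.2.2.2.1
  · linarith

theorem mid_lt_upLabel [T2Space X] {x : ℝ × ℝ} (hx : x ∈ P.list) :
    mid x < P.upLabel (mid x) := by
  have := P.ε_pos h hx
  rw [upLabel]
  split_ifs with hp
  · obtain ⟨I, J, hIJ⟩ := hp
    exact hIJ.2.2.2.2.trans (P.up_spec _ (P.mid_mem_crit h hx) I J hIJ).1
  · linarith

/-- The forks of a proper part are not shifted and stay in the proper part. -/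
theorem labels_proper [T2Space X] {U : Set ℝ} (hU : U ∈ 𝓤) {x : ℝ × ℝ}
    (hx : x = (lowEnd 𝓤 U, highEnd 𝓤 U)) :
    (¬ ∃ I J, BetweenProper 𝓤 I J (mid x)) ∧
      P.downLabel (mid x) ∈ Icc (lowEnd 𝓤 U) (highEnd 𝓤 U) ∧
      P.upLabel (mid x) ∈ Icc (lowEnd 𝓤 U) (highEnd 𝓤 U) := by
  have hxl : x ∈ P.list := hx ▸ P.properInterval_mem hU
  have hlt := h.low_lt_high U hU
  have m1 : lowEnd 𝓤 U < mid x := by rw [hx, mid]; linarith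
  have m2 : mid x < highEnd 𝓤 U := by rw [hx, mid]; linarith
  have hp : ¬ ∃ I J, BetweenProper 𝓤 I J (mid x) := by
    rintro ⟨I, J, hI, hJ, hne, h1, h2⟩
    by_cases hIU : I = U
    · subst hIU; linarith
    · by_cases hUJ : U = J
      · subst hUJ; linarith
      · rcases h.ordered I hI U hU hIU with a | a
        · rcases h.ordered U hU J hJ hUJ with b | b
          · exact h.not_between hI hJ hne hU a b
          · have := h.low_lt_high J hJ; linarith
        · have := h.low_lt_high I hI; linarith
  have e1 := P.ε_pos h hxl
  have e2 := P.lt_sub_ε h hxl ⟨U, hU, Or.inl rfl⟩ m1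
  have e3 := P.add_ε_lt h hxl ⟨U, hU, Or.inr rfl⟩ m2
  refine ⟨hp, ?_⟩
  rw [downLabel, upLabel, if_neg hp, if_neg hp]
  exact ⟨⟨e2.le, by linarith⟩, ⟨by linarith, e3.le⟩⟩

/-- The forks of an intersection are shifted to the proper parts. -/
theorem labels_inter [T2Space X] {U V : Set ℝ} (hU : U ∈ 𝓤) (hV : V ∈ 𝓤) (hne : (U ∩ V).Nonempty)
    {x : ℝ × ℝ} (hx : x ∈ P.list) (h1 : highEnd 𝓤 U < x.1) (h2 : x.2 < lowEnd 𝓤 V) :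
    (∃ I J, BetweenProper 𝓤 I J (mid x)) ∧
      P.downLabel (mid x) ∈ Icc (lowEnd 𝓤 U) (highEnd 𝓤 U) ∧
      P.upLabel (mid x) ∈ Icc (lowEnd 𝓤 V) (highEnd 𝓤 V) := by
  obtain ⟨m1, m2⟩ := P.mid_mem h hx
  have hb : BetweenProper 𝓤 U V (mid x) := ⟨hU, hV, hne, by linarith, by linarith⟩
  have hp : ∃ I J, BetweenProper 𝓤 I J (mid x) := ⟨U, V, hb⟩
  have hd := P.down_spec _ (P.mid_mem_crit h hx) U V hb
  have hu := P.up_spec _ (P.mid_mem_crit h hx) U V hb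
  refine ⟨hp, ?_⟩
  rw [downLabel, upLabel, if_pos hp, if_pos hp]
  exact ⟨⟨hd.1.le, hd.2.1.le⟩, ⟨hu.1.le, hu.2.1.le⟩⟩

/-- If one of the intervals belongs to a proper part, its forks stay in place and limit the Shift of
the other. Between two intersections there is a proper part, and its two forks separate the shifted
ones. -/
theorem upLabel_lt_downLabel [T2Space X] {x y : ℝ × ℝ} (hx : x ∈ P.list) (hy : y ∈ P.list)
    (hxy : x.2 < y.1) : P.upLabel (mid x) < P.downLabel (mid y) := by
  have hsep := P.add_ε_lt_sub_ε h hx hy hxy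
  rcases P.cases_of_mem_list h hx with ⟨U, hU, ex⟩ | ⟨U, hU, V, hV, hne, hUV, ex, -, -, -, hUx, hxV⟩
  · have := (P.labels_proper h hU ex).1
    rw [upLabel, if_neg this]
    exact P.lt_downLabel h hy (P.mem_crit_split h hx).2 hsep
  · rcases P.cases_of_mem_list h hy with ⟨V', hV', ey⟩ | ⟨U', hU', V', hV', hne', hUV', ey, -, -, -, hUy, hyV⟩
    · have := (P.labels_proper h hV' ey).1
      rw [downLabel, if_neg this]
      exact P.upLabel_lt h hx (P.mem_crit_split h hy).1 hsep
    · have hlt := P.highEnd_lt_of_lt h hU hV hU' hV' hne hne' hUV hUV' ex ey hx hy hUx hUy hyV hxy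
      have hz := P.properInterval_mem hV
      have s1 := P.upLabel_lt h hx (P.mem_crit_split h hz).1 (P.add_ε_lt_sub_ε h hx hz hxV)
      have s2 := P.lt_downLabel h hy (P.mem_crit_split h hz).2 (P.add_ε_lt_sub_ε h hz hy hlt)
      have := P.ε_pos h hz
      linarith

theorem pairwise_shifted [T2Space X] : P.shifted.Pairwise fun e e' => e.1 < e'.1 := by
  rw [shifted, List.pairwise_flatMap]
  constructor
  · intro x hx
    simp only [List.pairwise_cons, List.mem_singleton, forall_eq, List.not_mem_nil, false_imp_iff,
      implies_true, List.Pairwise.nil, and_true]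
    exact (P.downLabel_lt_mid h hx).trans (P.mid_lt_upLabel h hx)
  · refine P.list_spec.1.imp_of_mem fun {x y} hx hy hxy e he e' he' => ?_
    have h0 := P.upLabel_lt_downLabel h hx hy hxy
    have h1 := (P.downLabel_lt_mid h hx).trans (P.mid_lt_upLabel h hx)
    have h2 := (P.downLabel_lt_mid h hy).trans (P.mid_lt_upLabel h hy)
    simp only [List.mem_cons, List.not_mem_nil, or_false] at he he'
    rcases he with rfl | rfl <;> rcases he' with rfl | rfl <;> simp only <;> linarith

theorem realises_shifted [T2Space X] : ∃ κ κ', ((P.merged.splitAll P.ε).shiftForks P.ε P.up P.down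
    (open Classical in P.merged.crit.filter fun c => ∃ I J, BetweenProper 𝓤 I J c)).Realises f
      P.shifted (sInf ((↑) '' range M.crit)) κ (sSup ((↑) '' range M.crit)) κ' := by
  obtain ⟨κ₁, κ₁', H₁⟩ := P.realises_merged h
  obtain ⟨κ, κ', H⟩ := P.realises_split h
  refine ⟨κ, κ', ?_⟩
  rw [← H₁.map_fst]
  have := Telescope.Realises.shiftForks (dl := P.list.map fun x => (mid x, decor M x)) (ε := P.ε)
    (by rw [List.flatMap_map]; exact H) ?_ P.up P.down (fun c => ∃ I J, BetweenProper 𝓤 I J c) ?_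
  · rw [List.flatMap_map] at this
    exact this
  · intro e he
    obtain ⟨x, hx, rfl⟩ := List.mem_map.1 he
    exact P.ε_pos h hx
  · rw [List.pairwise_map]
    refine P.list_spec.1.imp_of_mem fun {x y} hx hy hxy => ?_
    have hsep := P.add_ε_lt_sub_ε h hx hy hxy
    refine ⟨?_, P.upLabel_lt h hx (P.mem_crit_split h hy).1 hsep⟩
    have := P.downLabel_lt_mid h hx
    have := P.ε_pos h hx
    change P.downLabel (mid x) < mid y - P.ε (mid y)
    linarith

end Perturbation

/-! ### The forks that end up in a proper part, and the final decoration. -/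

theorem OrderedCover.eq_of_mem_Icc {Z : Set ℝ} {𝓤 : Set (Set ℝ)} (h : OrderedCover Z 𝓤) {U V : Set ℝ}
    (hU : U ∈ 𝓤) (hV : V ∈ 𝓤) {t : ℝ} (htU : t ∈ Icc (lowEnd 𝓤 U) (highEnd 𝓤 U))
    (htV : t ∈ Icc (lowEnd 𝓤 V) (highEnd 𝓤 V)) : U = V := by
  by_contra hne
  rcases h.ordered U hU V hV hne with a | a
  · exact absurd (htV.1.trans htU.2) (not_le.2 a)
  · exact absurd (htU.1.trans htV.2) (not_le.2 a)

theorem OrderedCover.eq_of_mem_Icc_of_mem {Z : Set ℝ} {𝓤 : Set (Set ℝ)} (h : OrderedCover Z 𝓤)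
    {U V : Set ℝ} (hU : U ∈ 𝓤) (hV : V ∈ 𝓤) {t : ℝ} (htU : t ∈ U)
    (htV : t ∈ Icc (lowEnd 𝓤 V) (highEnd 𝓤 V)) : U = V := by
  by_contra hne
  rcases h.ordered U hU V hV hne with a | a
  · exact h.low_notMem V hV U hU (Ne.symm hne) (h.interval U hU _ (h.high_mem U hU) t htU _
      (h.subset V hV (h.low_mem V hV)) a.le htV.1)
  · exact h.high_notMem V hV U hU (Ne.symm hne) (h.interval U hU t htU _ (h.low_mem U hU) _
      (h.subset V hV (h.high_mem V hV)) htV.2 a.le)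

namespace Perturbation

variable {X : Type u} [TopologicalSpace X] {f : X → ℝ} {M : MorseType f} {𝓤 : Set (Set ℝ)}

/-- One of the forks of an interval lies in the proper part of `U`. -/
def HasLabel (P : Perturbation M 𝓤) (U : Set ℝ) (x : ℝ × ℝ) : Prop :=
  P.downLabel (mid x) ∈ Icc (lowEnd 𝓤 U) (highEnd 𝓤 U) ∨
    P.upLabel (mid x) ∈ Icc (lowEnd 𝓤 U) (highEnd 𝓤 U)

variable (P : Perturbation M 𝓤) (h : OrderedCover (range f) 𝓤)
include h

/-- The intervals between the ends of different proper parts are disjoint, so the position of a fork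
identifies the element. The forks at `U` thus come from its own proper part or from an intersection
with `U`. -/
theorem HasLabel.mem [T2Space X] {U : Set ℝ} (hU : U ∈ 𝓤) {x : ℝ × ℝ} (hx : x ∈ P.list)
    (hxU : P.HasLabel U x) : x.1 ∈ U ∧ x.2 ∈ U := by
  rcases P.cases_of_mem_list h hx with ⟨V, hV, rfl⟩ | ⟨V, hV, W, hW, hne, hVW, -, -, m1, m2, h1, h2⟩
  · obtain ⟨-, l1, l2⟩ := P.labels_proper h hV rfl
    have : U = V := hxU.elim (fun l => h.eq_of_mem_Icc hU hV l l1) fun l => h.eq_of_mem_Icc hU hV l l2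
    subst this
    exact ⟨h.low_mem U hU, h.high_mem U hU⟩
  · obtain ⟨-, l1, l2⟩ := P.labels_inter h hV hW hne hx h1 h2
    rcases hxU with l | l
    · rw [h.eq_of_mem_Icc hU hV l l1]; exact ⟨m1.1, m2.1⟩
    · rw [h.eq_of_mem_Icc hU hW l l2]; exact ⟨m1.2, m2.2⟩

/-- The down-fork of an intersection goes to the lower element and the up-fork to the higher one, so
each of the two receives a fork. -/
theorem hasLabel_inter [T2Space X] {U V : Set ℝ} (hU : U ∈ 𝓤) (hV : V ∈ 𝓤) (hUV : U ≠ V)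
    (hne : (U ∩ V).Nonempty) : P.HasLabel U (P.α (U ∩ V), P.β (U ∩ V)) := by
  obtain ⟨-, m1, m2, -⟩ := P.inter U hU V hV hUV hne
  have hx := P.interInterval_mem hU hV hUV hne
  rcases h.ordered U hU V hV hUV with a | a
  · exact Or.inl (P.labels_inter h hU hV hne hx (h.lt_of_mem_inter hU hV a m1).1
      (h.lt_of_mem_inter hU hV a m2).2).2.1
  · rw [inter_comm] at hne m1 m2 hx ⊢
    exact Or.inr (P.labels_inter h hV hU hne hx (h.lt_of_mem_inter hV hU a m1).1
      (h.lt_of_mem_inter hV hU a m2).2).2.2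

theorem exists_hasLabel [T2Space X] {U : Set ℝ} (hU : U ∈ 𝓤) (i : Fin M.n) (hi : M.crit i ∈ U) :
    ∃ x ∈ P.list, P.HasLabel U x ∧ M.crit i ∈ Icc x.1 x.2 := by
  rcases h.mem_Icc_or (M.crit_mem i) with ⟨V, hV, hiV⟩ | ⟨V, hV, W, hW, hiVW, h1, h2⟩
  · obtain rfl := h.eq_of_mem_Icc_of_mem hU hV hi hiV
    exact ⟨_, P.properInterval_mem hU, Or.inl (P.labels_proper h hU rfl).2.1, hiV⟩
  · have hVW := h.ne_of_lt hV (h1.trans h2)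
    have hne : (V ∩ W).Nonempty := ⟨_, hiVW⟩
    have hicc := (P.inter V hV W hW hVW hne).2.2.2 i hiVW
    refine ⟨_, P.interInterval_mem hV hW hVW hne, ?_, hicc⟩
    by_cases hUV : U = V
    · rw [hUV]; exact P.hasLabel_inter h hV hW hVW hne
    · by_cases hUW : U = W
      · rw [hUW, inter_comm]
        exact P.hasLabel_inter h hW hV hVW.symm (inter_comm V W ▸ hne)
      · exact (h.not_triple hU hV hW hUV hVW hUW hi hiVW.1 hiVW.2).elim

omit h in
theorem exists_mem_shifted {e : ℝ × EReal × EReal} (he : e ∈ P.shifted) : ∃ x ∈ P.list,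
    e.2 = decor M x ∧ (e.1 = P.downLabel (mid x) ∨ e.1 = P.upLabel (mid x)) := by
  obtain ⟨x, hx, he⟩ := List.mem_flatMap.1 he
  simp only [List.mem_cons, List.not_mem_nil, or_false] at he
  rcases he with rfl | rfl
  · exact ⟨x, hx, rfl, Or.inl rfl⟩
  · exact ⟨x, hx, rfl, Or.inr rfl⟩

omit h in
theorem exists_mem_shifted_of_hasLabel {U : Set ℝ} {x : ℝ × ℝ} (hx : x ∈ P.list)
    (hxU : P.HasLabel U x) : ∃ e ∈ P.shifted, e.1 ∈ Icc (lowEnd 𝓤 U) (highEnd 𝓤 U) ∧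
      (e.1 = P.downLabel (mid x) ∨ e.1 = P.upLabel (mid x)) := by
  rcases hxU with l | l
  · exact ⟨(_, decor M x), List.mem_flatMap.2 ⟨x, hx, List.mem_cons_self ..⟩, l, Or.inl rfl⟩
  · exact ⟨(_, decor M x), List.mem_flatMap.2 ⟨x, hx, List.mem_cons_of_mem _ (List.mem_cons_self ..)⟩,
      l, Or.inr rfl⟩

/-- The labels determine the order of the intervals. -/
theorem le_of_label_le [T2Space X] {x y : ℝ × ℝ} (hx : x ∈ P.list) (hy : y ∈ P.list) {s t : ℝ}
    (hs : s = P.downLabel (mid x) ∨ s = P.upLabel (mid x))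
    (ht : t = P.downLabel (mid y) ∨ t = P.upLabel (mid y)) (hst : s ≤ t) :
    x.1 ≤ y.1 ∧ x.2 ≤ y.2 := by
  rcases P.trichotomy hx hy with rfl | hlt | hlt
  · exact ⟨le_rfl, le_rfl⟩
  · have h1 := P.fst_le_snd h hx
    have h2 := P.fst_le_snd h hy
    constructor <;> linarith
  · have h0 := P.upLabel_lt_downLabel h hy hx hlt
    have h1 := (P.downLabel_lt_mid h hx).trans (P.mid_lt_upLabel h hx)
    have h2 := (P.downLabel_lt_mid h hy).trans (P.mid_lt_upLabel h hy)
    rcases hs with rfl | rfl <;> rcases ht with rfl | rfl <;> linarith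

/-- The lowest and the highest fork at `U` determine the merged interval. `A` and `B` are the lower
and the upper end of the intervals from which these two forks come; they bound all the others since
labels and intervals are in the same order. -/
theorem exists_mergeEntry_shifted [T2Space X] {U : Set ℝ} (hU : U ∈ 𝓤) (h₀ l₀ : EReal) :
    ∃ A ∈ U, ∃ B ∈ U, Telescope.mergeEntry P.shifted h₀ l₀ (lowEnd 𝓤 U, highEnd 𝓤 U) =
      ((lowEnd 𝓤 U + highEnd 𝓤 U) / 2, supBelow (range M.crit) A, infAbove (range M.crit) B) ∧
      ∀ x ∈ P.list, P.HasLabel U x → A ≤ x.1 ∧ x.2 ≤ B := by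
  have hUl := P.properInterval_mem hU
  have hsort := P.pairwise_shifted h
  obtain ⟨e₀, he₀, hlow₀, -⟩ := P.exists_mem_shifted_of_hasLabel hUl
    (Or.inl (P.labels_proper h hU rfl).2.1)
  obtain ⟨A, hA, eA, hA'⟩ : ∃ A ∈ U, firstLo (P.shifted.filter fun e => lowEnd 𝓤 U ≤ e.1) l₀ =
      supBelow (range M.crit) A ∧ ∀ x ∈ P.list, P.HasLabel U x → A ≤ x.1 := by
    have hp := hsort.filter fun e => lowEnd 𝓤 U ≤ e.1
    have hmem : ∀ e, e ∈ P.shifted.filter (fun e => lowEnd 𝓤 U ≤ e.1) ↔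
        e ∈ P.shifted ∧ lowEnd 𝓤 U ≤ e.1 := fun e => by simp [List.mem_filter]
    generalize P.shifted.filter (fun e => lowEnd 𝓤 U ≤ e.1) = d at hp hmem
    rcases d with _ | ⟨e, d⟩
    · exact absurd ((hmem e₀).2 ⟨he₀, hlow₀.1⟩) List.not_mem_nil
    · have hle : ∀ e', e' ∈ P.shifted → lowEnd 𝓤 U ≤ e'.1 → e.1 ≤ e'.1 := fun e' h1 h2 => by
        rcases List.mem_cons.1 ((hmem e').2 ⟨h1, h2⟩) with rfl | h3
        · exact le_rfl
        · exact ((List.pairwise_cons.1 hp).1 e' h3).le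
      obtain ⟨he, hel⟩ := (hmem e).1 (List.mem_cons_self ..)
      obtain ⟨x, hx, ex, lx⟩ := P.exists_mem_shifted he
      have heU : e.1 ∈ Icc (lowEnd 𝓤 U) (highEnd 𝓤 U) :=
        ⟨hel, (hle e₀ he₀ hlow₀.1).trans hlow₀.2⟩
      have hxU : P.HasLabel U x := lx.elim (fun l => Or.inl (l ▸ heU)) fun l => Or.inr (l ▸ heU)
      refine ⟨x.1, (HasLabel.mem P h hU hx hxU).1, congrArg Prod.fst ex, fun y hy hyU => ?_⟩
      obtain ⟨e', he', l1, l2⟩ := P.exists_mem_shifted_of_hasLabel hy hyU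
      exact (P.le_of_label_le h hx hy lx l2 (hle e' he' l1.1)).1
  obtain ⟨B, hB, eB, hB'⟩ : ∃ B ∈ U, lastHi (P.shifted.filter fun e => e.1 ≤ highEnd 𝓤 U) h₀ =
      infAbove (range M.crit) B ∧ ∀ x ∈ P.list, P.HasLabel U x → x.2 ≤ B := by
    have hp := hsort.filter fun e => e.1 ≤ highEnd 𝓤 U
    have hmem : ∀ e, e ∈ P.shifted.filter (fun e => e.1 ≤ highEnd 𝓤 U) ↔
        e ∈ P.shifted ∧ e.1 ≤ highEnd 𝓤 U := fun e => by simp [List.mem_filter]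
    generalize P.shifted.filter (fun e => e.1 ≤ highEnd 𝓤 U) = d at hp hmem
    rcases List.eq_nil_or_concat d with rfl | ⟨d, e, rfl⟩
    · exact absurd ((hmem e₀).2 ⟨he₀, hlow₀.2⟩) List.not_mem_nil
    · rw [List.concat_eq_append] at *
      have hle : ∀ e', e' ∈ P.shifted → e'.1 ≤ highEnd 𝓤 U → e'.1 ≤ e.1 := fun e' h1 h2 => by
        rcases List.mem_append.1 ((hmem e').2 ⟨h1, h2⟩) with h3 | h3
        · exact ((List.pairwise_append.1 hp).2.2 e' h3 e (List.mem_singleton_self _)).le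
        · rw [List.mem_singleton.1 h3]
      obtain ⟨he, hel⟩ := (hmem e).1 (List.mem_append_right _ (List.mem_singleton_self _))
      obtain ⟨x, hx, ex, lx⟩ := P.exists_mem_shifted he
      have heU : e.1 ∈ Icc (lowEnd 𝓤 U) (highEnd 𝓤 U) :=
        ⟨hlow₀.1.trans (hle e₀ he₀ hlow₀.2), hel⟩
      have hxU : P.HasLabel U x := lx.elim (fun l => Or.inl (l ▸ heU)) fun l => Or.inr (l ▸ heU)
      refine ⟨x.2, (HasLabel.mem P h hU hx hxU).2, ?_, fun y hy hyU => ?_⟩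
      · rw [lastHi_append]
        exact congrArg Prod.snd ex
      · obtain ⟨e', he', l1, l2⟩ := P.exists_mem_shifted_of_hasLabel hy hyU
        exact (P.le_of_label_le h hy hx l2 lx (hle e' he' l1.2)).2
  refine ⟨A, hA, B, hB, ?_, fun x hx hxU => ⟨hA' x hx hxU, hB' x hx hxU⟩⟩
  rw [Telescope.mergeEntry, ← eA, ← eB]

/-- The perturbed telescope has one critical value for every element `U` of the gomic, and the slice
represents the components over an interval with the same critical values as `U`. -/
theorem realises_telescope [T2Space X] : ∃ dl κ h₀ l₀ κ', P.telescope.Realises f dl h₀ κ l₀ κ' ∧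
    P.telescope.crit.Pairwise (· < ·) ∧
    (∀ e ∈ dl, ∃ U ∈ 𝓤, e.1 = (lowEnd 𝓤 U + highEnd 𝓤 U) / 2) ∧
    ∀ U ∈ 𝓤, ∃ A ∈ U, ∃ B ∈ U, ((lowEnd 𝓤 U + highEnd 𝓤 U) / 2, supBelow (range M.crit) A,
      infAbove (range M.crit) B) ∈ dl ∧ A ≤ lowEnd 𝓤 U ∧ highEnd 𝓤 U ≤ B ∧
      (∀ c ∈ range M.crit, c ∈ U → A ≤ c ∧ c ≤ B) ∧
      ∀ V ∈ 𝓤, U ≠ V → (U ∩ V).Nonempty → A ≤ P.α (U ∩ V) ∧ P.α (U ∩ V) ≤ B := by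
  obtain ⟨κ, κ', H⟩ := P.realises_shifted h
  have hmem' : ∀ x ∈ P.list', ∃ U ∈ 𝓤, x = (lowEnd 𝓤 U, highEnd 𝓤 U) := fun x hx =>
    (P.list'_spec.2 x).1 hx
  have hle : ∀ x ∈ P.list', x.1 ≤ x.2 := fun x hx => by
    obtain ⟨U, hU, rfl⟩ := hmem' x hx
    exact (h.low_lt_high U hU).le
  have H' := Telescope.Realises.mergeList (d₀ := []) (dl := P.shifted) M.continuous P.list' H ?_
    P.list'_spec.1 hle (by simp) ?_
  · rw [List.nil_append, lastHi] at H'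
    have hc := H'.map_fst
    refine ⟨_, _, _, _, _, H', ?_, ?_, ?_⟩
    · change (Telescope.mergeList _ _).crit.Pairwise _
      rw [← hc, List.pairwise_map, List.pairwise_map]
      refine P.list'_spec.1.imp_of_mem fun {x y} hx hy hxy => ?_
      have h1 := hle x hx
      have h2 := hle y hy
      change (x.1 + x.2) / 2 < (y.1 + y.2) / 2
      linarith
    · intro e he
      obtain ⟨x, hx, rfl⟩ := List.mem_map.1 he
      obtain ⟨U, hU, rfl⟩ := hmem' x hx
      exact ⟨U, hU, rfl⟩
    · intro U hU
      obtain ⟨A, hA, B, hB, e, hAB⟩ := P.exists_mergeEntry_shifted h hU (sInf ((↑) '' range M.crit))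
        (sSup ((↑) '' range M.crit))
      have hAB₀ := hAB _ (P.properInterval_mem hU) (Or.inl (P.labels_proper h hU rfl).2.1)
      refine ⟨A, hA, B, hB, ?_, hAB₀.1, hAB₀.2, ?_, ?_⟩
      · rw [← e]
        exact List.mem_map_of_mem ((P.list'_spec.2 _).2 ⟨U, hU, rfl⟩)
      · rintro _ ⟨i, rfl⟩ hi
        obtain ⟨x, hx, hxU, hix⟩ := P.exists_hasLabel h hU i hi
        have := hAB x hx hxU
        exact ⟨this.1.trans hix.1, hix.2.trans this.2⟩
      · intro V hV hUV hne
        have h1 := hAB _ (P.interInterval_mem hU hV hUV hne) (P.hasLabel_inter h hU hV hUV hne)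
        exact ⟨h1.1, ((P.inter U hU V hV hUV hne).1).trans h1.2⟩
  · rw [← H.map_fst, List.pairwise_map]
    exact P.pairwise_shifted h
  -- Every fork now lies between the ends of some proper part, so the last Merges leave no other
  -- critical values.
  · intro e he
    obtain ⟨x, hx, -, lx⟩ := P.exists_mem_shifted he
    have : ∃ U ∈ 𝓤, e.1 ∈ Icc (lowEnd 𝓤 U) (highEnd 𝓤 U) := by
      rcases P.cases_of_mem_list h hx with ⟨V, hV, rfl⟩ | ⟨V, hV, W, hW, hne, hVW, -, -, m1, m2, h1, h2⟩
      · obtain ⟨-, l1, l2⟩ := P.labels_proper h hV rfl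
        rcases lx with l | l <;> rw [l]
        · exact ⟨V, hV, l1⟩
        · exact ⟨V, hV, l2⟩
      · obtain ⟨-, l1, l2⟩ := P.labels_inter h hV hW hne hx h1 h2
        rcases lx with l | l <;> rw [l]
        · exact ⟨V, hV, l1⟩
        · exact ⟨W, hW, l2⟩
    obtain ⟨U, hU, heU⟩ := this
    exact ⟨_, (P.list'_spec.2 _).2 ⟨U, hU, rfl⟩, heU⟩

end Perturbation

/-! ### Intervals at and between the labels of a sorted decoration. -/

theorem localSet_of_mem {dl : List (ℝ × EReal × EReal)} {h l : EReal}
    (hdl : dl.Pairwise fun e e' => e.1 < e'.1) {e : ℝ × EReal × EReal} (he : e ∈ dl) :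
    localSet dl h l e.1 = realIoo e.2.1 e.2.2 := by
  obtain ⟨s, t, rfl⟩ := List.append_of_mem he
  rw [localSet_append fun e' he' => (List.pairwise_append.1 hdl).2.2 e' he' e (List.mem_cons_self ..),
    localSet, if_neg (lt_irrefl _), if_pos rfl]

theorem localSet_of_between {dl : List (ℝ × EReal × EReal)} {h l : EReal}
    (hdl : dl.Pairwise fun e e' => e.1 < e'.1) {e e' : ℝ × EReal × EReal} (he : e ∈ dl) (he' : e' ∈ dl)
    (hbet : ∀ e'' ∈ dl, ¬ (e.1 < e''.1 ∧ e''.1 < e'.1)) {t : ℝ} (h₁ : e.1 < t) (h₂ : t < e'.1) :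
    localSet dl h l t = realIoo e'.2.1 e.2.2 := by
  obtain ⟨s, r, rfl⟩ := List.append_of_mem he
  obtain ⟨hs, hr, hsr⟩ := List.pairwise_append.1 hdl
  rw [List.pairwise_cons] at hr
  have hs' := fun e' he' => hsr e' he' e (List.mem_cons_self ..)
  rw [localSet_append fun e' he' => (hs' e' he').trans h₁, localSet, if_neg h₁.not_gt, if_neg h₁.ne']
  rcases List.mem_append.1 he' with he' | he'
  · exact absurd (h₁.trans h₂) (hs' e' he').not_gt
  rcases List.mem_cons.1 he' with rfl | he'
  · exact absurd (h₁.trans h₂) (lt_irrefl _)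
  rcases r with _ | ⟨e'', r⟩
  · cases he'
  · have : e' = e'' := by
      rcases List.mem_cons.1 he' with rfl | he'
      · rfl
      · exact absurd ⟨hr.1 e'' (List.mem_cons_self ..), (List.pairwise_cons.1 hr.2).1 e' he'⟩
          (hbet e'' (by simp))
    rw [localSet, ← this, if_pos h₂]

theorem Decoration.pairwise {dl : List (ℝ × EReal × EReal)} {h l : EReal} (H : Decoration dl h l) :
    dl.Pairwise fun e e' => e.2.1 ≤ e'.2.1 ∧ e.2.2 ≤ e'.2.2 := by
  suffices (∀ e ∈ dl, firstLo dl l ≤ e.2.1 ∧ h ≤ e.2.2) ∧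
      dl.Pairwise fun e e' => e.2.1 ≤ e'.2.1 ∧ e.2.2 ≤ e'.2.2 from this.2
  induction dl generalizing h with
  | nil => simp
  | cons e dl ih =>
    obtain ⟨h1, h2, h3, h4⟩ := H
    obtain ⟨i1, i2⟩ := ih h4
    refine ⟨fun e' he' => ?_, List.pairwise_cons.2 ⟨fun e' he' => ?_, i2⟩⟩
    · rcases List.mem_cons.1 he' with rfl | he'
      · exact ⟨le_rfl, h2⟩
      · exact ⟨h3.trans (i1 e' he').1, h2.trans (i1 e' he').2⟩
    · exact ⟨h3.trans (i1 e' he').1, (i1 e' he').2⟩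

theorem Decoration.le_of_lt {dl : List (ℝ × EReal × EReal)} {h l : EReal} (H : Decoration dl h l)
    (hdl : dl.Pairwise fun e e' => e.1 < e'.1) {e e' : ℝ × EReal × EReal} (he : e ∈ dl) (he' : e' ∈ dl)
    (hlt : e.1 < e'.1) : e.2.1 ≤ e'.2.1 ∧ e.2.2 ≤ e'.2.2 := by
  have hp := H.pairwise
  obtain ⟨s, r, rfl⟩ := List.append_of_mem he
  rcases List.mem_append.1 he' with he' | he'
  · exact absurd hlt ((List.pairwise_append.1 hdl).2.2 e' he' e (List.mem_cons_self ..)).not_gt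
  rcases List.mem_cons.1 he' with rfl | he'
  · exact absurd hlt (lt_irrefl _)
  · exact (List.pairwise_cons.1 (List.pairwise_append.1 hp).2.1).1 e' he'

/-! ### Passage between intervals with the same critical values. -/

namespace MorseType

variable {X : Type u} [TopologicalSpace X] {f : X → ℝ}

/-- Two intervals with the same critical values as a smaller open interval have the same
components. -/
theorem joinedIn_congr (M : MorseType f) {J₀ J₁ J₂ : Set ℝ} (h₁ : J₀ ⊆ J₁) (h₂ : J₀ ⊆ J₂)
    (hJ₀ : IsOpen J₀) (hJ₀' : J₀.OrdConnected) (hJ₁ : J₁.OrdConnected) (hJ₂ : J₂.OrdConnected)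
    (hc₁ : ∀ i, M.crit i ∈ J₁ → M.crit i ∈ J₀) (hc₂ : ∀ i, M.crit i ∈ J₂ → M.crit i ∈ J₀) {x x' : X}
    (hx : f x ∈ J₀) (hx' : f x' ∈ J₀) : JoinedIn (f ⁻¹' J₁) x x' ↔ JoinedIn (f ⁻¹' J₂) x x' :=
  ⟨fun h => (M.joinedIn_of_crit_subset h₁ hJ₁ hJ₀ hJ₀' hc₁ hx hx' h).mono (preimage_mono h₂),
    fun h => (M.joinedIn_of_crit_subset h₂ hJ₂ hJ₀ hJ₀' hc₂ hx hx' h).mono (preimage_mono h₁)⟩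

end MorseType

namespace Telescope

variable {X : Type u} [TopologicalSpace X] {f : X → ℝ} {Y Z : TopCat.{u}} {T : Telescope Y Z}
  {dl : List (ℝ × EReal × EReal)} {h l : EReal}

/-- The points `x` and `y` represent the components of `k (rep p)` and `k (rep q)` over the common
part `J₀`. For such points it is equivalent to be joined over `S`, the interval of the telescope,
and over `S'`, the interval of the cover. -/
theorem Represents.joinedIn_iff_of_crit (M : MorseType f) {k : T.Pieces univ → X}
    (H : T.Represents f univ dl h l k) (hT : T.crit.Pairwise (· < ·)) {J J₀ S S' : Set ℝ}
    (hJ : J.OrdConnected) (hS : ⋃ t ∈ J, localSet dl h l t = S) (h₁ : J₀ ⊆ S) (h₂ : J₀ ⊆ S')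
    (hJ₀ : IsOpen J₀) (hJ₀' : J₀.OrdConnected) (hS₁ : S.OrdConnected) (hS₂ : S'.OrdConnected)
    (hc₁ : ∀ i, M.crit i ∈ S → M.crit i ∈ J₀) (hc₂ : ∀ i, M.crit i ∈ S' → M.crit i ∈ J₀)
    {p q : T.Space} (hp : T.height p ∈ J) (hq : T.height q ∈ J) {x y : X} (hx : f x ∈ J₀)
    (hy : f y ∈ J₀) (hpx : JoinedIn (f ⁻¹' S) (k (T.rep p)) x)
    (hqy : JoinedIn (f ⁻¹' S) (k (T.rep q)) y) :
    JoinedIn (T.height ⁻¹' J) p q ↔ JoinedIn (f ⁻¹' S') x y := by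
  rw [H.joinedIn_iff M.continuous hT hJ hp hq, hS,
    ← M.joinedIn_congr h₁ h₂ hJ₀ hJ₀' hS₁ hS₂ hc₁ hc₂ hx hy]
  exact ⟨fun h => (hpx.symm.trans h).trans hqy, fun h => (hpx.trans h).trans hqy.symm⟩

/-- A point over `S'` is moved into `J₀`, where the telescope represents it at height `t`; the
resulting path over `S` is exchanged for one over `S'`. -/
theorem Represents.exists_of_crit (M : MorseType f) {k : T.Pieces univ → X}
    (H : T.Represents f univ dl h l k) (hT : T.crit.Pairwise (· < ·)) {t : ℝ} {J₀ S S' : Set ℝ}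
    (hS : localSet dl h l t = S) (h₁ : J₀ ⊆ S) (h₂ : J₀ ⊆ S') (hne : J₀.Nonempty)
    (hJ₀ : IsOpen J₀) (hJ₀' : J₀.OrdConnected) (hS₁ : S.OrdConnected) (hS₂ : S'.OrdConnected)
    (hc₁ : ∀ i, M.crit i ∈ S → M.crit i ∈ J₀) (hc₂ : ∀ i, M.crit i ∈ S' → M.crit i ∈ J₀)
    {κ : T.Space → X} (hκ : ∀ p, T.height p = t → f (κ p) ∈ J₀ ∧ JoinedIn (f ⁻¹' S) (k (T.rep p)) (κ p))
    {x : X} (hx : f x ∈ S') : ∃ p, T.height p = t ∧ JoinedIn (f ⁻¹' S') (κ p) x := by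
  obtain ⟨x₀, hx₀, hxx₀⟩ := M.exists_joinedIn_of_crit_subset h₂ hS₂ hJ₀ hne hc₂ hx
  obtain ⟨p, hp, hpx⟩ := H.exists_joinedIn hT (t := t) (hS.symm ▸ h₁ hx₀ : f x₀ ∈ localSet dl h l t)
  rw [hS] at hpx
  refine ⟨p, hp, JoinedIn.trans ?_ hxx₀.symm⟩
  exact (M.joinedIn_congr h₁ h₂ hJ₀ hJ₀' hS₁ hS₂ hc₁ hc₂ (hκ p hp).1 hx₀).1
    ((hκ p hp).2.symm.trans hpx)

theorem Represents.joinedIn_rep_rep {k : T.Pieces univ → X}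
    (H : T.Represents f univ dl h l k) (hT : T.crit.Pairwise (· < ·)) (p : T.Space) :
    f (k (T.rep p)) ∈ localSet dl h l (T.height p) := by
  have := (H.joinedIn_rep hT (T.rep p)).source_mem
  rwa [T.piecesHeight_rep] at this

end Telescope

/-! ### Comparison of the multinerve Mapper with a combinatorial Reeb graph -/

/-- The map `κ` identifies the components of the parts of `B` over the critical values `m U`, and of
the parts between consecutive ones, with the components of the sets `f⁻¹(U)` and `f⁻¹(U ∩ V)`. -/
structure GraphComparison {X B : Type u} [TopologicalSpace X] [TopologicalSpace B] (f : X → ℝ)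
    (g : B → ℝ) (C : Set ℝ) (𝓤 : Set (Set ℝ)) (m : Set ℝ → ℝ) (κ : B → X) : Prop where
  image : m '' 𝓤 = C
  injOn : InjOn m 𝓤
  consecutive : ∀ U ∈ 𝓤, ∀ V ∈ 𝓤, U ≠ V → (U ∩ V).Nonempty →
    Consecutive C (m U) (m V) ∨ Consecutive C (m V) (m U)
  triple : ∀ U ∈ 𝓤, ∀ V ∈ 𝓤, ∀ W ∈ 𝓤, U ≠ V → V ≠ W → U ≠ W → ∀ z ∈ U, z ∈ V → z ∉ W
  node_iff : ∀ U ∈ 𝓤, ∀ p q, g p = m U → g q = m U →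
    (JoinedIn (g ⁻¹' {m U}) p q ↔ JoinedIn (f ⁻¹' U) (κ p) (κ q))
  node_surj : ∀ U ∈ 𝓤, ∀ x, f x ∈ U → ∃ p, g p = m U ∧ JoinedIn (f ⁻¹' U) (κ p) x
  edge_iff : ∀ U ∈ 𝓤, ∀ V ∈ 𝓤, Consecutive C (m U) (m V) → ∀ p q, g p ∈ Ioo (m U) (m V) →
    g q ∈ Ioo (m U) (m V) →
    (JoinedIn (g ⁻¹' Ioo (m U) (m V)) p q ↔ JoinedIn (f ⁻¹' (U ∩ V)) (κ p) (κ q))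
  edge_surj : ∀ U ∈ 𝓤, ∀ V ∈ 𝓤, Consecutive C (m U) (m V) → ∀ x, f x ∈ U ∩ V →
    ∃ p, g p ∈ Ioo (m U) (m V) ∧ JoinedIn (f ⁻¹' (U ∩ V)) (κ p) x
  low_iff : ∀ U ∈ 𝓤, ∀ V ∈ 𝓤, Consecutive C (m U) (m V) → ∀ p q, g p = m U →
    g q ∈ Ioo (m U) (m V) →
    (JoinedIn (g ⁻¹' Ico (m U) (m V)) p q ↔ JoinedIn (f ⁻¹' U) (κ p) (κ q))
  high_iff : ∀ U ∈ 𝓤, ∀ V ∈ 𝓤, Consecutive C (m U) (m V) → ∀ p q, g p = m V →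
    g q ∈ Ioo (m U) (m V) →
    (JoinedIn (g ⁻¹' Ioc (m U) (m V)) p q ↔ JoinedIn (f ⁻¹' V) (κ p) (κ q))

theorem pathComponentIn_eq {X : Type*} [TopologicalSpace X] {S : Set X} {x y : X}
    (h : JoinedIn S x y) : pathComponentIn S x = pathComponentIn S y := by
  ext z
  exact ⟨fun hz => h.symm.trans hz, fun hz => h.trans hz⟩

/-- Turns an edge of the multinerve, a component of the intersection of two components, into a
component of `f⁻¹(U ∩ V)`. A path from `x` in `S ∩ T` stays in both components of `x`. -/
theorem pathComponentIn_inter {X : Type*} [TopologicalSpace X] {S T : Set X} {x : X}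
    (hS : x ∈ S) (hT : x ∈ T) :
    pathComponentIn (pathComponentIn S x ∩ pathComponentIn T x) x = pathComponentIn (S ∩ T) x := by
  refine subset_antisymm
    (pathComponentIn_mono (inter_subset_inter pathComponentIn_subset pathComponentIn_subset))
    fun y hy => ?_
  have hx : x ∈ pathComponentIn (S ∩ T) x := mem_pathComponentIn_self ⟨hS, hT⟩
  exact ((isPathConnected_pathComponentIn (F := S ∩ T) ⟨hS, hT⟩).joinedIn x hx y hy).mono
    (subset_inter (pathComponentIn_mono inter_subset_left) (pathComponentIn_mono inter_subset_right))

theorem Multinerve.ext' {X : Type u} [TopologicalSpace X] {ι : Type u} {U : ι → Set X}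
    {p q : Multinerve U} (hF : p.F = q.F) (hC : p.C = q.C) : p = q := by
  cases p; cases q; cases hF; cases hC; rfl

theorem ReebArc.ext' {X : Type u} [TopologicalSpace X] {f : X → ℝ} {C : Set ℝ} {a b : ReebArc f C}
    (h₁ : a.lo = b.lo) (h₂ : a.hi = b.hi) (h₃ : a.carrier = b.carrier) : a = b := by
  cases a; cases b; cases h₁; cases h₂; cases h₃; rfl

/-! ### Nodes and edges of the multinerve of the pullback cover. -/

namespace PullbackIndex

variable {X : Type u} [TopologicalSpace X] {f : X → ℝ} {𝓤 : Set (Set ℝ)}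

/-- The component of `f⁻¹(U)` that contains `x`. -/
def ofPoint (U : Set ℝ) (hU : U ∈ 𝓤) (x : X) (hx : f x ∈ U) : PullbackIndex f 𝓤 :=
  ⟨(U, pathComponentIn (f ⁻¹' U) x), hU, x, hx, rfl⟩

theorem ofPoint_eq {U : Set ℝ} (hU : U ∈ 𝓤) {x y : X} (h : JoinedIn (f ⁻¹' U) x y) :
    (ofPoint U hU x h.source_mem : PullbackIndex f 𝓤) = ofPoint U hU y h.target_mem :=
  Subtype.ext (Prod.ext rfl (pathComponentIn_eq h))

theorem eq_ofPoint (v : PullbackIndex f 𝓤) {x : X} (hx : x ∈ v.1.2) :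
    ∃ hx', v = ofPoint v.1.1 v.2.1 x hx' := by
  obtain ⟨⟨U, C⟩, hU, y, hy, e⟩ := v
  obtain rfl : C = pathComponentIn (f ⁻¹' U) y := e
  have hyx : JoinedIn (f ⁻¹' U) y x := hx
  exact ⟨hyx.target_mem, ofPoint_eq hU hyx⟩

/-- The node of the multinerve given by an index. -/
def node (v : PullbackIndex f 𝓤) : (Multinerve.graph (pullbackCover f 𝓤)).Node :=
  ⟨⟨{v}, v.1.2, Or.inr ⟨Finset.singleton_nonempty v, by
    obtain ⟨x, hx, e⟩ := v.2.2
    have hxv : x ∈ v.1.2 := by rw [e]; exact mem_pathComponentIn_self hx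
    have e' : ⋂ i ∈ ({v} : Finset (PullbackIndex f 𝓤)), pullbackCover f 𝓤 i = v.1.2 := by
      simp [pullbackCover]
    rw [e']
    refine ⟨x, hxv, ?_⟩
    have hc : IsPathConnected v.1.2 := by rw [e]; exact isPathConnected_pathComponentIn hx
    exact subset_antisymm (fun y hy => hc.joinedIn x hxv y hy) pathComponentIn_subset⟩⟩,
    Finset.card_singleton v⟩

theorem node_injective : Function.Injective (node : PullbackIndex f 𝓤 → _) := fun _ _ h =>
  Finset.singleton_injective (congrArg (fun p => p.1.F) h)

/-- A component is path-connected and hence its own only component, so a node carries no more than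
its index. -/
theorem exists_node_eq (p : (Multinerve.graph (pullbackCover f 𝓤)).Node) :
    ∃ v, p = node v ∧ p.1.F = {v} := by
  obtain ⟨p, hp⟩ := p
  obtain ⟨v, hv⟩ := Finset.card_eq_one.1 hp
  refine ⟨v, Subtype.ext (Multinerve.ext' hv ?_), hv⟩
  rcases p.isComponent with h | ⟨-, x, hx, e⟩
  · rw [h.1] at hp; cases hp
  · have e' : ⋂ i ∈ p.F, pullbackCover f 𝓤 i = v.1.2 := by rw [hv]; simp [pullbackCover]
    rw [e'] at hx e
    rw [e]
    obtain ⟨y, hy, ey⟩ := v.2.2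
    have hc : IsPathConnected v.1.2 := by rw [ey]; exact isPathConnected_pathComponentIn hy
    exact subset_antisymm pathComponentIn_subset fun z hz => hc.joinedIn x hx z hz

theorem iInter_pair (v w : PullbackIndex f 𝓤) [DecidableEq (PullbackIndex f 𝓤)] :
    ⋂ i ∈ ({v, w} : Finset (PullbackIndex f 𝓤)), pullbackCover f 𝓤 i = v.1.2 ∩ w.1.2 := by
  ext x
  simp [pullbackCover]

open Classical in
/-- The edge of the multinerve given by a point of `f⁻¹(U ∩ V)`. -/
noncomputable def edge (U V : Set ℝ) (hU : U ∈ 𝓤) (hV : V ∈ 𝓤) (hUV : U ≠ V) (x : X)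
    (hx : f x ∈ U ∩ V) : (Multinerve.graph (pullbackCover f 𝓤)).Edge :=
  ⟨⟨{ofPoint U hU x hx.1, ofPoint V hV x hx.2}, pathComponentIn (f ⁻¹' (U ∩ V)) x,
    Or.inr ⟨Finset.insert_nonempty _ _, by
      rw [iInter_pair]
      exact ⟨x, ⟨mem_pathComponentIn_self hx.1, mem_pathComponentIn_self hx.2⟩,
        (pathComponentIn_inter (S := f ⁻¹' U) (T := f ⁻¹' V) hx.1 hx.2).symm⟩⟩⟩,
    Finset.card_pair fun h => hUV (congrArg (fun v => v.1.1) h)⟩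

theorem edge_eq {U V : Set ℝ} (hU : U ∈ 𝓤) (hV : V ∈ 𝓤) (hUV : U ≠ V) {x y : X}
    (h : JoinedIn (f ⁻¹' (U ∩ V)) x y) :
    (edge U V hU hV hUV x h.source_mem : (Multinerve.graph (pullbackCover f 𝓤)).Edge) =
      edge U V hU hV hUV y h.target_mem := by
  refine Subtype.ext (Multinerve.ext' ?_ (pathComponentIn_eq h))
  have h1 := ofPoint_eq hU (h.mono (preimage_mono inter_subset_left))
  have h2 := ofPoint_eq hV (h.mono (preimage_mono inter_subset_right))
  simp only [edge, h1, h2]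

/-- The two indices belong to different elements of the cover, since components of one `f⁻¹(U)` with
a common point coincide. Both orders are recorded, because the pair is unordered while an arc has a
lower and an upper end. -/
theorem exists_edge_eq (p : (Multinerve.graph (pullbackCover f 𝓤)).Edge) :
    ∃ U V, ∃ (hU : U ∈ 𝓤) (hV : V ∈ 𝓤) (hUV : U ≠ V), ∃ x, ∃ hx : f x ∈ U ∩ V,
      p = edge U V hU hV hUV x hx ∧ p = edge V U hV hU hUV.symm x hx.symm := by
  classical
  obtain ⟨p, hp⟩ := p
  obtain ⟨v, w, hvw, hF⟩ := Finset.card_eq_two.1 hp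
  rcases p.isComponent with h | ⟨-, x, hx, e⟩
  · rw [h.1] at hp; cases hp
  rw [hF, iInter_pair] at hx e
  obtain ⟨hxv, ev⟩ := v.eq_ofPoint hx.1
  obtain ⟨hxw, ew⟩ := w.eq_ofPoint hx.2
  have hUV : v.1.1 ≠ w.1.1 := fun h => hvw <| by
    rw [ev, ew]
    exact Subtype.ext (Prod.ext h (by change pathComponentIn _ _ = pathComponentIn _ _; rw [h]))
  have e1 : v.1.2 = pathComponentIn (f ⁻¹' v.1.1) x := congrArg (fun v => v.1.2) ev
  have e2 : w.1.2 = pathComponentIn (f ⁻¹' w.1.1) x := congrArg (fun v => v.1.2) ew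
  have e3 : p.C = pathComponentIn (f ⁻¹' (v.1.1 ∩ w.1.1)) x := by
    rw [e, e1, e2]
    exact pathComponentIn_inter (S := f ⁻¹' v.1.1) (T := f ⁻¹' w.1.1) hxv hxw
  have key : ∀ v' w' : PullbackIndex f 𝓤, ∀ (h' : v'.1.1 ≠ w'.1.1) hv' hw', v' = ofPoint v'.1.1 v'.2.1 x hv' →
      w' = ofPoint w'.1.1 w'.2.1 x hw' → p.F = {v', w'} →
      p.C = pathComponentIn (f ⁻¹' (v'.1.1 ∩ w'.1.1)) x →
      (⟨p, hp⟩ : (Multinerve.graph (pullbackCover f 𝓤)).Edge) =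
        edge v'.1.1 w'.1.1 v'.2.1 w'.2.1 h' x ⟨hv', hw'⟩ := by
    intro v' w' h' hv' hw' i1 i2 i3 i4
    refine Subtype.ext (Multinerve.ext' ?_ i4)
    change p.F = {ofPoint v'.1.1 v'.2.1 x hv', ofPoint w'.1.1 w'.2.1 x hw'}
    rw [← i1, ← i2]
    exact i3
  refine ⟨v.1.1, w.1.1, v.2.1, w.2.1, hUV, x, ⟨hxv, hxw⟩, key v w hUV hxv hxw ev ew hF e3, ?_⟩
  exact key w v hUV.symm hxw hxv ew ev (by rw [hF, Finset.pair_comm]) (by rw [e3, inter_comm])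

theorem ends_edge {U V : Set ℝ} (hU : U ∈ 𝓤) (hV : V ∈ 𝓤) (hUV : U ≠ V) {x : X}
    (hx : f x ∈ U ∩ V) : (Multinerve.graph (pullbackCover f 𝓤)).ends (edge U V hU hV hUV x hx) =
      {node (ofPoint U hU x hx.1), node (ofPoint V hV x hx.2)} := by
  classical
  ext p
  constructor
  · rintro ⟨hF, -⟩
    obtain ⟨v, rfl, hv⟩ := exists_node_eq p
    rw [hv, Finset.singleton_subset_iff] at hF
    rcases Finset.mem_insert.1 hF with rfl | hF
    · exact Or.inl rfl
    · rw [Finset.mem_singleton.1 hF]; exact Or.inr rfl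
  · rintro (rfl | rfl)
    · exact ⟨Finset.singleton_subset_iff.2 (Finset.mem_insert_self _ _),
        pathComponentIn_mono (preimage_mono inter_subset_left)⟩
    · exact ⟨Finset.singleton_subset_iff.2 (Finset.mem_insert_of_mem (Finset.mem_singleton_self _)),
        pathComponentIn_mono (preimage_mono inter_subset_right)⟩

end PullbackIndex

/-! ### The isomorphism of multigraphs. -/

namespace GraphComparison

variable {X B : Type u} [TopologicalSpace X] [TopologicalSpace B] {f : X → ℝ} {g : B → ℝ}
  {C : Set ℝ} {𝓤 : Set (Set ℝ)} {m : Set ℝ → ℝ} {κ : B → X}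

/-- Three indices with a common point would belong to three different elements of the cover, and
these do not meet. -/
theorem card_le_two (H : GraphComparison f g C 𝓤 m κ) (p : MultiNerveMapper f 𝓤) :
    p.F.card ≤ 2 := by
  by_contra! hp
  obtain ⟨u, v, w, hu, hv, hw, huv, huw, hvw⟩ := Finset.two_lt_card_iff.1 hp
  rcases p.isComponent with h | ⟨-, x, hx, e⟩
  · rw [h.1] at hp; simp at hp
  have hmem : ∀ i ∈ p.F, x ∈ i.1.2 := fun i hi => mem_iInter₂.1 hx i hi
  obtain ⟨xu, eu⟩ := u.eq_ofPoint (hmem u hu)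
  obtain ⟨xv, ev⟩ := v.eq_ofPoint (hmem v hv)
  obtain ⟨xw, ew⟩ := w.eq_ofPoint (hmem w hw)
  have hne : ∀ i j : PullbackIndex f 𝓤, ∀ hi hj, i = .ofPoint i.1.1 i.2.1 x hi →
      j = .ofPoint j.1.1 j.2.1 x hj → i ≠ j → i.1.1 ≠ j.1.1 := by
    intro i j hi hj ei ej hij h
    apply hij
    rw [ei, ej]
    exact Subtype.ext (Prod.ext h (by change pathComponentIn _ _ = pathComponentIn _ _; rw [h]))
  exact H.triple _ u.2.1 _ v.2.1 _ w.2.1 (hne u v xu xv eu ev huv) (hne v w xv xw ev ew hvw)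
    (hne u w xu xw eu ew huw) (f x) xu xv xw

theorem node_mem (H : GraphComparison f g C 𝓤 m κ) {U : Set ℝ} (hU : U ∈ 𝓤) {p : B}
    (hp : g p = m U) : f (κ p) ∈ U :=
  ((H.node_iff U hU p p hp hp).1 (JoinedIn.refl hp)).source_mem

theorem edge_mem (H : GraphComparison f g C 𝓤 m κ) {U V : Set ℝ} (hU : U ∈ 𝓤) (hV : V ∈ 𝓤)
    (hc : Consecutive C (m U) (m V)) {p : B} (hp : g p ∈ Ioo (m U) (m V)) : f (κ p) ∈ U ∩ V :=
  ((H.edge_iff U hU V hV hc p p hp hp).1 (JoinedIn.refl hp)).source_mem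

/-- A node over `m U` goes to the component of `f⁻¹(U)` that contains its image under `κ`. The
formula is kept for every representative, as the ends of arcs are given by arbitrary ones. -/
theorem exists_nodeEquiv (H : GraphComparison f g C 𝓤 m κ) :
    ∃ N : (combReeb g C).Node ≃ (Multinerve.graph (pullbackCover f 𝓤)).Node,
      ∀ (r : (combReeb g C).Node) p U, Quotient.mk (reebSetoid g) p = r.1 → ∀ (hU : U ∈ 𝓤)
        (hp : g p = m U), N r = PullbackIndex.node (.ofPoint U hU (κ p) (H.node_mem hU hp)) := by
  have hex : ∀ r : (combReeb g C).Node, ∃ p U, Quotient.mk (reebSetoid g) p = r.1 ∧ U ∈ 𝓤 ∧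
      g p = m U := by
    rintro ⟨r, hr⟩
    obtain ⟨p, rfl⟩ := Quotient.exists_rep r
    have : g p ∈ C := hr
    rw [← H.image] at this
    obtain ⟨U, hU, e⟩ := this
    exact ⟨p, U, rfl, hU, e.symm⟩
  choose p U hp hU hpU using hex
  let N : (combReeb g C).Node → (Multinerve.graph (pullbackCover f 𝓤)).Node := fun r =>
    PullbackIndex.node (.ofPoint (U r) (hU r) (κ (p r)) (H.node_mem (hU r) (hpU r)))
  have hN : ∀ (r : (combReeb g C).Node) p' U', Quotient.mk (reebSetoid g) p' = r.1 →
      ∀ (hU' : U' ∈ 𝓤) (hp' : g p' = m U'),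
      N r = PullbackIndex.node (.ofPoint U' hU' (κ p') (H.node_mem hU' hp')) := by
    intro r p' U' e hU' hp'
    obtain ⟨h1, h2⟩ : g (p r) = g p' ∧ JoinedIn (g ⁻¹' {g (p r)}) (p r) p' :=
      Quotient.exact ((hp r).trans e.symm)
    have hUU : U r = U' := H.injOn (hU r) hU' (by rw [← hpU, h1, hp'])
    subst hUU
    rw [hpU] at h2
    exact congrArg PullbackIndex.node (PullbackIndex.ofPoint_eq _ ((H.node_iff _ hU' _ _ (hpU r) hp').1 h2))
  refine ⟨Equiv.ofBijective N ⟨fun r r' h => ?_, fun v => ?_⟩, hN⟩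
  · have h' := PullbackIndex.node_injective h
    have h1 : U r = U r' := congrArg (fun v => v.1.1) h'
    have h2 : pathComponentIn (f ⁻¹' U r) (κ (p r)) = pathComponentIn (f ⁻¹' U r') (κ (p r')) :=
      congrArg (fun v => v.1.2) h'
    have hpr' : g (p r') = m (U r) := by rw [h1]; exact hpU r'
    have h3 : JoinedIn (f ⁻¹' U r) (κ (p r)) (κ (p r')) := by
      have : κ (p r') ∈ pathComponentIn (f ⁻¹' U r) (κ (p r)) := by
        rw [h2]; exact mem_pathComponentIn_self (H.node_mem (hU r') (hpU r'))
      exact this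
    have h4 := (H.node_iff _ (hU r) _ _ (hpU r) hpr').2 h3
    refine Subtype.ext ?_
    rw [← hp r, ← hp r']
    exact Quotient.sound ⟨(hpU r).trans hpr'.symm, by rw [hpU r]; exact h4⟩
  · obtain ⟨v, rfl, -⟩ := PullbackIndex.exists_node_eq v
    obtain ⟨x, hx, e⟩ := v.2.2
    obtain ⟨hx', e'⟩ := v.eq_ofPoint (x := x) (by rw [e]; exact mem_pathComponentIn_self hx)
    obtain ⟨q, hq, hqx⟩ := H.node_surj v.1.1 v.2.1 x hx
    refine ⟨⟨Quotient.mk _ q, ?_⟩, ?_⟩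
    · change g q ∈ C
      rw [← H.image, hq]
      exact mem_image_of_mem _ v.2.1
    · refine (hN _ q v.1.1 rfl v.2.1 hq).trans (congrArg PullbackIndex.node ?_)
      rw [PullbackIndex.ofPoint_eq v.2.1 hqx]
      exact e'.symm

/-- The ends of an arc determine `U` and `V`, and the arc goes to the component of `f⁻¹(U ∩ V)`
through `κ q`. If `U` and `V` are disjoint, `edge_mem` excludes arcs between their critical values.
-/
theorem exists_edgeEquiv (H : GraphComparison f g C 𝓤 m κ) :
    ∃ N : (combReeb g C).Edge ≃ (Multinerve.graph (pullbackCover f 𝓤)).Edge,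
      ∀ e : ReebArc g C, ∃ U V, ∃ (hU : U ∈ 𝓤) (hV : V ∈ 𝓤) (hUV : U ≠ V),
        ∃ q, ∃ hx : f (κ q) ∈ U ∩ V, e.lo = m U ∧ e.hi = m V ∧
        e.carrier = pathComponentIn (g ⁻¹' Ioo (m U) (m V)) q ∧ g q ∈ Ioo (m U) (m V) ∧
        N e = PullbackIndex.edge U V hU hV hUV (κ q) hx := by
  have hex : ∀ e : ReebArc g C, ∃ U V q, U ∈ 𝓤 ∧ V ∈ 𝓤 ∧ U ≠ V ∧ e.lo = m U ∧ e.hi = m V ∧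
      e.carrier = pathComponentIn (g ⁻¹' Ioo (m U) (m V)) q ∧ g q ∈ Ioo (m U) (m V) ∧
      f (κ q) ∈ U ∩ V := by
    rintro ⟨lo, hi, hc, D, q, hq, rfl⟩
    obtain ⟨U, hU, rfl⟩ := H.image.symm ▸ hc.1
    obtain ⟨V, hV, rfl⟩ := H.image.symm ▸ hc.2.1
    exact ⟨U, V, q, hU, hV, fun e => hc.2.2.1.ne (by rw [e]), rfl, rfl, rfl, hq,
      H.edge_mem hU hV hc hq⟩
  choose U V q hU hV hUV hlo hhi hcar hq hx using hex
  have hcons : ∀ e, Consecutive C (m (U e)) (m (V e)) := fun e => hlo e ▸ hhi e ▸ e.consecutive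
  let N : (combReeb g C).Edge → (Multinerve.graph (pullbackCover f 𝓤)).Edge := fun e =>
    PullbackIndex.edge (U e) (V e) (hU e) (hV e) (hUV e) (κ (q e)) (hx e)
  -- A point of `U ∩ V` lies in no third element, and the order of the critical values tells which
  -- of the two is the lower one.
  have huniq : ∀ (e : ReebArc g C) U' V', U' ∈ 𝓤 → V' ∈ 𝓤 → m U' < m V' → ∀ z, z ∈ U e ∩ V e →
      z ∈ U' ∩ V' → U e = U' ∧ V e = V' := by
    intro e U' V' hU' hV' hlt z hz hz'
    have hlt' := (hcons e).2.2.1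
    have a : U' = U e ∨ U' = V e := by
      by_contra! hne
      exact H.triple _ (hU e) _ (hV e) _ hU' (hUV e) hne.2.symm hne.1.symm z hz.1 hz.2 hz'.1
    have b : V' = U e ∨ V' = V e := by
      by_contra! hne
      exact H.triple _ (hU e) _ (hV e) _ hV' (hUV e) hne.2.symm hne.1.symm z hz.1 hz.2 hz'.2
    rcases a with rfl | rfl <;> rcases b with rfl | rfl
    · exact absurd hlt (lt_irrefl _)
    · exact ⟨rfl, rfl⟩
    · exact absurd hlt hlt'.not_gt
    · exact absurd hlt (lt_irrefl _)
  refine ⟨Equiv.ofBijective N ⟨fun e e' h => ?_, fun p => ?_⟩, fun e =>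
    ⟨U e, V e, hU e, hV e, hUV e, q e, hx e, hlo e, hhi e, hcar e, hq e, rfl⟩⟩
  · have h2 : pathComponentIn (f ⁻¹' (U e ∩ V e)) (κ (q e)) =
        pathComponentIn (f ⁻¹' (U e' ∩ V e')) (κ (q e')) := congrArg (fun p => p.1.C) h
    have h3 : JoinedIn (f ⁻¹' (U e ∩ V e)) (κ (q e)) (κ (q e')) := by
      have : κ (q e') ∈ pathComponentIn (f ⁻¹' (U e ∩ V e)) (κ (q e)) := by
        rw [h2]; exact mem_pathComponentIn_self (hx e')
      exact this
    obtain ⟨a, b⟩ := huniq e _ _ (hU e') (hV e') (hcons e').2.2.1 _ h3.target_mem (hx e')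
    have hq' := hq e'
    rw [← a, ← b] at hq'
    have h4 := (H.edge_iff _ (hU e) _ (hV e) (hcons e) _ _ (hq e) hq').2 h3
    refine ReebArc.ext' ((hlo e).trans ((congrArg m a).trans (hlo e').symm))
      ((hhi e).trans ((congrArg m b).trans (hhi e').symm)) ((hcar e).trans (Eq.trans ?_ (hcar e').symm))
    rw [← a, ← b]
    exact pathComponentIn_eq h4
  · have key : ∀ U' V' (hU' : U' ∈ 𝓤) (hV' : V' ∈ 𝓤) (hUV' : U' ≠ V') x (hx' : f x ∈ U' ∩ V'),
        Consecutive C (m U') (m V') → p = PullbackIndex.edge U' V' hU' hV' hUV' x hx' → ∃ e, N e = p := by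
      intro U' V' hU' hV' hUV' x hx' hc hp
      obtain ⟨r, hr, hrx⟩ := H.edge_surj U' hU' V' hV' hc x hx'
      let e : ReebArc g C := ⟨m U', m V', hc, pathComponentIn (g ⁻¹' Ioo (m U') (m V')) r, r, hr, rfl⟩
      have a : U' = U e := H.injOn hU' (hU e) (hlo e)
      have b : V' = V e := H.injOn hV' (hV e) (hhi e)
      refine ⟨e, ?_⟩
      rw [hp]
      have h1 : JoinedIn (g ⁻¹' Ioo (m U') (m V')) (q e) r := by
        have hqe := hq e
        rw [← a, ← b] at hqe
        have : q e ∈ pathComponentIn (g ⁻¹' Ioo (m U') (m V')) r := by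
          have h2 : pathComponentIn (g ⁻¹' Ioo (m U') (m V')) r = _ := hcar e
          rw [h2, ← a, ← b]
          exact mem_pathComponentIn_self hqe
        exact JoinedIn.symm this
      have h2 := (H.edge_iff U' hU' V' hV' hc _ _ h1.source_mem h1.target_mem).1 h1
      have h3 := PullbackIndex.edge_eq (𝓤 := 𝓤) hU' hV' hUV' (h2.trans hrx)
      rw [← h3]
      simp only [N, ← a, ← b]
    obtain ⟨U', V', hU', hV', hUV', x, hx', e1, e2⟩ := PullbackIndex.exists_edge_eq p
    rcases H.consecutive U' hU' V' hV' hUV' ⟨_, hx'⟩ with hc | hc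
    · exact key _ _ _ _ _ _ _ hc e1
    · exact key _ _ _ _ _ _ _ hc e2

/-- By `low_iff` and `high_iff` the lower end of an arc is the component of `f⁻¹(U)`, and the upper
end that of `f⁻¹(V)`, which contains the corresponding component of `f⁻¹(U ∩ V)`. This is the face
relation of the multinerve. -/
theorem nonempty_iso (H : GraphComparison f g C 𝓤 m κ) :
    Nonempty (Multigraph.Iso (Multinerve.graph (pullbackCover f 𝓤)) (combReeb g C)) := by
  obtain ⟨N, hN⟩ := H.exists_nodeEquiv
  obtain ⟨E, hE⟩ := H.exists_edgeEquiv
  have key : ∀ e : (combReeb g C).Edge,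
      (Multinerve.graph (pullbackCover f 𝓤)).ends (E e) = N '' (combReeb g C).ends e := by
    intro e
    obtain ⟨U, V, hU, hV, hUV, q, hx, hlo, hhi, hcar, hq, hEe⟩ := hE e
    have hc : Consecutive C (m U) (m V) := hlo ▸ hhi ▸ ReebArc.consecutive e
    rw [hEe, PullbackIndex.ends_edge]
    ext v
    constructor
    · rintro (rfl | rfl)
      · obtain ⟨p, hp, hpq⟩ := H.node_surj U hU _ hx.1
        refine ⟨⟨Quotient.mk _ p, ?_⟩, ⟨p, rfl, q, ?_, Or.inl ⟨hp.trans hlo.symm, ?_⟩⟩, ?_⟩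
        · change g p ∈ C; rw [hp]; exact hc.1
        · rw [hcar]; exact mem_pathComponentIn_self hq
        · rw [hlo, hhi]; exact (H.low_iff U hU V hV hc p q hp hq).2 hpq
        · exact (hN _ p U rfl hU hp).trans (congrArg PullbackIndex.node (PullbackIndex.ofPoint_eq hU hpq))
      · obtain ⟨p, hp, hpq⟩ := H.node_surj V hV _ hx.2
        refine ⟨⟨Quotient.mk _ p, ?_⟩, ⟨p, rfl, q, ?_, Or.inr ⟨hp.trans hhi.symm, ?_⟩⟩, ?_⟩
        · change g p ∈ C; rw [hp]; exact hc.2.1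
        · rw [hcar]; exact mem_pathComponentIn_self hq
        · rw [hlo, hhi]; exact (H.high_iff U hU V hV hc p q hp hq).2 hpq
        · exact (hN _ p V rfl hV hp).trans (congrArg PullbackIndex.node (PullbackIndex.ofPoint_eq hV hpq))
    · rintro ⟨r, ⟨p, hpr, y, hy, hor⟩, rfl⟩
      rw [hcar] at hy
      have hqy : JoinedIn (g ⁻¹' Ioo (m U) (m V)) q y := hy
      have hk := (H.edge_iff U hU V hV hc q y hq hqy.target_mem).1 hqy
      rcases hor with ⟨hp, hj⟩ | ⟨hp, hj⟩
      · rw [hlo] at hp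
        rw [hlo, hhi] at hj
        have h1 := (H.low_iff U hU V hV hc p y hp hqy.target_mem).1 hj
        left
        rw [hN r p U hpr hU hp,
          PullbackIndex.ofPoint_eq hU (h1.trans (hk.mono (preimage_mono inter_subset_left)).symm)]
      · rw [hhi] at hp
        rw [hlo, hhi] at hj
        have h1 := (H.high_iff U hU V hV hc p y hp hqy.target_mem).1 hj
        right
        rw [mem_singleton_iff, hN r p V hpr hV hp,
          PullbackIndex.ofPoint_eq hV (h1.trans (hk.mono (preimage_mono inter_subset_right)).symm)]
  refine ⟨⟨N.symm, E.symm, fun e => ?_⟩⟩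
  have := key (E.symm e)
  rw [Equiv.apply_symm_apply] at this
  rw [this, ← image_comp]
  simp

end GraphComparison

/-! ### The comparison for the perturbed telescope. -/

theorem Consecutive.unique {C : Set ℝ} {a b a' b' t : ℝ} (h : Consecutive C a b)
    (h' : Consecutive C a' b') (ht : t ∈ Ioo a b) (ht' : t ∈ Ioo a' b') : a = a' ∧ b = b' := by
  obtain ⟨h1, h2, -, h3⟩ := h
  obtain ⟨i1, i2, -, i3⟩ := h'
  refine ⟨le_antisymm (not_lt.1 fun hlt => ?_) (not_lt.1 fun hlt => ?_),
    le_antisymm (not_lt.1 fun hlt => ?_) (not_lt.1 fun hlt => ?_)⟩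
  · exact i3 a h1 ⟨hlt, ht.1.trans ht'.2⟩
  · exact h3 a' i1 ⟨hlt, ht'.1.trans ht.2⟩
  · exact h3 b' i2 ⟨ht.1.trans ht'.2, hlt⟩
  · exact i3 b h2 ⟨ht'.1.trans ht.2, hlt⟩

namespace OrderedCover

variable {Z : Set ℝ} {𝓤 : Set (Set ℝ)} (h : OrderedCover Z 𝓤) {U V : Set ℝ}
include h

theorem mid_lt_iff (hU : U ∈ 𝓤) (hV : V ∈ 𝓤) :
    (lowEnd 𝓤 U + highEnd 𝓤 U) / 2 < (lowEnd 𝓤 V + highEnd 𝓤 V) / 2 ↔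
      highEnd 𝓤 U < lowEnd 𝓤 V := by
  have h1 := h.low_lt_high U hU
  have h2 := h.low_lt_high V hV
  refine ⟨fun hlt => ?_, fun hlt => by linarith⟩
  have hne : U ≠ V := by rintro rfl; exact lt_irrefl _ hlt
  exact (h.ordered U hU V hV hne).resolve_right fun h' => by linarith

theorem mid_injOn : InjOn (fun U => (lowEnd 𝓤 U + highEnd 𝓤 U) / 2) 𝓤 := fun U hU V hV e => by
  by_contra hne
  rcases h.ordered U hU V hV hne with a | a
  · exact ((h.mid_lt_iff hU hV).2 a).ne e
  · exact ((h.mid_lt_iff hV hU).2 a).ne' e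

theorem consecutive_mid_iff (hU : U ∈ 𝓤) (hV : V ∈ 𝓤) :
    Consecutive ((fun U => (lowEnd 𝓤 U + highEnd 𝓤 U) / 2) '' 𝓤)
      ((lowEnd 𝓤 U + highEnd 𝓤 U) / 2) ((lowEnd 𝓤 V + highEnd 𝓤 V) / 2) ↔
      highEnd 𝓤 U < lowEnd 𝓤 V ∧
        ∀ W ∈ 𝓤, highEnd 𝓤 U < lowEnd 𝓤 W → highEnd 𝓤 W < lowEnd 𝓤 V → False := by
  constructor
  · rintro ⟨-, -, h1, h2⟩
    exact ⟨(h.mid_lt_iff hU hV).1 h1, fun W hW a b => h2 _ ⟨W, hW, rfl⟩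
      ⟨(h.mid_lt_iff hU hW).2 a, (h.mid_lt_iff hW hV).2 b⟩⟩
  · rintro ⟨h1, h2⟩
    refine ⟨⟨U, hU, rfl⟩, ⟨V, hV, rfl⟩, (h.mid_lt_iff hU hV).2 h1, ?_⟩
    rintro _ ⟨W, hW, rfl⟩ ⟨a, b⟩
    exact h2 W hW ((h.mid_lt_iff hU hW).1 a) ((h.mid_lt_iff hW hV).1 b)

end OrderedCover

/-- The interval `D U` of a slice and the hull of `U` have the same critical values, and so have the
interval `E U V` of a cylinder and the intersection of two hulls. With the open common parts `N U`
and `F U V` every comparison becomes one of intervals with the same critical values; `κ` moves the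
image of a point into the common part. -/
theorem Perturbation.exists_comparison {X : Type u} [TopologicalSpace X] [T2Space X] {f : X → ℝ}
    {M : MorseType f} {𝓤 : Set (Set ℝ)} (P : Perturbation M 𝓤) (h : OrderedCover (range f) 𝓤) :
    ∃ κ, GraphComparison f P.telescope.height {c | c ∈ P.telescope.crit} 𝓤
      (fun U => (lowEnd 𝓤 U + highEnd 𝓤 U) / 2) κ := by
  obtain ⟨dl, κ₁, h₀, l₀, κ', H, hT, hdl₁, hdl₂⟩ := P.realises_telescope h
  obtain ⟨k, hk, -⟩ := H.exists_represents univ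
  have hmap := H.map_fst
  have hsort : dl.Pairwise fun e e' => e.1 < e'.1 := by rw [← hmap, List.pairwise_map] at hT; exact hT
  choose! A hA B hB hmem hAl hBh hcrit hα using hdl₂
  have hC : (fun U => (lowEnd 𝓤 U + highEnd 𝓤 U) / 2) '' 𝓤 = {c | c ∈ P.telescope.crit} := by
    ext c
    constructor
    · rintro ⟨U, hU, rfl⟩
      change _ ∈ P.telescope.crit
      rw [← hmap]
      exact List.mem_map_of_mem (hmem U hU)
    · intro hc
      have hc' : c ∈ P.telescope.crit := hc
      rw [← hmap] at hc'
      obtain ⟨e, he, rfl⟩ := List.mem_map.1 hc'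
      obtain ⟨U, hU, e⟩ := hdl₁ e he
      exact ⟨U, hU, e.symm⟩
  rw [← hC]
  set m : Set ℝ → ℝ := fun U => (lowEnd 𝓤 U + highEnd 𝓤 U) / 2 with hm
  set K := range M.crit with hK
  have hKf : K.Finite := finite_range _
  let D : Set ℝ → Set ℝ := fun U => realIoo (supBelow K (A U)) (infAbove K (B U))
  let E : Set ℝ → Set ℝ → Set ℝ := fun U V => realIoo (supBelow K (A V)) (infAbove K (B U))
  have hcons : ∀ U ∈ 𝓤, ∀ V ∈ 𝓤, Consecutive (m '' 𝓤) (m U) (m V) → highEnd 𝓤 U < lowEnd 𝓤 V ∧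
      ∀ W ∈ 𝓤, highEnd 𝓤 U < lowEnd 𝓤 W → highEnd 𝓤 W < lowEnd 𝓤 V → False :=
    fun U hU V hV => (h.consecutive_mid_iff hU hV).1
  have hlsD : ∀ U ∈ 𝓤, localSet dl h₀ l₀ (m U) = D U := fun U hU =>
    localSet_of_mem hsort (hmem U hU)
  have hlsE : ∀ U ∈ 𝓤, ∀ V ∈ 𝓤, Consecutive (m '' 𝓤) (m U) (m V) → ∀ t ∈ Ioo (m U) (m V),
      localSet dl h₀ l₀ t = E U V := fun U hU V hV hc t ht => by
    refine localSet_of_between hsort (hmem U hU) (hmem V hV) (fun e he => ?_) ht.1 ht.2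
    obtain ⟨W, hW, e'⟩ := hdl₁ e he
    rw [e']
    exact hc.2.2.2 _ ⟨W, hW, rfl⟩
  have hED : ∀ U ∈ 𝓤, ∀ V ∈ 𝓤, Consecutive (m '' 𝓤) (m U) (m V) → E U V ⊆ D U ∧ E U V ⊆ D V :=
    fun U hU V hV hc => by
      have := H.decoration.le_of_lt hsort (hmem U hU) (hmem V hV) hc.2.2.1
      exact ⟨realIoo_subset this.1 le_rfl, realIoo_subset le_rfl this.2⟩
  have hmemD : ∀ U, ∀ t, A U ≤ t → t ≤ B U → t ∈ D U := fun U t h1 h2 =>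
    (mem_realIoo_supBelow hKf).2 ⟨fun c _ hc => hc.trans_le h1, fun c _ hc => h2.trans_lt hc⟩
  have hDU : ∀ U ∈ 𝓤, ∀ i, M.crit i ∈ D U ↔ M.crit i ∈ U := fun U hU i => by
    constructor
    · intro hi
      have hi' := (mem_realIoo_supBelow hKf).1 hi
      exact h.interval U hU _ (hA U hU) _ (hB U hU) _ (M.crit_mem i)
        (not_lt.1 fun hlt => lt_irrefl _ (hi'.1 _ ⟨i, rfl⟩ hlt))
        (not_lt.1 fun hlt => lt_irrefl _ (hi'.2 _ ⟨i, rfl⟩ hlt))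
    · intro hi
      have := hcrit U hU _ ⟨i, rfl⟩ hi
      exact hmemD U _ this.1 this.2
  have hhull : ∀ U ∈ 𝓤, ∀ i, M.crit i ∈ OrderedCover.hull 𝓤 U ↔ M.crit i ∈ U := fun U hU i =>
    h.mem_hull_iff hU (M.crit_mem i)
  have hf : ∀ U ∈ 𝓤, f ⁻¹' U = f ⁻¹' OrderedCover.hull 𝓤 U := fun U hU => by
    ext x; exact (h.mem_hull_iff hU ⟨x, rfl⟩).symm
  have hlowD : ∀ U ∈ 𝓤, lowEnd 𝓤 U ∈ D U := fun U hU =>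
    hmemD U _ (hAl U hU) ((h.low_lt_high U hU).le.trans (hBh U hU))
  -- the common part of the two intervals for a node
  let N : Set ℝ → Set ℝ := fun U => D U ∩ OrderedCover.hull 𝓤 U
  have hNo : ∀ U, IsOpen (N U) := fun U => (isOpen_realIoo _ _).inter (h.isOpen_hull U)
  have hNc : ∀ U, (N U).OrdConnected := fun U =>
    (ordConnected_realIoo _ _).inter (OrderedCover.ordConnected_hull _ _)
  have hNn : ∀ U ∈ 𝓤, (N U).Nonempty := fun U hU => ⟨_, hlowD U hU,
    (h.mem_hull_iff hU (h.subset U hU (h.low_mem U hU))).2 (h.low_mem U hU)⟩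
  have hN₁ : ∀ U ∈ 𝓤, ∀ i, M.crit i ∈ D U → M.crit i ∈ N U := fun U hU i hi =>
    ⟨hi, (hhull U hU i).2 ((hDU U hU i).1 hi)⟩
  have hN₂ : ∀ U ∈ 𝓤, ∀ i, M.crit i ∈ OrderedCover.hull 𝓤 U → M.crit i ∈ N U := fun U hU i hi =>
    ⟨(hDU U hU i).2 ((hhull U hU i).1 hi), hi⟩
  -- the common part of the two intervals for an edge
  let F : Set ℝ → Set ℝ → Set ℝ := fun U V =>
    E U V ∩ (OrderedCover.hull 𝓤 U ∩ OrderedCover.hull 𝓤 V)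
  have hFo : ∀ U V, IsOpen (F U V) := fun U V =>
    (isOpen_realIoo _ _).inter ((h.isOpen_hull U).inter (h.isOpen_hull V))
  have hhh : ∀ U V, (OrderedCover.hull 𝓤 U ∩ OrderedCover.hull 𝓤 V).OrdConnected := fun U V =>
    (OrderedCover.ordConnected_hull _ _).inter (OrderedCover.ordConnected_hull _ _)
  have hFc : ∀ U V, (F U V).OrdConnected := fun U V => (ordConnected_realIoo _ _).inter (hhh U V)
  have hFn : ∀ U ∈ 𝓤, ∀ V ∈ 𝓤, Consecutive (m '' 𝓤) (m U) (m V) → (F U V).Nonempty := by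
    intro U hU V hV hc
    obtain ⟨hlt, hbet⟩ := hcons U hU V hV hc
    -- The chosen point `α (U ∩ V)` lies in both intervals. If consecutive elements do not meet, `f`
    -- has no value between their proper parts, and any number there will do.
    by_cases hne : (U ∩ V).Nonempty
    · have hUV := h.ne_of_lt hU hlt
      obtain ⟨-, ha, -, -⟩ := P.inter U hU V hV hUV hne
      have ha' := h.lt_of_mem_inter hU hV hlt ha
      have a1 := hα U hU V hV hUV hne
      have a2 := hα V hV U hU hUV.symm (inter_comm U V ▸ hne)
      rw [inter_comm] at a2
      exact ⟨P.α (U ∩ V), realIoo_inter (hmemD V _ a2.1 a2.2) (hmemD U _ a1.1 a1.2),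
        h.Ioo_subset_hull hU hV hbet ha'⟩
    · obtain ⟨t, ht1, ht2⟩ := exists_between hlt
      have hnone : ∀ z ∈ range f, highEnd 𝓤 U < z → z < lowEnd 𝓤 V → False := fun z hz h1 h2 =>
        hne ⟨z, h.mem_inter_of_mem_Ioo hU hV hbet hz h1 h2⟩
      refine ⟨t, (mem_realIoo_supBelow hKf).2 ⟨?_, ?_⟩, h.Ioo_subset_hull hU hV hbet ⟨ht1, ht2⟩⟩
      · rintro _ ⟨i, rfl⟩ hi
        by_contra hle
        exact hnone _ (M.crit_mem i) (ht1.trans_le (not_lt.1 hle)) (hi.trans_le (hAl V hV))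
      · rintro _ ⟨i, rfl⟩ hi
        by_contra hle
        exact hnone _ (M.crit_mem i) ((hBh U hU).trans_lt hi) ((not_lt.1 hle).trans_lt ht2)
  have hF₁ : ∀ U ∈ 𝓤, ∀ V ∈ 𝓤, Consecutive (m '' 𝓤) (m U) (m V) → ∀ i, M.crit i ∈ E U V →
      M.crit i ∈ F U V := fun U hU V hV hc i hi =>
    ⟨hi, (hN₁ U hU i ((hED U hU V hV hc).1 hi)).2, (hN₁ V hV i ((hED U hU V hV hc).2 hi)).2⟩
  have hF₂ : ∀ U ∈ 𝓤, ∀ V ∈ 𝓤, ∀ i, M.crit i ∈ OrderedCover.hull 𝓤 U ∩ OrderedCover.hull 𝓤 V →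
      M.crit i ∈ F U V := fun U hU V hV i hi =>
    ⟨realIoo_inter (hN₂ V hV i hi.2).1 (hN₂ U hU i hi.1).1, hi⟩
  have hex : ∀ p : P.telescope.Space, ∃ x, (∀ U ∈ 𝓤, P.telescope.height p = m U → f x ∈ N U ∧
      JoinedIn (f ⁻¹' D U) (k (P.telescope.rep p)) x) ∧ ∀ U ∈ 𝓤, ∀ V ∈ 𝓤, Consecutive (m '' 𝓤) (m U) (m V) →
      P.telescope.height p ∈ Ioo (m U) (m V) → f x ∈ F U V ∧ JoinedIn (f ⁻¹' E U V) (k (P.telescope.rep p)) x := by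
    intro p
    have hp := hk.joinedIn_rep_rep hT p
    by_cases hp₁ : ∃ U ∈ 𝓤, P.telescope.height p = m U
    · obtain ⟨U, hU, hpU⟩ := hp₁
      rw [hpU, hlsD U hU] at hp
      obtain ⟨x, hx, hpx⟩ := M.exists_joinedIn_of_crit_subset inter_subset_left
        (ordConnected_realIoo _ _) (hNo U) (hNn U hU) (hN₁ U hU) hp
      refine ⟨x, fun U' hU' hpU' => ?_, fun U' hU' V' hV' hc ht => ?_⟩
      · obtain rfl : U = U' := h.mid_injOn hU hU' (hpU.symm.trans hpU')
        exact ⟨hx, hpx⟩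
      · exact absurd ht (by rw [hpU]; exact hc.2.2.2 _ ⟨U, hU, rfl⟩)
    · by_cases hp₂ : ∃ U ∈ 𝓤, ∃ V ∈ 𝓤, Consecutive (m '' 𝓤) (m U) (m V) ∧
        P.telescope.height p ∈ Ioo (m U) (m V)
      · obtain ⟨U, hU, V, hV, hc, hpUV⟩ := hp₂
        rw [hlsE U hU V hV hc _ hpUV] at hp
        obtain ⟨x, hx, hpx⟩ := M.exists_joinedIn_of_crit_subset inter_subset_left
          (ordConnected_realIoo _ _) (hFo U V) (hFn U hU V hV hc) (hF₁ U hU V hV hc) hp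
        refine ⟨x, fun U' hU' hpU' => absurd ⟨U', hU', hpU'⟩ hp₁, fun U' hU' V' hV' hc' ht => ?_⟩
        obtain ⟨e1, e2⟩ := hc.unique hc' hpUV ht
        obtain rfl : U = U' := h.mid_injOn hU hU' e1
        obtain rfl : V = V' := h.mid_injOn hV hV' e2
        exact ⟨hx, hpx⟩
      -- Heights below all critical values or above all of them take no part in the graphs, so the
      -- value is arbitrary.
      · exact ⟨k (P.telescope.rep p), fun U hU hp => absurd ⟨U, hU, hp⟩ hp₁, fun U hU V hV hc ht =>
          absurd ⟨U, hU, V, hV, hc, ht⟩ hp₂⟩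
  choose κ hκN hκE using hex
  -- Over `[m U, m V)` only `D U` and its subset `E U V` occur, so this part of the telescope has
  -- the same components as the slice at `m U`. This will identify the lower end of an arc.
  have hIco : ∀ U ∈ 𝓤, ∀ V ∈ 𝓤, Consecutive (m '' 𝓤) (m U) (m V) →
      ⋃ t ∈ Ico (m U) (m V), localSet dl h₀ l₀ t = D U := fun U hU V hV hc => by
    refine subset_antisymm (iUnion₂_subset fun t ht => ?_) fun x hx =>
      mem_iUnion₂.2 ⟨m U, ⟨le_rfl, hc.2.2.1⟩, (hlsD U hU).symm ▸ hx⟩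
    rcases ht.1.eq_or_lt with rfl | hlt
    · exact (hlsD U hU).subset
    · rw [hlsE U hU V hV hc t ⟨hlt, ht.2⟩]; exact (hED U hU V hV hc).1
  have hIoc : ∀ U ∈ 𝓤, ∀ V ∈ 𝓤, Consecutive (m '' 𝓤) (m U) (m V) →
      ⋃ t ∈ Ioc (m U) (m V), localSet dl h₀ l₀ t = D V := fun U hU V hV hc => by
    refine subset_antisymm (iUnion₂_subset fun t ht => ?_) fun x hx =>
      mem_iUnion₂.2 ⟨m V, ⟨hc.2.2.1, le_rfl⟩, (hlsD V hV).symm ▸ hx⟩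
    rcases ht.2.eq_or_lt with rfl | hlt
    · exact (hlsD V hV).subset
    · rw [hlsE U hU V hV hc t ⟨ht.1, hlt⟩]; exact (hED U hU V hV hc).2
  have hIoo : ∀ U ∈ 𝓤, ∀ V ∈ 𝓤, Consecutive (m '' 𝓤) (m U) (m V) →
      ⋃ t ∈ Ioo (m U) (m V), localSet dl h₀ l₀ t = E U V := fun U hU V hV hc => by
    obtain ⟨t, ht⟩ := exists_between hc.2.2.1
    exact subset_antisymm (iUnion₂_subset fun t ht => (hlsE U hU V hV hc t ht).subset) fun x hx =>
      mem_iUnion₂.2 ⟨t, ht, (hlsE U hU V hV hc t ht).symm ▸ hx⟩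
  refine ⟨κ, rfl, h.mid_injOn, ?_, ?_, ?_, ?_, ?_, ?_, ?_, ?_⟩
  · intro U hU V hV hUV hne
    rcases h.ordered U hU V hV hUV with a | a
    · exact Or.inl ((h.consecutive_mid_iff hU hV).2 ⟨a, fun W hW => h.not_between hU hV hne hW⟩)
    · rw [inter_comm] at hne
      exact Or.inr ((h.consecutive_mid_iff hV hU).2 ⟨a, fun W hW => h.not_between hV hU hne hW⟩)
  · exact fun U hU V hV W hW h1 h2 h3 z h4 h5 h6 => h.not_triple hU hV hW h1 h2 h3 h4 h5 h6
  · intro U hU p q hp hq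
    rw [hf U hU]
    have hS : ⋃ t ∈ ({m U} : Set ℝ), localSet dl h₀ l₀ t = D U := by
      rw [biUnion_singleton]; exact hlsD U hU
    exact hk.joinedIn_iff_of_crit M hT ordConnected_singleton hS inter_subset_left
      inter_subset_right (hNo U) (hNc U) (ordConnected_realIoo _ _)
      (OrderedCover.ordConnected_hull _ _) (hN₁ U hU) (hN₂ U hU) hp hq (hκN p U hU hp).1
      (hκN q U hU hq).1 (hκN p U hU hp).2 (hκN q U hU hq).2
  · intro U hU x hx
    rw [hf U hU]
    exact hk.exists_of_crit M hT (hlsD U hU) inter_subset_left inter_subset_right (hNn U hU) (hNo U)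
      (hNc U) (ordConnected_realIoo _ _) (OrderedCover.ordConnected_hull _ _) (hN₁ U hU) (hN₂ U hU)
      (fun p hp => hκN p U hU hp) ((h.mem_hull_iff hU ⟨x, rfl⟩).2 hx)
  · intro U hU V hV hc p q hp hq
    rw [preimage_inter, hf U hU, hf V hV, ← preimage_inter]
    exact hk.joinedIn_iff_of_crit M hT ordConnected_Ioo (hIoo U hU V hV hc) inter_subset_left
      inter_subset_right (hFo U V) (hFc U V) (ordConnected_realIoo _ _) (hhh U V)
      (hF₁ U hU V hV hc) (hF₂ U hU V hV) hp hq (hκE p U hU V hV hc hp).1 (hκE q U hU V hV hc hq).1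
      (hκE p U hU V hV hc hp).2 (hκE q U hU V hV hc hq).2
  · intro U hU V hV hc x hx
    rw [preimage_inter, hf U hU, hf V hV, ← preimage_inter]
    obtain ⟨t, ht⟩ := exists_between hc.2.2.1
    obtain ⟨p, hp, hpx⟩ := hk.exists_of_crit M hT (hlsE U hU V hV hc t ht) inter_subset_left
      inter_subset_right (hFn U hU V hV hc) (hFo U V) (hFc U V) (ordConnected_realIoo _ _) (hhh U V)
      (hF₁ U hU V hV hc) (hF₂ U hU V hV) (κ := κ)
      (fun p hp => hκE p U hU V hV hc (by rw [hp]; exact ht))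
      (x := x) ⟨(h.mem_hull_iff hU ⟨x, rfl⟩).2 hx.1, (h.mem_hull_iff hV ⟨x, rfl⟩).2 hx.2⟩
    exact ⟨p, by rw [hp]; exact ht, hpx⟩
  · intro U hU V hV hc p q hp hq
    rw [hf U hU]
    -- The image of `q` was chosen over `F U V`, which is contained in `N U`, so it also serves as a
    -- representative for the node.
    have hq' := hκE q U hU V hV hc hq
    have hsub := hED U hU V hV hc
    exact hk.joinedIn_iff_of_crit M hT ordConnected_Ico (hIco U hU V hV hc) inter_subset_left
      inter_subset_right (hNo U) (hNc U) (ordConnected_realIoo _ _)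
      (OrderedCover.ordConnected_hull _ _) (hN₁ U hU) (hN₂ U hU)
      (by rw [hp]; exact ⟨le_rfl, hc.2.2.1⟩) ⟨hq.1.le, hq.2⟩ (hκN p U hU hp).1
      ⟨hsub.1 hq'.1.1, hq'.1.2.1⟩ (hκN p U hU hp).2 (hq'.2.mono (preimage_mono hsub.1))
  · intro U hU V hV hc p q hp hq
    rw [hf V hV]
    have hq' := hκE q U hU V hV hc hq
    have hsub := hED U hU V hV hc
    exact hk.joinedIn_iff_of_crit M hT ordConnected_Ioc (hIoc U hU V hV hc) inter_subset_left
      inter_subset_right (hNo V) (hNc V) (ordConnected_realIoo _ _)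
      (OrderedCover.ordConnected_hull _ _) (hN₁ V hV) (hN₂ V hV)
      (by rw [hp]; exact ⟨hc.2.2.1, le_rfl⟩) ⟨hq.1, hq.2.le⟩ (hκN p V hV hp).1
      ⟨hsub.2 hq'.1.1, hq'.1.2.2⟩ (hκN p V hV hp).2 (hq'.2.mono (preimage_mono hsub.2))

theorem mainTheorem1 {X : Type u} [TopologicalSpace X] [T2Space X] (f : X → ℝ) (M : MorseType f)
    (hf : Bornology.IsBounded (range f)) (𝓤 : Set (Set ℝ)) (h𝓤 : IsGomic (range f) 𝓤)
    (P : Perturbation M 𝓤) :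
    (∀ p : MultiNerveMapper f 𝓤, p.F.card ≤ 2) ∧
      Nonempty (Multigraph.Iso (Multinerve.graph (pullbackCover f 𝓤))
        (combReeb P.telescope.height {c | c ∈ P.telescope.crit})) := by
  have hZ : IsCompact (range f) := Metric.isCompact_of_isClosed_isBounded M.isClosed_range hf
  obtain ⟨κ, H⟩ := P.exists_comparison (h𝓤.orderedCover hZ P.list'_spec)
  exact ⟨H.card_le_two, H.nonempty_iso⟩
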